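/- **Conventions.** All groups $S, X, \Sigma$ are finite. Let $\mathbb{Q}^{ab}\subseteq\mathbb{C}$ be the field generated by all roots of unity, $\mathcal{G}=\operatorname{Gal}(\mathbb{Q}^{ab}/\mathbb{Q})$ and let $\mathcal{J}\le\mathcal{G}$ be a subgroup. If a group $A$ acts on a group $N$ by automorphisms, $A\times\mathcal{J}$ acts on $\operatorname{Irr}(N)$ by moving arguments and applying $\sigma\in\mathcal{J}$ to values; $(A\times\mathcal{J})_\theta$ and $A_\theta$ denote stabilizers of $\theta$, and $A_{\theta^{\mathcal{J}}}$ is the stabilizer of the $\mathcal{J}$-orbit of $\theta$. A *$\mathcal{J}$-triple* $(G,N,\theta)_{\mathcal{J}}$ consists of $N\trianglelefteq G$ and $\theta\in\operatorname{Irr}(N)$ such that the $G$-orbit of $\theta$ is contained in its $\mathcal{J}$-orbit. A projective representation $\mathcal{P}:G_\theta\to \operatorname{GL}_{\theta(1)}(\mathbb{C})$ with factor set $\alpha$, $\mathcal{P}(gh)=\alpha(g,h)\mathcal{P}(g)\mathcal{P}(h)$, is *associated with $\theta$* if $\mathcal{P}|_N$ is a representation affording $\theta$ and $\mathcal{P}(ng)=\mathcal{P}(n)\mathcal{P}(g)$,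 $\mathcal{P}(gn)=\mathcal{P}(g)\mathcal{P}(n)$ for $n\in N$, $g\in G_\theta$. If it has entries in $\mathbb{Q}^{ab}$ and $a=(g,\sigma)\in G\times\mathcal{J}$ fixes $\theta$, there is a unique $\mu_a:G_\theta\to\mathbb{C}^\times$ with $\mu_a(1)=1$, constant on cosets of $N$, such that $x\mapsto \mathcal{P}(gxg^{-1})^\sigma$ is similar to $\mu_a\mathcal{P}$. For $\mathcal{J}$-triples $(G,N,\theta)_{\mathcal{J}}$ and $(H,M,\varphi)_{\mathcal{J}}$ with $H\le G$, write $(G,N,\theta)_{\mathcal{J}}\succeq_{\mathbf c}(H,M,\varphi)_{\mathcal{J}}$ if: (i) $G=NH$, $N\cap H=M$ and $\mathbf{C}_G(N)\subseteq H$; (ii) $(H\times\mathcal{J})_\theta=(H\times\mathcal{J})_\varphi$; (iii) there are projective representations $\mathcal{P},\mathcal{P}'$ associated with $(G_\theta,N,\theta)$ and $(H_\varphi,M,\varphi)$, with entries in $\mathbb{Q}^{ab}$ and factor sets $\alpha,\alpha'$ taking roots of unity as values, such that $\alpha_{H_\theta\times H_\theta}=\alpha'$ and, for each $c\in\mathbf{C}_G(N)$,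 $\mathcal{P}(c)$ and $\mathcal{P}'(c)$ are scalar matrices with the same scalar; (iv) for these $\mathcal{P},\mathcal{P}'$ and every $a\in(H\times\mathcal{J})_\theta$, the corresponding functions $\mu_a$ and $\mu'_a$ agree on $H_\theta$. **Theorem.** Let $S$ be a non-abelian finite simple group, $X$ a universal covering group of $S$ and $\chi\in\operatorname{Irr}(X)$. Let $U<X$ be a proper subgroup with $\mathbf{N}_X(U)=U$ that is intravariant in $X$ (for every $\delta\in\operatorname{Aut}(X)$ there is $x\in X$ with $U^\delta=U^x$). Let $\Gamma=\operatorname{Aut}(X)_U=\{\delta\in\operatorname{Aut}(X): U^\delta=U\}$ and let $\mu\in\operatorname{Irr}(U)$ be such that $(\Gamma\times\mathcal{J})_\chi=(\Gamma\times\mathcal{J})_\mu$. Let $\Sigma$ be a finite group containing $X$ as a normal subgroup such that the conjugation action of $\Delta:=\mathbf{N}_\Sigma(U)$ on $X$ induces the subgroup $\Gamma_{\chi^{\mathcal{J}}}$ of $\operatorname{Aut}(X)$. Assume that, for a prime $p$, $\Sigma/X$ has a normal $p$-complement $K/X$ such that $\mathbf{C}_\Sigma(X)\subseteq\mathbf{C}_\Sigma(K_\chi)$,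 and that $\chi$ extends to a character $\chi^*\in\operatorname{Irr}(K_\chi)$ such that $(\Sigma,K_\chi,\chi^*)_{\mathcal{J}}$ is a $\mathcal{J}$-triple and $(\Delta\times\mathcal{J})_\chi=(\Delta\times\mathcal{J})_{\chi^*}$. Assume that $\mu$ extends to a character $\mu^*\in\operatorname{Irr}(K\cap\Delta_\mu)$ such that $(\Delta,K\cap\Delta_\mu,\mu^*)_{\mathcal{J}}$ is a $\mathcal{J}$-triple and $(\Delta\times\mathcal{J})_\mu=(\Delta\times\mathcal{J})_{\mu^*}$. Finally, assume that the multiplicity $[\chi^*_{\Delta_\mu\cap K},\mu^*]$ is coprime to $p$. Then $$(X\rtimes\Gamma_{\chi^{\mathcal{J}}},X,\chi)_{\mathcal{J}}\succeq_{\mathbf c}(U\rtimes\Gamma_{\chi^{\mathcal{J}}},U,\mu)_{\mathcal{J}}.$$ -/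

import Mathlib

universe u

open scoped Pointwise

noncomputable section

/-! ### The field `ℚ^ab` and its Galois group -/

/-- `ℚ^ab`: the subfield of `ℂ` generated by all roots of unity. -/
def Qab : IntermediateField ℚ ℂ :=
  IntermediateField.adjoin ℚ {z : ℂ | ∃ n : ℕ, 0 < n ∧ z ^ n = 1}

/-- `Gal(ℚ^ab/ℚ)`. -/
abbrev GalQab : Type := Qab ≃ₐ[ℚ] Qab

open Classical in
/-- The action of `σ ∈ Gal(ℚ^ab/ℚ)` on numbers.  It is only used on elements of `ℚ^ab` (character
values, entries of matrices over `ℚ^ab`); by convention the other complex numbers are fixed. -/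
def galAct (σ : GalQab) (z : ℂ) : ℂ :=
  if h : z ∈ Qab then ((σ ⟨z, h⟩ : Qab) : ℂ) else z

theorem galAct_coe (σ : GalQab) (z : Qab) : galAct σ (z : ℂ) = ((σ z : Qab) : ℂ) := by
  simp [galAct]

theorem galAct_one (z : ℂ) : galAct 1 z = z := by
  unfold galAct
  split_ifs <;> simp

theorem galAct_mul (σ τ : GalQab) (z : ℂ) : galAct (σ * τ) z = galAct σ (galAct τ z) := by
  by_cases h : z ∈ Qab
  · lift z to Qab using h
    simp only [galAct_coe, AlgEquiv.mul_apply]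
  · simp [galAct, h]

theorem galAct_inv_self (σ : GalQab) (z : ℂ) : galAct σ⁻¹ (galAct σ z) = z := by
  rw [← galAct_mul, inv_mul_cancel, galAct_one]

/-! ### Characters -/

/-- `θ ∈ Irr(G)`: `θ` is the character of an irreducible complex representation of `G`. -/
def IsIrrChar {G : Type*} [Group G] (θ : G → ℂ) : Prop :=
  ∃ (n : ℕ) (ρ : Representation ℂ G (Fin n → ℂ)), ρ.IsIrreducible ∧ ρ.character = θ

/-- The inner product `[f, g] = |G|⁻¹ ∑ f(x) \overline{g(x)}` for a finite group `G`. -/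
def charInner {G : Type*} [Group G] (f g : G → ℂ) : ℂ :=
  (∑ᶠ x : G, f x * starRingEnd ℂ (g x)) / (Nat.card G : ℂ)

section Actions

variable {A N : Type*} [Group A] [Group N]

/-- If `A` acts on `N` by automorphisms, this is the stabilizer `A_θ` of the function `θ`. -/
def charStab (act : A →* MulAut N) (θ : N → ℂ) : Subgroup A where
  carrier := {a | ∀ x, θ (act a x) = θ x}
  one_mem' := by simp
  mul_mem' := by
    intro a b ha hb x
    rw [map_mul, MulAut.mul_apply, ha, hb]
  inv_mem' := by
    intro a ha x
    have h := ha (act a⁻¹ x)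
    rw [← MulAut.mul_apply, ← map_mul, mul_inv_cancel, map_one, MulAut.one_apply] at h
    exact h.symm

/-- The stabilizer `(A × J)_θ` for the action `θ^(a,σ) (x) = σ (θ (a x))`. -/
def pairStab (act : A →* MulAut N) (J : Subgroup GalQab) (θ : N → ℂ) : Set (A × GalQab) :=
  {a | a.2 ∈ J ∧ ∀ x, galAct a.2 (θ (act a.1 x)) = θ x}

/-- The stabilizer in `A` of the `J`-orbit of `θ`.  As the actions of `A` and `J` commute, `a ∈ A`
stabilizes the orbit if and only if `θ^a = θ^σ` for some `σ ∈ J`. -/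
def orbitStab (act : A →* MulAut N) (J : Subgroup GalQab) (θ : N → ℂ) : Subgroup A where
  carrier := {a | ∃ σ ∈ J, ∀ x, θ (act a x) = galAct σ (θ x)}
  one_mem' := ⟨1, J.one_mem, by simp [galAct_one]⟩
  mul_mem' := by
    rintro a b ⟨σ, hσ, ha⟩ ⟨τ, hτ, hb⟩
    refine ⟨σ * τ, J.mul_mem hσ hτ, fun x => ?_⟩
    rw [map_mul, MulAut.mul_apply, ha, hb, galAct_mul]
  inv_mem' := by
    rintro a ⟨σ, hσ, ha⟩
    refine ⟨σ⁻¹, J.inv_mem hσ, fun x => ?_⟩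
    have h := ha (act a⁻¹ x)
    rw [← MulAut.mul_apply, ← map_mul, mul_inv_cancel, map_one, MulAut.one_apply] at h
    rw [h, galAct_inv_self]

end Actions

/-! ### Triples and projective representations -/

section Triples

variable {G : Type*} [Group G]

/-- `(G, N, θ)_J` is a `J`-triple: `N ⊴ G`, `θ ∈ Irr(N)`, and the `G`-orbit of `θ` is contained in
the `J`-orbit of `θ`. -/
structure IsGTriple (J : Subgroup GalQab) (N : Subgroup G) [N.Normal] (θ : N → ℂ) : Prop where
  irr : IsIrrChar θ
  orbit : ∀ g : G, ∃ σ ∈ J, ∀ x : N, θ (MulAut.conjNormal g x) = galAct σ (θ x)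

/-- The stabilizer `G_θ` of a function `θ` on a normal subgroup `N` of `G`. -/
abbrev inertia (N : Subgroup G) [N.Normal] (θ : N → ℂ) : Subgroup G :=
  charStab (MulAut.conjNormal : G →* MulAut N) θ

/-- `P` is a projective representation of `T` with factor set `α`:
`P(gh) = α(g,h) P(g) P(h)`. -/
def IsProjRep {T : Type*} [Group T] {d : ℕ} (P : T → GL (Fin d) ℂ) (α : T → T → ℂˣ) : Prop :=
  ∀ g h : T, (P (g * h) : Matrix (Fin d) (Fin d) ℂ) =
    (α g h : ℂ) • ((P g : Matrix (Fin d) (Fin d) ℂ) * (P h : Matrix (Fin d) (Fin d) ℂ))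

/-- The map `P` on `G_θ` restricts to a representation of `N` affording `θ`, and
`P(ng) = P(n)P(g)`, `P(gn) = P(g)P(n)` for `n ∈ N`, `g ∈ G_θ`. -/
structure IsAssociated (N : Subgroup G) [N.Normal] (θ : N → ℂ) {d : ℕ}
    (P : inertia N θ → GL (Fin d) ℂ) : Prop where
  affords : ∀ (g : inertia N θ) (n : N), (g : G) = n →
    Matrix.trace (P g : Matrix (Fin d) (Fin d) ℂ) = θ n
  mul_left : ∀ n g : inertia N θ, (n : G) ∈ N → P (n * g) = P n * P g
  mul_right : ∀ g n : inertia N θ, (n : G) ∈ N → P (g * n) = P g * P n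

/-- Entries in `ℚ^ab`, and a factor set whose values are roots of unity. -/
structure IsCyclotomic {T : Type*} {d : ℕ} (P : T → GL (Fin d) ℂ) (α : T → T → ℂˣ) : Prop where
  entries : ∀ (g : T) (i j : Fin d), (P g : Matrix (Fin d) (Fin d) ℂ) i j ∈ Qab
  factors : ∀ g h : T, ∃ n : ℕ, 0 < n ∧ α g h ^ n = 1

/-- For `(g, σ)` fixing `θ`, the function `μ` on `G_θ` is the (unique) one with `μ(1) = 1`, constant
on cosets of `N`, such that `P^(gσ)`, given by `P^(gσ)(x) = P(g x g⁻¹)^σ`, is similar to `μ P`.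
(The group `G_θ` is normalized by `g`, so `y = g x g⁻¹` runs over `G_θ` with `x`.) -/
structure IsTwistFun (N : Subgroup G) [N.Normal] (θ : N → ℂ) {d : ℕ}
    (P : inertia N θ → GL (Fin d) ℂ) (g : G) (σ : GalQab) (μ : inertia N θ → ℂˣ) : Prop where
  one : μ 1 = 1
  const : ∀ n x : inertia N θ, (n : G) ∈ N → μ (n * x) = μ x
  similar : ∃ S : GL (Fin d) ℂ, ∀ x y : inertia N θ, (y : G) = g * x * g⁻¹ →
    (P y : Matrix (Fin d) (Fin d) ℂ).map (galAct σ) =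
      (S : Matrix (Fin d) (Fin d) ℂ) * ((μ x : ℂ) • (P x : Matrix (Fin d) (Fin d) ℂ)) *
        ((S⁻¹ : GL (Fin d) ℂ) : Matrix (Fin d) (Fin d) ℂ)

/-- The central order `(G, N, θ)_J ⪰_c (H, M, φ)_J` of `J`-triples, where `H ≤ G`, `M ⊴ H`.  Both
triples being `J`-triples is part of the relation. -/
structure CentralOrder (J : Subgroup GalQab) (N : Subgroup G) [N.Normal] (θ : N → ℂ)
    (H : Subgroup G) (M : Subgroup H) [M.Normal] (φ : M → ℂ) : Prop where
  triple : IsGTriple J N θ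
  triple' : IsGTriple J M φ
  sup : N ⊔ H = ⊤
  inf : N ⊓ H = M.map H.subtype
  centralizer_le : Subgroup.centralizer (N : Set G) ≤ H
  stab_eq : pairStab ((MulAut.conjNormal : G →* MulAut N).comp H.subtype) J θ =
    pairStab (MulAut.conjNormal : H →* MulAut M) J φ
  proj : ∃ (d e : ℕ) (P : inertia N θ → GL (Fin d) ℂ) (P' : inertia M φ → GL (Fin e) ℂ)
      (α : inertia N θ → inertia N θ → ℂˣ) (α' : inertia M φ → inertia M φ → ℂˣ),
    IsProjRep P α ∧ IsAssociated N θ P ∧ IsCyclotomic P α ∧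
    IsProjRep P' α' ∧ IsAssociated M φ P' ∧ IsCyclotomic P' α' ∧
    -- the restriction of `α` to `H_θ = H_φ` is `α'`
    (∀ (x y : inertia N θ) (x' y' : inertia M φ),
      (x : G) = (x' : H) → (y : G) = (y' : H) → α x y = α' x' y') ∧
    -- elements of `C_G(N)` act through the same scalars
    (∀ c ∈ Subgroup.centralizer (N : Set G), ∀ (x : inertia N θ) (x' : inertia M φ),
      (x : G) = c → ((x' : H) : G) = c → ∃ ζ : ℂ,
        (P x : Matrix (Fin d) (Fin d) ℂ) = ζ • (1 : Matrix (Fin d) (Fin d) ℂ) ∧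
        (P' x' : Matrix (Fin e) (Fin e) ℂ) = ζ • (1 : Matrix (Fin e) (Fin e) ℂ)) ∧
    -- the twisting functions agree on `H_θ`
    (∀ (h : H) (σ : GalQab),
      (h, σ) ∈ pairStab ((MulAut.conjNormal : G →* MulAut N).comp H.subtype) J θ →
      ∃ (μ : inertia N θ → ℂˣ) (μ' : inertia M φ → ℂˣ),
        IsTwistFun N θ P (h : G) σ μ ∧ IsTwistFun M φ P' h σ μ' ∧
        ∀ (x : inertia N θ) (x' : inertia M φ), (x : G) = (x' : H) → μ x = μ' x')

end Triples

/-! ### Automorphisms, covering groups and semidirect products -/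

/-- `X` is a universal covering group of `S`: there is a central extension `π : X → S` through
which every central extension of `S` factors in a unique way. -/
def IsUniversalCoveringGroup (X S : Type u) [Group X] [Group S] : Prop :=
  ∃ π : X →* S, Function.Surjective π ∧ π.ker ≤ Subgroup.center X ∧
    ∀ (E : Type u) [Group E] (ε : E →* S), Function.Surjective ε → ε.ker ≤ Subgroup.center E →
      ∃! f : X →* E, ε.comp f = π

section Aut

variable {X : Type*} [Group X]

/-- `U` is intravariant in `X`: every `Aut(X)`-conjugate of `U` is an `X`-conjugate. -/
def IsIntravariant (U : Subgroup X) : Prop :=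
  ∀ δ : MulAut X, ∃ x : X, δ • U = MulAut.conj x • U

/-- `Aut(X)_U`, the group of automorphisms `δ` of `X` with `δ(U) = U`. -/
abbrev autStab (U : Subgroup X) : Subgroup (MulAut X) :=
  MulAction.stabilizer (MulAut X) U

theorem autStab_apply_mem {U : Subgroup X} {γ : MulAut X} (hγ : γ ∈ autStab U) {u : X}
    (hu : u ∈ U) : γ u ∈ U := by
  have h : γ • u ∈ γ • U := Subgroup.smul_mem_pointwise_smul u γ U hu
  rw [MulAction.mem_stabilizer_iff.mp hγ] at h
  exact h

/-- The action of `Aut(X)_U` on `U` by restriction. -/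
def autRestrict (U : Subgroup X) : autStab U →* MulAut U where
  toFun γ :=
    { toFun := fun u => ⟨(γ : MulAut X) u, autStab_apply_mem γ.2 u.2⟩
      invFun := fun u => ⟨((γ⁻¹ : autStab U) : MulAut X) u, autStab_apply_mem (γ⁻¹).2 u.2⟩
      left_inv := fun u => by ext; simp
      right_inv := fun u => by ext; simp
      map_mul' := fun u v => by ext; simp }
  map_one' := by ext; simp
  map_mul' _ _ := by ext; simp

/-- `Γ_{χ^J}` for `Γ = Aut(X)_U`: the stabilizer in `Γ` of the `J`-orbit of `χ`. -/
def gammaOrbit (U : Subgroup X) (J : Subgroup GalQab) (χ : X → ℂ) : Subgroup (MulAut X) :=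
  autStab U ⊓ orbitStab (MonoidHom.id (MulAut X)) J χ

theorem gammaOrbit_le (U : Subgroup X) (J : Subgroup GalQab) (χ : X → ℂ) :
    gammaOrbit U J χ ≤ autStab U := inf_le_left

/-- The semidirect product `X ⋊ Λ` for a group `Λ` of automorphisms of `X`. -/
abbrev AutSemidirect (Λ : Subgroup (MulAut X)) : Type _ := X ⋊[Λ.subtype] Λ

/-- The normal subgroup `X` of `X ⋊ Λ`. -/
abbrev sdBase (Λ : Subgroup (MulAut X)) : Subgroup (AutSemidirect Λ) :=
  (SemidirectProduct.rightHom : AutSemidirect Λ →* Λ).ker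

/-- `χ` as a function on the subgroup `X` of `X ⋊ Λ`. -/
def sdBaseChar (Λ : Subgroup (MulAut X)) (χ : X → ℂ) : sdBase Λ → ℂ :=
  fun x => χ (x : AutSemidirect Λ).left

/-- The subgroup `U ⋊ Λ` of `X ⋊ Λ`, where `Λ` stabilizes `U`. -/
def sdSub (U : Subgroup X) (Λ : Subgroup (MulAut X)) (hΛ : Λ ≤ autStab U) :
    Subgroup (AutSemidirect Λ) where
  carrier := {g | g.left ∈ U}
  one_mem' := U.one_mem
  mul_mem' := by
    intro a b ha hb
    exact U.mul_mem ha (autStab_apply_mem (hΛ a.right.2) hb)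
  inv_mem' := by
    intro a ha
    exact autStab_apply_mem (hΛ (a.right⁻¹).2) (U.inv_mem ha)

/-- The normal subgroup `U` of `U ⋊ Λ`. -/
abbrev sdSubBase (U : Subgroup X) (Λ : Subgroup (MulAut X)) (hΛ : Λ ≤ autStab U) :
    Subgroup (sdSub U Λ hΛ) :=
  ((SemidirectProduct.rightHom : AutSemidirect Λ →* Λ).comp (sdSub U Λ hΛ).subtype).ker

/-- `μ` as a function on the subgroup `U` of `U ⋊ Λ`. -/
def sdSubBaseChar (U : Subgroup X) (Λ : Subgroup (MulAut X)) (hΛ : Λ ≤ autStab U) (μ : U → ℂ) :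
    sdSubBase U Λ hΛ → ℂ :=
  fun u => μ ⟨((u : sdSub U Λ hΛ) : AutSemidirect Λ).left, (u : sdSub U Λ hΛ).2⟩

end Aut

/-! ### The overgroup `Σ` of `X` -/

section Overgroup

variable {G : Type*} [Group G] (X : Subgroup G) [X.Normal] (U : Subgroup X)

/-- `N_G(U)` for a subgroup `U` of the normal subgroup `X` of `G`: the elements of `G` whose
conjugation action on `X` stabilizes `U`. -/
def normIn : Subgroup G := (autStab U).comap (MulAut.conjNormal : G →* MulAut X)

/-- The conjugation action of `N_G(U)` on `U`. -/
def normInAct : normIn X U →* MulAut U :=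
  (autRestrict U).comp ((MulAut.conjNormal : G →* MulAut X).subgroupComap (autStab U))

/-- The stabilizer `K_χ` in `K` of a function `χ` on `X`. -/
abbrev stabIn (K : Subgroup G) (χ : X → ℂ) : Subgroup G := K ⊓ inertia X χ

/-- `K ∩ Δ_μ` as a subgroup of `Δ = N_G(U)`. -/
abbrev stabInNorm (K : Subgroup G) (μ : U → ℂ) : Subgroup (normIn X U) :=
  K.subgroupOf (normIn X U) ⊓ charStab (normInAct X U) μ

theorem mem_normIn_iff (g : G) : g ∈ normIn X U ↔
    g ∈ Subgroup.normalizer ((U.map X.subtype : Subgroup G) : Set G) := by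
  have key : ∀ x : X, (x : G) ∈ U.map X.subtype ↔ x ∈ U := fun x =>
    Subgroup.mem_map_iff_mem X.subtype_injective (x := x)
  rw [Subgroup.mem_normalizer_iff]
  change (MulAut.conjNormal g : MulAut X) • U = U ↔ _
  constructor
  · intro h y
    constructor
    · rintro ⟨u, hu, rfl⟩
      have h' : (MulAut.conjNormal g : MulAut X) • u ∈ (MulAut.conjNormal g : MulAut X) • U :=
        Subgroup.smul_mem_pointwise_smul u _ U hu
      rw [h] at h'
      exact ⟨_, h', by simp⟩
    · rintro ⟨u, hu, hy⟩
      have hu' : u ∈ (MulAut.conjNormal g : MulAut X) • U := by rw [h]; exact hu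
      rw [Subgroup.mem_pointwise_smul_iff_inv_smul_mem] at hu'
      refine ⟨_, hu', ?_⟩
      have hy' : (u : G) = g * y * g⁻¹ := hy
      rw [← map_inv]
      simp [hy', mul_assoc]
  · intro h
    ext u
    rw [Subgroup.mem_pointwise_smul_iff_inv_smul_mem, ← key, ← key, h, ← map_inv]
    simp [mul_assoc]

end Overgroup

end

universe v

noncomputable section

/-! ### Operators with coefficients in `ℚ^ab` -/

/-! Write Δ = N_Σ(U) and M = K ∩ Δ_μ. The comparison is made inside Σ and moved to X ⋊ Γ_{χ^J} only
at the end. Intravariance of U gives Σ = XΔ, so the equality of stabilizers makes χ* invariant in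
Σ_χ and μ* invariant in Δ_μ. Hence there are projective extensions P of χ* to Σ_χ and Q of μ* to
Δ_μ, with entries in ℚ^ab and factor sets α, α' of finite order (`exists_isProjExt`).

Let W be the space of matrices T with P(y)T = TQ(y) for y ∈ M. Its dimension m is the multiplicity
[χ*_M, μ*]. An element x ∈ Δ_μ acts on W by T ↦ P(x)TQ(x)⁻¹. This is a projective action with factor
set α/α', trivial on M. The index of M in Δ_μ is a power of p, hence prime to m, and this is what
makes everything work. After normalizing determinants the factor set has values in the m-th roots of
unity, while its |Δ_μ : M|-th power is a coboundary, so it is itself a coboundary. Absorbing the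
correction into Q turns the action into a homomorphism with values of determinant one
(`exists_rescale_det_eq_one`, `exists_isMatched`).

The three required equalities follow. The factor sets agree because the action on W is a genuine
one. If P(c) = a and Q(c) = b are scalars, then a/b has m-th power one by the determinant, and |Δ_μ
: M|-th power one because that power of c lies in M, so a = b. For a pair (h, σ) fixing χ, the
similarities for P and Q induce a σ-semilinear bijection of W. It shows that the quotient of the two
twist functions is a homomorphism, trivial on M, with m-th power one, hence trivial
(`IsMatched.twist_eq`).

For the transfer, each element of X ⋊ Γ_{χ^J} is lifted to an element of Σ inducing the same
automorphism of X (`IsLift`). Two such lifts differ by an element of C_Σ(X), on which P and Q are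
the same scalar, so the equalities survive (`exists_factor_lift`, `exists_twist_lift`).

Entries in ℚ^ab rest on Brauer's theorem that an irreducible representation ρ of a finite group G is
realizable over ℚ^ab (`exists_basis_repr_mem_Qab`). The ℚ^ab-algebra spanned by ρ(G) is semisimple
and isotypic, so the ranks of its elements are multiples of a minimal rank r, and r = 1 gives the
realization. If a prime q divided r, then q would divide all multiplicities in restrictions of ρ to
q-hyperelementary subgroups, because irreducible representations of those groups have rank one
operators over ℚ^ab. A congruence argument with permutation characters on cosets of hyperelementary
subgroups then contradicts [ρ, ρ] = 1 (`exists_not_dvd_finrank_range_qabOp`). -/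

theorem mem_Qab_of_pow_eq_one {z : ℂ} {n : ℕ} (hn : 0 < n) (h : z ^ n = 1) : z ∈ Qab :=
  IntermediateField.subset_adjoin _ _ ⟨n, hn, h⟩

namespace Representation

open Module

section Operators

variable {G V W : Type*} [Group G] [AddCommGroup V] [Module ℂ V] [AddCommGroup W] [Module ℂ W]

/-- The action of the group algebra over `ℚ^ab` on a complex representation. -/
def qabOp (ρ : Representation ℂ G V) : MonoidAlgebra Qab G →ₐ[Qab] Module.End ℂ V :=
  MonoidAlgebra.lift Qab _ G ρ

@[simp]
theorem qabOp_single (ρ : Representation ℂ G V) (g : G) (a : Qab) :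
    ρ.qabOp (MonoidAlgebra.single g a) = (a : ℂ) • ρ g := by
  simp only [qabOp, MonoidAlgebra.lift_single]
  rfl

theorem qabOp_sum (ρ : Representation ℂ G V) [Fintype G] (c : G → Qab) :
    ρ.qabOp (∑ g, MonoidAlgebra.single g (c g)) = ∑ g, (c g : ℂ) • ρ g := by
  simp

theorem qabOp_intertwining {ρ : Representation ℂ G V} {σ : Representation ℂ G W}
    (f : V →ₗ[ℂ] W) (hf : ∀ g, f ∘ₗ ρ g = σ g ∘ₗ f) (x : MonoidAlgebra Qab G) :
    f ∘ₗ ρ.qabOp x = σ.qabOp x ∘ₗ f := by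
  induction x using MonoidAlgebra.induction_linear with
  | zero => simp
  | add x y hx hy => simp only [map_add, LinearMap.comp_add, LinearMap.add_comp, hx, hy]
  | single g a => simp only [qabOp_single, LinearMap.comp_smul, LinearMap.smul_comp, hf]

theorem qabOp_prod (ρ : Representation ℂ G V) (σ : Representation ℂ G W)
    (x : MonoidAlgebra Qab G) :
    (ρ.prod σ).qabOp x = (ρ.qabOp x).prodMap (σ.qabOp x) := by
  induction x using MonoidAlgebra.induction_linear with
  | zero => ext <;> simp
  | add x y hx hy => simp only [map_add, hx, hy]; ext <;> simp
  | single g a => simp only [qabOp_single]; ext <;> simp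

theorem qabOp_comp {H : Type*} [Group H] (ρ : Representation ℂ G V) (f : H →* G)
    (x : MonoidAlgebra Qab H) :
    Representation.qabOp (ρ.comp f) x = ρ.qabOp (MonoidAlgebra.mapDomain f x) := by
  induction x using MonoidAlgebra.induction_linear with
  | zero => simp
  | add x y hx hy => simp only [map_add, hx, hy, MonoidAlgebra.mapDomain_add]
  | single g a => simp

end Operators

/-! ### Character values as sums of roots of unity -/

section Characters

variable {G V : Type*} [Group G] [AddCommGroup V] [Module ℂ V] [FiniteDimensional ℂ V]

theorem pow_card_eq_one_of_mem_roots_charpoly (ρ : Representation ℂ G V) (g : G) {z : ℂ}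
    (hz : z ∈ (ρ g).charpoly.roots) : z ^ Nat.card G = 1 := by
  have h1 : End.HasEigenvalue (ρ g) z := by
    rw [End.hasEigenvalue_iff_isRoot_charpoly]
    exact Polynomial.isRoot_of_mem_roots hz
  obtain ⟨v, hv⟩ := h1.exists_hasEigenvector
  have h2 := hv.pow_apply (Nat.card G)
  rw [← map_pow, pow_card_eq_one', map_one, End.one_apply] at h2
  have h3 : (z ^ Nat.card G - 1) • v = 0 := by rw [sub_smul, one_smul, ← h2, sub_self]
  exact sub_eq_zero.mp ((smul_eq_zero.mp h3).resolve_right hv.2)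

theorem character_mem_Qab [Finite G] (ρ : Representation ℂ G V) (g : G) : ρ.character g ∈ Qab := by
  rw [character, End.trace_eq_sum_roots_charpoly_of_splits (IsAlgClosed.splits _)]
  exact multiset_sum_mem _ fun z hz =>
    mem_Qab_of_pow_eq_one Nat.card_pos (ρ.pow_card_eq_one_of_mem_roots_charpoly g hz)

theorem isIntegral_character [Finite G] (ρ : Representation ℂ G V) (g : G) : IsIntegral ℤ (ρ.character g) := by
  rw [character, End.trace_eq_sum_roots_charpoly_of_splits (IsAlgClosed.splits _)]
  refine IsIntegral.multiset_sum fun z hz => ?_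
  have h := ρ.pow_card_eq_one_of_mem_roots_charpoly g hz
  exact IsIntegral.of_pow Nat.card_pos (h ▸ isIntegral_one)

end Characters

/-! ### Complete reducibility as an induction principle -/

section Induction

variable {G : Type*} [Group G] [Finite G]

/-- A property of finite-dimensional complex representations that is invariant under isomorphism,
closed under direct sums, and holds for irreducible representations holds in general. -/
theorem induction_on_irreducible
    {P : ∀ (W : Type u) [AddCommGroup W] [Module ℂ W] [FiniteDimensional ℂ W]
      (_ : Representation ℂ G W), Prop}
    (subsingleton : ∀ (W : Type u) [AddCommGroup W] [Module ℂ W] [FiniteDimensional ℂ W]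
      (ρ : Representation ℂ G W), Subsingleton W → P W ρ)
    (irreducible : ∀ (W : Type u) [AddCommGroup W] [Module ℂ W] [FiniteDimensional ℂ W]
      (ρ : Representation ℂ G W), ρ.IsIrreducible → P W ρ)
    (prod : ∀ (W W' : Type u) [AddCommGroup W] [Module ℂ W] [FiniteDimensional ℂ W]
      [AddCommGroup W'] [Module ℂ W'] [FiniteDimensional ℂ W']
      (ρ : Representation ℂ G W) (σ : Representation ℂ G W'), P W ρ → P W' σ →
        P (W × W') (ρ.prod σ))
    (equiv : ∀ (W W' : Type u) [AddCommGroup W] [Module ℂ W] [FiniteDimensional ℂ W]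
      [AddCommGroup W'] [Module ℂ W'] [FiniteDimensional ℂ W']
      (ρ : Representation ℂ G W) (σ : Representation ℂ G W'), ρ.Equiv σ → P W ρ → P W' σ)
    (W : Type u) [AddCommGroup W] [Module ℂ W] [FiniteDimensional ℂ W]
    (ρ : Representation ℂ G W) : P W ρ := by
  induction hn : finrank ℂ W using Nat.strong_induction_on generalizing W with
  | _ n ih =>
    rcases subsingleton_or_nontrivial W with hW | hW
    · exact subsingleton W ρ hW
    by_cases hirr : ρ.IsIrreducible
    · exact irreducible W ρ hirr
    obtain ⟨A, hA0, hA1⟩ : ∃ A : Subrepresentation ρ, A ≠ ⊥ ∧ A ≠ ⊤ := by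
      by_contra! h
      have : Nontrivial (Subrepresentation ρ) := ⟨⊥, ⊤, fun h' =>
        bot_ne_top (α := Submodule ℂ W) (congrArg Subrepresentation.toSubmodule h')⟩
      exact hirr ⟨fun A => or_iff_not_imp_left.mpr (h A)⟩
    obtain ⟨B, hAB⟩ := exists_isCompl A
    have hAB' : IsCompl A.toSubmodule B.toSubmodule := by
      constructor
      · rw [disjoint_iff]
        exact congrArg Subrepresentation.toSubmodule hAB.inf_eq_bot
      · rw [codisjoint_iff]
        exact congrArg Subrepresentation.toSubmodule hAB.sup_eq_top
    have hsum := Submodule.finrank_add_eq_of_isCompl hAB'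
    have hA : A.toSubmodule ≠ ⊤ := fun h => hA1 (Subrepresentation.toSubmodule_injective h)
    have hB : B.toSubmodule ≠ ⊤ := by
      intro h
      rw [h] at hAB'
      exact hA0 (Subrepresentation.toSubmodule_injective (eq_bot_of_isCompl_top hAB'))
    refine equiv _ _ (A.toRepresentation.prod B.toRepresentation) ρ
      (Equiv.mk (Submodule.prodEquivOfIsCompl _ _ hAB') fun g => ?_)
      (prod _ _ _ _ (ih _ ?_ _ A.toRepresentation rfl) (ih _ ?_ _ B.toRepresentation rfl))
    · ext w
      · simp [Subrepresentation.toRepresentation]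
      · simp [Subrepresentation.toRepresentation]
    · rw [← hn]; exact Submodule.finrank_lt hA
    · rw [← hn]; exact Submodule.finrank_lt hB

end Induction

end Representation

namespace Representation

open Module

/-! ### Rank one operators for hyperelementary groups -/

section Hyperelementary

variable {G V : Type*} [Group G] [AddCommGroup V] [Module ℂ V]

/-- The subspace `W` is stable under the subgroup `L`, and irreducible as an `L`-representation. -/
structure IsIrrSubspace (ρ : Representation ℂ G V) (L : Subgroup G) (W : Submodule ℂ V) :
    Prop where
  stable : ∀ l ∈ L, ∀ w ∈ W, ρ l w ∈ W
  ne_bot : W ≠ ⊥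
  eq_of_le : ∀ W' ≤ W, (∀ l ∈ L, ∀ w ∈ W', ρ l w ∈ W') → W' ≠ ⊥ → W' = W

/-- The element `g` acts on the subspace `W` as a scalar. -/
def IsScalarOn (ρ : Representation ℂ G V) (W : Submodule ℂ V) (g : G) : Prop :=
  ∃ z : ℂ, ∀ w ∈ W, ρ g w = z • w

variable {ρ : Representation ℂ G V} {L : Subgroup G} {W : Submodule ℂ V}

theorem IsIrrSubspace.finrank_eq_one (h : ρ.IsIrrSubspace L W)
    (hs : ∀ l ∈ L, ρ.IsScalarOn W l) : finrank ℂ W = 1 := by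
  obtain ⟨w, hw, hw0⟩ := W.exists_mem_ne_zero_of_ne_bot h.ne_bot
  have h1 : Submodule.span ℂ {w} = W := by
    refine h.eq_of_le _ ((Submodule.span_singleton_le_iff_mem _ _).mpr hw) ?_ ?_
    · intro l hl v hv
      obtain ⟨z, hz⟩ := hs l hl
      rw [hz v ((Submodule.span_singleton_le_iff_mem _ _).mpr hw hv)]
      exact Submodule.smul_mem _ _ hv
    · simpa using hw0
  rw [← h1, finrank_span_singleton hw0]

variable [Finite G]

/-- A Clifford step. Pass from W to an eigenspace of `a` in W and from L to the stabilizer of that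
eigenspace. Conjugates of `a` are scalar multiples of powers of `a` on W, so L permutes the
eigenspaces in a controlled way. The eigenprojector has coefficients in ℚ^ab because eigenvalues are
roots of unity. -/
theorem IsIrrSubspace.exists_lt [FiniteDimensional ℂ V] (h : ρ.IsIrrSubspace L W) {x : MonoidAlgebra Qab G}
    (hx : LinearMap.range (ρ.qabOp x) = W) {a : G} (ha : a ∈ L) (hna : ¬ ρ.IsScalarOn W a)
    (hconj : ∀ l ∈ L, ∃ (z : ℂ) (i : ℕ), ∀ w ∈ W, ρ (l⁻¹ * a * l) w = z • (ρ a ^ i) w) :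
    ∃ L' < L, ∃ (W' : Submodule ℂ V) (x' : MonoidAlgebra Qab G), ρ.IsIrrSubspace L' W' ∧
      LinearMap.range (ρ.qabOp x') = W' := by
  have hWnt : Nontrivial W := Submodule.nontrivial_iff_ne_bot.mpr h.ne_bot
  obtain ⟨t, ht⟩ := End.exists_eigenvalue ((ρ a).restrict (h.stable a ha))
  obtain ⟨w₀, hw₀⟩ := ht.exists_hasEigenvector
  have hw₀e : ρ a w₀ = t • (w₀ : V) := congrArg Subtype.val hw₀.apply_eq_smul
  have hw₀0 : (w₀ : V) ≠ 0 := fun h0 => hw₀.2 (Subtype.ext h0)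
  set n := Nat.card G with hn
  have hn0 : 0 < n := Nat.card_pos
  have hTn : ρ a ^ n = 1 := by rw [← map_pow, pow_card_eq_one', map_one]
  have htn : t ^ n = 1 := by
    have h2 : ∀ j : ℕ, (ρ a ^ j) (w₀ : V) = t ^ j • (w₀ : V) := by
      intro j
      induction j with
      | zero => simp
      | succ j ih => rw [pow_succ', End.mul_apply, ih, map_smul, hw₀e, smul_smul, pow_succ]
    have h3 := h2 n
    rw [hTn, End.one_apply] at h3
    have h4 : (t ^ n - 1) • (w₀ : V) = 0 := by rw [sub_smul, one_smul, ← h3, sub_self]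
    exact sub_eq_zero.mp ((smul_eq_zero.mp h4).resolve_right hw₀0)
  have ht0 : t ≠ 0 := by
    rintro rfl
    rw [zero_pow hn0.ne'] at htn
    exact zero_ne_one htn
  set S : End ℂ V := t⁻¹ • ρ a with hS
  have hSn : S ^ n = 1 := by rw [hS, smul_pow, hTn, inv_pow, htn, inv_one, one_smul]
  -- As (t⁻¹ρ(a))ⁿ = 1, this is n times the projector onto the t-eigenspace of ρ(a).
  set E : End ℂ V := ∑ j ∈ Finset.range n, S ^ j with hE
  have hSE : S * E = E := by
    have := mul_geom_sum S n
    rw [hSn, sub_self, sub_mul, one_mul, sub_eq_zero] at this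
    exact this
  have hES : E * S = E := by
    have := geom_sum_mul S n
    rw [hSn, sub_self, mul_sub, mul_one, sub_eq_zero] at this
    exact this
  have htQ : t⁻¹ ∈ Qab := mem_Qab_of_pow_eq_one hn0 (by rw [inv_pow, htn, inv_one])
  let y : MonoidAlgebra Qab G :=
    ∑ j ∈ Finset.range n, MonoidAlgebra.single (a ^ j) ((⟨t⁻¹, htQ⟩ : Qab) ^ j)
  have hy : ρ.qabOp y = E := by
    simp only [y, map_sum, qabOp_single, hE, hS, smul_pow, map_pow]
    rfl
  have hS_iff : ∀ (v : V) (s : ℂ), ρ a v = s • v → S v = (t⁻¹ * s) • v := by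
    intro v s hv
    rw [hS, LinearMap.smul_apply, hv, smul_smul]
  have hE_fix : ∀ v : V, ρ a v = t • v → E v = (n : ℂ) • v := by
    intro v hv
    have h1 : S v = v := by rw [hS_iff v t hv, inv_mul_cancel₀ ht0, one_smul]
    have h2 : ∀ j : ℕ, (S ^ j) v = v := by
      intro j
      induction j with
      | zero => simp
      | succ j ih => rw [pow_succ', End.mul_apply, ih, h1]
    rw [hE, LinearMap.sum_apply, Finset.sum_congr rfl fun j _ => h2 j, Finset.sum_const,
      Finset.card_range, Nat.cast_smul_eq_nsmul]
  have hE_kill : ∀ (v : V) (s : ℂ), ρ a v = s • v → s ≠ t → E v = 0 := by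
    intro v s hv hs
    have h1 : E v = (t⁻¹ * s) • E v := by
      conv_lhs => rw [← hES, End.mul_apply, hS_iff v s hv, map_smul]
    have h2 : (t⁻¹ * s - 1) • E v = 0 := by rw [sub_smul, one_smul, ← h1, sub_self]
    refine (smul_eq_zero.mp h2).resolve_left fun h3 => hs ?_
    rw [sub_eq_zero] at h3
    field_simp at h3
    exact h3
  have hEW : ∀ w ∈ W, E w ∈ W := by
    intro w hw
    rw [hE, LinearMap.sum_apply]
    refine W.sum_mem fun j _ => ?_
    rw [hS, smul_pow, ← map_pow]
    exact W.smul_mem _ (h.stable _ (L.pow_mem ha j) w hw)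
  set W₁ : Submodule ℂ V := W ⊓ End.eigenspace (ρ a) t with hW₁
  have mem_W₁ : ∀ v, v ∈ W₁ ↔ v ∈ W ∧ ρ a v = t • v := fun v => by
    rw [hW₁, Submodule.mem_inf, End.mem_eigenspace_iff]
  let L₁ : Subgroup G :=
    { carrier := {l | l ∈ L ∧ W₁.map (ρ l) = W₁}
      one_mem' := ⟨L.one_mem, by rw [map_one]; exact Submodule.map_id _⟩
      mul_mem' := by
        rintro l l' ⟨hl, h1⟩ ⟨hl', h2⟩
        refine ⟨L.mul_mem hl hl', ?_⟩
        rw [map_mul, Module.End.mul_eq_comp, Submodule.map_comp, h2, h1]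
      inv_mem' := by
        rintro l ⟨hl, h1⟩
        refine ⟨L.inv_mem hl, ?_⟩
        conv_lhs => rw [← h1]
        rw [← Submodule.map_comp, ← Module.End.mul_eq_comp, ← map_mul, inv_mul_cancel, map_one]
        exact Submodule.map_id _ }
  have hρinj : ∀ l : G, Function.Injective (ρ l) := fun l => by
    have := ρ.apply_bijective l
    exact this.1
  refine ⟨L₁, lt_of_le_of_ne (fun l hl => hl.1) ?_, W₁, y * x, ⟨?_, ?_, ?_⟩, ?_⟩
  · intro hL
    have h1 : W₁ = W := h.eq_of_le W₁ inf_le_left (fun l hl w hw => by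
      have h2 : l ∈ L₁ := by rw [hL]; exact hl
      rw [← h2.2]
      exact Submodule.mem_map_of_mem hw) fun h0 => hw₀0 (by
        have : (w₀ : V) ∈ W₁ := (mem_W₁ _).mpr ⟨w₀.2, hw₀e⟩
        rwa [h0, Submodule.mem_bot] at this)
    exact hna ⟨t, fun w hw => ((mem_W₁ w).mp (h1 ▸ hw)).2⟩
  · intro l hl w hw
    rw [← hl.2]
    exact Submodule.mem_map_of_mem hw
  · intro h0
    have : (w₀ : V) ∈ W₁ := (mem_W₁ _).mpr ⟨w₀.2, hw₀e⟩
    rw [h0, Submodule.mem_bot] at this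
    exact hw₀0 this
  · intro W' hW' hstab hne
    refine le_antisymm hW' fun w hw => ?_
    -- The L-translates of W' span W by irreducibility. It then suffices that the projector sends
    -- every translate back into W', since it acts on the eigenspace as the nonzero number n.
    let U : Submodule ℂ V := ⨆ l : L, W'.map (ρ l)
    have hUW : U = W := by
      refine h.eq_of_le U (iSup_le fun l => ?_) ?_ ?_
      · rintro _ ⟨w', hw', rfl⟩
        exact h.stable _ l.2 _ ((mem_W₁ _).mp (hW' hw')).1
      · intro l hl u hu
        have h1 : U.map (ρ l) ≤ U := by
          rw [Submodule.map_iSup]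
          refine iSup_le fun l' => ?_
          rw [← Submodule.map_comp, ← Module.End.mul_eq_comp, ← map_mul]
          exact le_iSup (fun l : L => W'.map (ρ l)) ⟨l * l', L.mul_mem hl l'.2⟩
        exact h1 (Submodule.mem_map_of_mem hu)
      · intro h0
        refine hne (le_bot_iff.mp (h0 ▸ ?_))
        exact le_trans (b := W'.map (ρ ((1 : L) : G))) (fun w hw => ⟨w, hw, by simp⟩)
          (le_iSup (fun l : L => W'.map (ρ l)) 1)
    have hEU : ∀ u ∈ U, E u ∈ W' := by
      intro u hu
      induction hu using Submodule.iSup_induction' with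
      | zero => simp
      | add u v _ _ hu hv => rw [map_add]; exact W'.add_mem hu hv
      | mem l u hu =>
        obtain ⟨w', hw', rfl⟩ := hu
        obtain ⟨z, i, hz⟩ := hconj l l.2
        have hpow : ∀ w ∈ W₁, (ρ a ^ i) w = t ^ i • w := by
          intro w hw
          have h2 : ∀ j : ℕ, (ρ a ^ j) w = t ^ j • w := by
            intro j
            induction j with
            | zero => simp
            | succ j ih =>
              rw [pow_succ', End.mul_apply, ih, map_smul, ((mem_W₁ w).mp hw).2, smul_smul, pow_succ]
          exact h2 i
        have hlw : ∀ w ∈ W₁, ρ a (ρ l w) = (z * t ^ i) • ρ l w := by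
          intro w hw
          have h1 := hz w ((mem_W₁ w).mp hw).1
          rw [hpow w hw, smul_smul] at h1
          have h2 := congrArg (ρ l) h1
          rwa [← End.mul_apply, ← map_mul, mul_assoc, mul_inv_cancel_left, map_mul, End.mul_apply,
            map_smul] at h2
        -- The translate by l lies in one eigenspace of ρ(a). Either that is the t-eigenspace, so l
        -- stabilizes it and hence W', or the projector kills the translate.
        by_cases hs : z * t ^ i = t
        · have hl : (l : G) ∈ L₁ := by
            refine ⟨l.2, Submodule.eq_of_le_of_finrank_eq ?_ ?_⟩
            · rintro _ ⟨w, hw, rfl⟩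
              rw [mem_W₁]
              exact ⟨h.stable _ l.2 _ ((mem_W₁ w).mp hw).1, by rw [hlw w hw, hs]⟩
            · exact (Submodule.equivMapOfInjective _ (hρinj l) W₁).symm.finrank_eq
          have h3 := hstab l hl w' hw'
          rw [hE_fix _ ((mem_W₁ _).mp (hW' h3)).2]
          exact W'.smul_mem _ h3
        · rw [hE_kill _ _ (hlw w' (hW' hw')) hs]
          exact W'.zero_mem
    have h4 := hEU w (hUW ▸ ((mem_W₁ w).mp hw).1)
    rw [hE_fix w ((mem_W₁ w).mp hw).2] at h4
    exact (W'.smul_mem_iff (Nat.cast_ne_zero.mpr hn0.ne')).mp h4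
  · rw [map_mul, hy, Module.End.mul_eq_comp, LinearMap.range_comp, hx]
    refine le_antisymm ?_ fun w hw => ?_
    · rintro _ ⟨w, hw, rfl⟩
      refine (mem_W₁ _).mpr ⟨hEW w hw, ?_⟩
      have h5 : S (E w) = E w := by rw [← End.mul_apply, hSE]
      rw [hS, LinearMap.smul_apply] at h5
      calc ρ a (E w) = t • t⁻¹ • ρ a (E w) := by rw [smul_smul, mul_inv_cancel₀ ht0, one_smul]
        _ = t • E w := by rw [h5]
    · refine ⟨(n : ℂ)⁻¹ • w, W.smul_mem _ ((mem_W₁ w).mp hw).1, ?_⟩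
      rw [map_smul, hE_fix w ((mem_W₁ w).mp hw).2, smul_smul,
        inv_mul_cancel₀ (Nat.cast_ne_zero.mpr hn0.ne'), one_smul]

/-- The element comes either from the cyclic normal subgroup or, if that subgroup acts by scalars,
from the centre of a q-group. -/
theorem IsIrrSubspace.exists_nonscalar (h : ρ.IsIrrSubspace L W) {q : ℕ} [Fact q.Prime]
    {C : Subgroup G} [C.Normal] [IsCyclic C] (hq : ∀ g : G, ∃ n : ℕ, g ^ q ^ n ∈ C)
    (hs : ¬ ∀ l ∈ L, ρ.IsScalarOn W l) :
    ∃ a ∈ L, ¬ ρ.IsScalarOn W a ∧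
      ∀ l ∈ L, ∃ (z : ℂ) (i : ℕ), ∀ w ∈ W, ρ (l⁻¹ * a * l) w = z • (ρ a ^ i) w := by
  have hcyc : IsCyclic (C ⊓ L : Subgroup G) :=
    isCyclic_of_injective (Subgroup.inclusion (inf_le_left : C ⊓ L ≤ C))
      (Subgroup.inclusion_injective _)
  obtain ⟨⟨a, haC, haL⟩, hgen⟩ := hcyc.exists_generator
  have hgen' : ∀ b ∈ C ⊓ L, ∃ i : ℕ, a ^ i = b := by
    intro b hb
    obtain ⟨i, hi⟩ := (mem_powers_iff_mem_zpowers).mpr (hgen ⟨b, hb⟩)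
    exact ⟨i, congrArg Subtype.val hi⟩
  by_cases hna : ρ.IsScalarOn W a
  swap
  -- Here the generator of C ∩ L works, since C ∩ L is normal in L and so conjugates of `a` are
  -- powers of `a`.
  · refine ⟨a, haL, hna, fun l hl => ?_⟩
    obtain ⟨i, hi⟩ := hgen' (l⁻¹ * a * l) ⟨by
      simpa using Subgroup.Normal.conj_mem ‹C.Normal› a haC l⁻¹,
      L.mul_mem (L.mul_mem (L.inv_mem hl) haL) hl⟩
    exact ⟨1, i, fun w _ => by rw [← hi, map_pow, one_smul]⟩
  obtain ⟨w₁, hw₁, hw₁0⟩ := W.exists_mem_ne_zero_of_ne_bot h.ne_bot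
  have hone : ρ.IsScalarOn W 1 := ⟨1, fun w _ => by simp⟩
  have hmul : ∀ {l l' : G}, ρ.IsScalarOn W l → ρ.IsScalarOn W l' → ρ.IsScalarOn W (l * l') := by
    rintro l l' ⟨z, hz⟩ ⟨z', hz'⟩
    exact ⟨z' * z, fun w hw => by rw [map_mul, End.mul_apply, hz' w hw, map_smul, hz w hw, smul_smul]⟩
  let Z : Subgroup L :=
    { carrier := {l | ρ.IsScalarOn W l}
      one_mem' := hone
      mul_mem' := fun h1 h2 => hmul h1 h2
      inv_mem' := by
        rintro l ⟨z, hz⟩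
        have hz0 : z ≠ 0 := by
          rintro rfl
          have := hz w₁ hw₁
          rw [zero_smul] at this
          exact hw₁0 ((ρ.apply_bijective l).1 (by rw [this, map_zero]))
        refine ⟨z⁻¹, fun w hw => ?_⟩
        have h1 := congrArg (ρ (l : G)⁻¹) (hz w hw)
        rw [← End.mul_apply, ← map_mul, inv_mul_cancel, map_one, End.one_apply, map_smul] at h1
        rw [h1, smul_smul, inv_mul_cancel₀ hz0, one_smul, ← h1]
        rfl }
  have hZn : Z.Normal := by
    refine ⟨fun g hg l => ?_⟩
    obtain ⟨z, hz⟩ := hg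
    refine ⟨z, fun w hw => ?_⟩
    have h1 := hz (ρ (l : G)⁻¹ w) (h.stable _ (L.inv_mem l.2) w hw)
    simp only [Subgroup.coe_mul, Subgroup.coe_inv, map_mul, End.mul_apply, h1, map_smul]
    rw [← End.mul_apply, ← map_mul, mul_inv_cancel, map_one, End.one_apply]
  have hpow : ∀ i : ℕ, ρ.IsScalarOn W (a ^ i) := by
    intro i
    induction i with
    | zero => simpa using hone
    | succ i ih => rw [pow_succ]; exact hmul ih hna
  -- Now C ∩ L acts by scalars, so L modulo the scalar elements is a nontrivial q-group. An element
  -- over a nontrivial central element of it agrees with its conjugates up to scalars on W.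
  have hP : IsPGroup q (L ⧸ Z) := by
    intro g
    obtain ⟨l, rfl⟩ := QuotientGroup.mk_surjective g
    obtain ⟨n, hn⟩ := hq l
    refine ⟨n, ?_⟩
    rw [← QuotientGroup.mk_pow, QuotientGroup.eq_one_iff]
    obtain ⟨i, hi⟩ := hgen' ((l : G) ^ q ^ n) ⟨hn, L.pow_mem l.2 _⟩
    change ρ.IsScalarOn W ((l ^ q ^ n : L) : G)
    rw [Subgroup.coe_pow, ← hi]
    exact hpow i
  push Not at hs
  obtain ⟨l₀, hl₀, hl₀s⟩ := hs
  have hnt : Nontrivial (L ⧸ Z) :=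
    ⟨(⟨l₀, hl₀⟩ : L), 1, fun h1 => hl₀s ((QuotientGroup.eq_one_iff _).mp h1)⟩
  obtain ⟨⟨c, hc⟩, hc1⟩ := @exists_ne (Subgroup.center (L ⧸ Z)) hP.center_nontrivial 1
  obtain ⟨b, rfl⟩ := QuotientGroup.mk_surjective c
  refine ⟨b, b.2, fun hb => hc1 (Subtype.ext ((QuotientGroup.eq_one_iff _).mpr hb)), ?_⟩
  intro l hl
  have h1 : ((b : L) : L ⧸ Z) = ((⟨l, hl⟩⁻¹ * b * ⟨l, hl⟩ : L) : L ⧸ Z) := by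
    rw [QuotientGroup.mk_mul, QuotientGroup.mk_mul, mul_assoc,
      ← Subgroup.mem_center_iff.mp hc, ← mul_assoc, QuotientGroup.mk_inv, inv_mul_cancel, one_mul]
  obtain ⟨z, hz⟩ := QuotientGroup.eq.mp h1
  refine ⟨z, 1, fun w hw => ?_⟩
  have h2 := congrArg (ρ b) (hz w hw)
  simp only [Subgroup.coe_mul, Subgroup.coe_inv] at h2
  rw [← End.mul_apply, ← map_mul, mul_inv_cancel_left, map_smul] at h2
  rw [pow_one]
  exact h2

/-- An irreducible representation of a finite group with a cyclic normal subgroup of `q`-power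
index has an operator of rank one with coefficients in `ℚ^ab`. -/
theorem exists_finrank_range_qabOp_eq_one [FiniteDimensional ℂ V] (ρ : Representation ℂ G V)
    [ρ.IsIrreducible] {q : ℕ}
    [Fact q.Prime] (C : Subgroup G) [C.Normal] [IsCyclic C] (hq : ∀ g : G, ∃ n : ℕ, g ^ q ^ n ∈ C) :
    ∃ x : MonoidAlgebra Qab G, finrank ℂ (LinearMap.range (ρ.qabOp x)) = 1 := by
  -- Descent on |L|, starting from L = G, W = V and x = 1: the image of the operator stays
  -- irreducible under the shrinking group. It stops when L acts by scalars, so that the irreducible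
  -- image is a line.
  have key : ∀ (N : ℕ) (L : Subgroup G) (W : Submodule ℂ V) (x : MonoidAlgebra Qab G),
      ρ.IsIrrSubspace L W → LinearMap.range (ρ.qabOp x) = W → Nat.card L = N →
      ∃ x : MonoidAlgebra Qab G, finrank ℂ (LinearMap.range (ρ.qabOp x)) = 1 := by
    intro N
    induction N using Nat.strong_induction_on with
    | _ N ih =>
      intro L W x h hx hN
      by_cases hs : ∀ l ∈ L, ρ.IsScalarOn W l
      · exact ⟨x, by rw [hx, h.finrank_eq_one hs]⟩
      · obtain ⟨a, ha, hna, hconj⟩ := h.exists_nonscalar hq hs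
        obtain ⟨L', hL', W', x', h', hx'⟩ := h.exists_lt hx ha hna hconj
        refine ih _ ?_ L' W' x' h' hx' rfl
        rw [← hN]
        exact Set.Finite.card_lt_card (Set.toFinite _) hL'
  refine key _ ⊤ ⊤ 1 ⟨fun _ _ _ _ => Submodule.mem_top, ?_, ?_⟩ ?_ rfl
  · intro h0
    exact bot_ne_top (α := Subrepresentation ρ) (Subrepresentation.toSubmodule_injective h0.symm)
  · intro W' _ hst hne
    have h1 := eq_bot_or_eq_top (α := Subrepresentation ρ) ⟨W', fun g w hw => hst g (Subgroup.mem_top g) w hw⟩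
    rcases h1 with h1 | h1
    · exact absurd (congrArg Subrepresentation.toSubmodule h1) hne
    · exact congrArg Subrepresentation.toSubmodule h1
  · rw [map_one]
    exact LinearMap.range_id

end Hyperelementary

end Representation

namespace Representation

open Module

/-! ### Multiplicities as ranks of operators -/

section Multiplicity

theorem char_prod {G V W : Type*} [Group G] [AddCommGroup V] [Module ℂ V] [FiniteDimensional ℂ V]
    [AddCommGroup W] [Module ℂ W] [FiniteDimensional ℂ W] (ρ : Representation ℂ G V)
    (σ : Representation ℂ G W) (g : G) :
    (ρ.prod σ).character g = ρ.character g + σ.character g :=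
  LinearMap.trace_prodMap' (ρ g) (σ g)

variable {G : Type*} [Group G]

theorem finrank_range_qabOp_of_equiv {V W : Type*} [AddCommGroup V] [Module ℂ V]
    [AddCommGroup W] [Module ℂ W] {ρ : Representation ℂ G V} {σ : Representation ℂ G W}
    (e : ρ.Equiv σ) (x : MonoidAlgebra Qab G) :
    finrank ℂ (LinearMap.range (σ.qabOp x)) = finrank ℂ (LinearMap.range (ρ.qabOp x)) := by
  have h := qabOp_intertwining (ρ := ρ) (σ := σ) e.toLinearEquiv.toLinearMap
    (fun g => e.isIntertwining' g) x
  have h2 : LinearMap.range (σ.qabOp x) =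
      (LinearMap.range (ρ.qabOp x)).map e.toLinearEquiv.toLinearMap := by
    rw [← LinearMap.range_comp, h, LinearMap.range_comp, LinearEquiv.range, Submodule.map_top]
  rw [h2]
  exact e.toLinearEquiv.finrank_map_eq _

variable [Finite G]

theorem sum_char_mul_char_inv {V W : Type*} [AddCommGroup V] [Module ℂ V] [FiniteDimensional ℂ V]
    [AddCommGroup W] [Module ℂ W] [FiniteDimensional ℂ W] [Fintype G] (ρ : Representation ℂ G V)
    (σ : Representation ℂ G W) :
    ∑ g : G, σ.character g * ρ.character g⁻¹ =
      (Nat.card G : ℂ) * finrank ℂ (IntertwiningMap ρ σ) := by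
  have h0 : (Nat.card G : ℂ) ≠ 0 := Nat.cast_ne_zero.mpr Nat.card_pos.ne'
  let _ : Invertible (Nat.card G : ℂ) := invertibleOfNonzero h0
  rw [← card_inv_mul_sum_char_mul_char_eq_finrank, mul_inv_cancel_left₀ h0]

theorem finrank_intertwiningMap_eq_of_char_eq {V V' W W' : Type*}
    [AddCommGroup V] [Module ℂ V] [FiniteDimensional ℂ V]
    [AddCommGroup V'] [Module ℂ V'] [FiniteDimensional ℂ V']
    [AddCommGroup W] [Module ℂ W] [FiniteDimensional ℂ W]
    [AddCommGroup W'] [Module ℂ W'] [FiniteDimensional ℂ W']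
    {ρ : Representation ℂ G V} {ρ' : Representation ℂ G V'} {σ : Representation ℂ G W}
    {σ' : Representation ℂ G W'} (h : ρ.character = ρ'.character)
    (h' : σ.character = σ'.character) :
    finrank ℂ (IntertwiningMap ρ σ) = finrank ℂ (IntertwiningMap ρ' σ') := by
  have _ := Fintype.ofFinite G
  have h0 : (Nat.card G : ℂ) ≠ 0 := Nat.cast_ne_zero.mpr Nat.card_pos.ne'
  have h1 := sum_char_mul_char_inv ρ σ
  rw [h, h', sum_char_mul_char_inv ρ' σ'] at h1
  exact_mod_cast (mul_left_cancel₀ h0 h1).symm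

theorem finrank_intertwiningMap_prod {V W W' : Type*}
    [AddCommGroup V] [Module ℂ V] [FiniteDimensional ℂ V]
    [AddCommGroup W] [Module ℂ W] [FiniteDimensional ℂ W]
    [AddCommGroup W'] [Module ℂ W'] [FiniteDimensional ℂ W']
    (ρ : Representation ℂ G V) (σ : Representation ℂ G W) (σ' : Representation ℂ G W') :
    finrank ℂ (IntertwiningMap ρ (σ.prod σ')) =
      finrank ℂ (IntertwiningMap ρ σ) + finrank ℂ (IntertwiningMap ρ σ') := by
  have _ := Fintype.ofFinite G
  have h0 : (Nat.card G : ℂ) ≠ 0 := Nat.cast_ne_zero.mpr Nat.card_pos.ne'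
  have h1 := sum_char_mul_char_inv ρ (σ.prod σ')
  simp only [char_prod, add_mul, Finset.sum_add_distrib, sum_char_mul_char_inv, ← mul_add] at h1
  exact_mod_cast (mul_left_cancel₀ h0 h1).symm

theorem finrank_prod_intertwiningMap {V W W' : Type*}
    [AddCommGroup V] [Module ℂ V] [FiniteDimensional ℂ V]
    [AddCommGroup W] [Module ℂ W] [FiniteDimensional ℂ W]
    [AddCommGroup W'] [Module ℂ W'] [FiniteDimensional ℂ W']
    (ρ : Representation ℂ G V) (σ : Representation ℂ G W) (σ' : Representation ℂ G W') :
    finrank ℂ (IntertwiningMap (σ.prod σ') ρ) =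
      finrank ℂ (IntertwiningMap σ ρ) + finrank ℂ (IntertwiningMap σ' ρ) := by
  have _ := Fintype.ofFinite G
  have h0 : (Nat.card G : ℂ) ≠ 0 := Nat.cast_ne_zero.mpr Nat.card_pos.ne'
  have h1 := sum_char_mul_char_inv (σ.prod σ') ρ
  simp only [char_prod, mul_add, Finset.sum_add_distrib, sum_char_mul_char_inv] at h1
  rw [← mul_add] at h1
  exact_mod_cast (mul_left_cancel₀ h0 h1).symm

variable {W : Type*} [AddCommGroup W] [Module ℂ W] [FiniteDimensional ℂ W]

/-- A multiple of the central idempotent of the group algebra belonging to `ψ`. -/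
def charElem (ψ : Representation ℂ G W) : MonoidAlgebra Qab G :=
  ∑ᶠ g : G, MonoidAlgebra.single g (⟨ψ.character g⁻¹, ψ.character_mem_Qab _⟩ : Qab)

theorem qabOp_charElem {V : Type*} [AddCommGroup V] [Module ℂ V] [Fintype G]
    (ψ : Representation ℂ G W) (ρ : Representation ℂ G V) :
    ρ.qabOp ψ.charElem = ∑ g, ψ.character g⁻¹ • ρ g := by
  rw [charElem, finsum_eq_sum_of_fintype, qabOp_sum]

/-- Schur's lemma provides the scalar, and a trace evaluates it. -/
theorem qabOp_charElem_of_irreducible {V : Type*} [AddCommGroup V] [Module ℂ V]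
    [FiniteDimensional ℂ V] (ψ : Representation ℂ G W) (ρ : Representation ℂ G V)
    [ρ.IsIrreducible] :
    ∃ z : ℂ, ρ.qabOp ψ.charElem = z • LinearMap.id ∧
      z * finrank ℂ V = Nat.card G * finrank ℂ (IntertwiningMap ψ ρ) := by
  have _ := Fintype.ofFinite G
  let f : IntertwiningMap ρ ρ :=
    { toLinearMap := ρ.qabOp ψ.charElem
      isIntertwining' := by
        intro h
        rw [qabOp_charElem, ← Module.End.mul_eq_comp, ← Module.End.mul_eq_comp, Finset.sum_mul,
          Finset.mul_sum]
        refine Fintype.sum_equiv (MulAut.conj h⁻¹).toEquiv _ _ fun g => ?_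
        rw [smul_mul_assoc, mul_smul_comm, ← map_mul, ← map_mul]
        have h1 : (MulAut.conj h⁻¹).toEquiv g = h⁻¹ * g * h := by simp
        rw [h1]
        congr 1
        · have := ψ.char_conj g⁻¹ h⁻¹
          rw [← this]
          congr 1
          group
        · congr 1; group }
  obtain ⟨z, hz⟩ := (IsIrreducible.algebraMap_intertwiningMap_bijective_of_isAlgClosed (k := ℂ) (ρ := ρ)).2 f
  have hz' : ρ.qabOp ψ.charElem = z • LinearMap.id := by
    have h1 : f.toLinearMap = (algebraMap ℂ (IntertwiningMap ρ ρ) z).toLinearMap := by rw [hz]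
    refine h1.trans ?_
    rw [Algebra.algebraMap_eq_smul_one]
    rfl
  refine ⟨z, hz', ?_⟩
  rw [← sum_char_mul_char_inv]
  have h2 := congrArg (LinearMap.trace ℂ V) hz'
  rw [qabOp_charElem, map_sum, map_smul, LinearMap.trace_id, smul_eq_mul] at h2
  rw [← h2]
  refine Finset.sum_congr rfl fun g _ => ?_
  rw [map_smul, smul_eq_mul, mul_comm]
  rfl

/-- If `ψ` has an operator of rank one, then its multiplicities are ranks of operators. -/
theorem exists_finrank_range_qabOp_eq_finrank_intertwiningMap (ψ : Representation ℂ G W)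
    [ψ.IsIrreducible] {x : MonoidAlgebra Qab G}
    (hx : finrank ℂ (LinearMap.range (ψ.qabOp x)) = 1) :
    ∃ y : MonoidAlgebra Qab G, ∀ (V : Type v) [AddCommGroup V] [Module ℂ V]
      [FiniteDimensional ℂ V] (ρ : Representation ℂ G V),
      finrank ℂ (LinearMap.range (ρ.qabOp y)) = finrank ℂ (IntertwiningMap ψ ρ) := by
  -- The factor `ψ.charElem` vanishes on irreducible representations other than ψ and is a nonzero
  -- scalar on ψ, so the product contributes rank one for each copy of ψ and nothing else.
  refine ⟨x * ψ.charElem, fun V _ _ _ ρ => ?_⟩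
  refine induction_on_irreducible (P := fun V _ _ _ ρ =>
    finrank ℂ (LinearMap.range (ρ.qabOp (x * ψ.charElem))) = finrank ℂ (IntertwiningMap ψ ρ))
    ?_ ?_ ?_ ?_ V ρ
  · intro V _ _ _ ρ hV
    have h1 : Subsingleton (IntertwiningMap ψ ρ) :=
      ⟨fun f g => IntertwiningMap.ext (LinearMap.ext fun w => Subsingleton.elim _ _)⟩
    rw [finrank_zero_of_subsingleton, finrank_zero_of_subsingleton]
  · intro V _ _ _ ρ hρ
    obtain ⟨z, hz, hz'⟩ := qabOp_charElem_of_irreducible ψ ρ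
    have hV : Nontrivial V := by
      by_contra hV
      rw [not_nontrivial_iff_subsingleton] at hV
      exact bot_ne_top (α := Subrepresentation ρ)
        (Subrepresentation.toSubmodule_injective (Subsingleton.elim _ _))
    have hd : (finrank ℂ V : ℂ) ≠ 0 := Nat.cast_ne_zero.mpr finrank_pos.ne'
    have hc : (Nat.card G : ℂ) ≠ 0 := Nat.cast_ne_zero.mpr Nat.card_pos.ne'
    rw [map_mul, hz]
    cases isEmpty_or_nonempty (ψ.Equiv ρ) with
    | inl he =>
      have h1 : finrank ℂ (IntertwiningMap ψ ρ) = 0 := finrank_zero_of_subsingleton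
      rw [h1, Nat.cast_zero, mul_zero] at hz'
      rw [(mul_eq_zero.mp hz').resolve_right hd, zero_smul, mul_zero, h1, LinearMap.range_zero,
        finrank_bot]
    | inr he =>
      obtain ⟨e⟩ := he
      have h1 : finrank ℂ (IntertwiningMap ψ ρ) = 1 := by
        rw [← IsIrreducible.finrank_intertwiningMap_self ψ]
        exact finrank_intertwiningMap_eq_of_char_eq rfl (char_iso e).symm
      have hz0 : z ≠ 0 := by
        rintro rfl
        rw [h1, zero_mul, Nat.cast_one, mul_one] at hz'
        exact hc hz'.symm
      rw [h1, mul_smul_comm, Module.End.mul_eq_comp, LinearMap.comp_id, LinearMap.range_smul _ _ hz0,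
        finrank_range_qabOp_of_equiv e, hx]
  · intro V V' _ _ _ _ _ _ ρ σ h h'
    rw [finrank_intertwiningMap_prod, ← h, ← h', qabOp_prod, LinearMap.range_prodMap,
      ← Module.finrank_prod]
    have h2 := LinearMap.finrank_range_of_inj (f := (LinearMap.range (ρ.qabOp (x * ψ.charElem))).subtype.prodMap
      (LinearMap.range (σ.qabOp (x * ψ.charElem))).subtype)
      (Function.Injective.prodMap (Submodule.subtype_injective _) (Submodule.subtype_injective _))
    rwa [LinearMap.range_prodMap, Submodule.range_subtype, Submodule.range_subtype] at h2
  · intro V V' _ _ _ _ _ _ ρ σ e h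
    rw [finrank_range_qabOp_of_equiv e, h]
    exact finrank_intertwiningMap_eq_of_char_eq rfl (char_iso e)

/-- For irreducible σ the multiplicity is itself the rank of a ℚ^ab-operator, because σ has a rank
one operator. The general case is additive in σ. -/
theorem dvd_finrank_intertwiningMap {q : ℕ} [Fact q.Prime] (C : Subgroup G) [C.Normal] [IsCyclic C]
    (hq : ∀ g : G, ∃ n : ℕ, g ^ q ^ n ∈ C)
    {V : Type v} [AddCommGroup V] [Module ℂ V] [FiniteDimensional ℂ V] (ρ : Representation ℂ G V)
    (hρ : ∀ x : MonoidAlgebra Qab G, q ∣ finrank ℂ (LinearMap.range (ρ.qabOp x)))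
    (Y : Type u) [AddCommGroup Y] [Module ℂ Y] [FiniteDimensional ℂ Y]
    (σ : Representation ℂ G Y) : q ∣ finrank ℂ (IntertwiningMap σ ρ) := by
  refine induction_on_irreducible (P := fun Y _ _ _ σ => q ∣ finrank ℂ (IntertwiningMap σ ρ))
    ?_ ?_ ?_ ?_ Y σ
  · intro Y _ _ _ σ hY
    have h1 : Subsingleton (IntertwiningMap σ ρ) :=
      ⟨fun f g => IntertwiningMap.ext (LinearMap.ext fun w => by
        rw [Subsingleton.elim w 0, map_zero, map_zero])⟩
    rw [finrank_zero_of_subsingleton]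
    exact dvd_zero q
  · intro Y _ _ _ σ hσ
    obtain ⟨x, hx⟩ := exists_finrank_range_qabOp_eq_one σ C hq
    obtain ⟨y, hy⟩ := exists_finrank_range_qabOp_eq_finrank_intertwiningMap.{v} σ hx
    rw [← hy]
    exact hρ y
  · intro Y Y' _ _ _ _ _ _ σ σ' h h'
    rw [finrank_prod_intertwiningMap]
    exact dvd_add h h'
  · intro Y Y' _ _ _ _ _ _ σ σ' e h
    rwa [← finrank_intertwiningMap_eq_of_char_eq (char_iso e) rfl]

end Multiplicity

end Representation

/-! ### Hyperelementary subgroups -/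

/-- A group with a cyclic normal subgroup whose quotient is a `q`-group. -/
def IsHyperelementary (q : ℕ) (H : Type*) [Group H] : Prop :=
  ∃ C : Subgroup H, C.Normal ∧ IsCyclic C ∧ ∀ h : H, ∃ n : ℕ, h ^ q ^ n ∈ C

section

variable {G : Type*} [Group G]

theorem mem_zpowers_pow_of_coprime {w : G} {n : ℕ} (h : (orderOf w).Coprime n) :
    w ∈ Subgroup.zpowers (w ^ n) := by
  obtain ⟨m, hm⟩ := exists_pow_eq_self_of_coprime h.symm
  have h1 := Subgroup.npow_mem_zpowers (w ^ n) m
  rwa [hm] at h1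

variable [Finite G]

/-- If x has order qᵃm with q ∤ m, the two parts are x^(qᵃ) and x^m, and Bézout recovers x from
them. -/
theorem exists_coprime_parts (q : ℕ) [hq : Fact q.Prime] (x : G) :
    ∃ u v : G, Commute u v ∧ u ∈ Subgroup.zpowers x ∧ v ∈ Subgroup.zpowers x ∧
      x ∈ Subgroup.zpowers u ⊔ Subgroup.zpowers v ∧ (orderOf u).Coprime q ∧
      IsPGroup q (Subgroup.zpowers v) := by
  obtain ⟨a, m, hm, ho⟩ := Nat.exists_eq_pow_mul_and_not_dvd (orderOf_pos x).ne' q hq.out.ne_one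
  have hcop : m.Coprime q := ((Nat.Prime.coprime_iff_not_dvd hq.out).mpr hm).symm
  have hm0 : m ≠ 0 := by rintro rfl; exact hm (dvd_zero q)
  have hqa : q ^ a ≠ 0 := pow_ne_zero _ hq.out.ne_zero
  refine ⟨x ^ q ^ a, x ^ m, (Commute.refl x).pow_pow _ _, Subgroup.npow_mem_zpowers _ _,
    Subgroup.npow_mem_zpowers _ _, ?_, ?_, ?_⟩
  · have hb := Nat.gcd_eq_gcd_ab (q ^ a) m
    rw [Nat.Coprime.gcd_eq_one ((hcop.symm).pow_left a)] at hb
    have h1 : x = (x ^ q ^ a) ^ (Nat.gcdA (q ^ a) m) * (x ^ m) ^ (Nat.gcdB (q ^ a) m) := by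
      rw [← zpow_natCast, ← zpow_natCast, ← zpow_mul, ← zpow_mul, ← zpow_add, ← hb, Nat.cast_one,
        zpow_one]
    have h2 := Subgroup.mul_mem_sup (Subgroup.zpow_mem_zpowers (x ^ q ^ a) (Nat.gcdA (q ^ a) m))
      (Subgroup.zpow_mem_zpowers (x ^ m) (Nat.gcdB (q ^ a) m))
    rwa [← h1] at h2
  · rw [orderOf_pow_of_dvd hqa (ho ▸ dvd_mul_right _ _), ho,
      Nat.mul_div_cancel_left _ (Nat.pos_of_ne_zero hqa)]
    exact hcop
  · refine IsPGroup.of_card (n := a) ?_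
    rw [Nat.card_zpowers, orderOf_pow_of_dvd hm0 (ho ▸ dvd_mul_left _ _), ho,
      Nat.mul_div_cancel _ (Nat.pos_of_ne_zero hm0)]

/-- For each element `x` there is a `q`-hyperelementary subgroup `H` such that the number of
fixed points of `x` on `G / H` is prime to `q`. -/
theorem exists_isHyperelementary_not_dvd_card_fixedBy (q : ℕ) [hq : Fact q.Prime] (x : G) :
    ∃ H : Subgroup G, IsHyperelementary q H ∧ ¬ q ∣ Nat.card (MulAction.fixedBy (G ⧸ H) x) := by
  obtain ⟨u, v, huv, hux, hvx, hx, hu, hv⟩ := exists_coprime_parts q x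
  set C₀ := Subgroup.zpowers u with hC₀
  set N := Subgroup.normalizer (C₀ : Set G) with hN
  have hvN : v ∈ N := by
    rw [hN, Subgroup.mem_normalizer_iff]
    intro h
    have key : ∀ y ∈ C₀, v * y * v⁻¹ = y := by
      rintro y ⟨i, rfl⟩
      have : Commute v (u ^ i) := (huv.symm).zpow_right i
      simp only [this.eq, mul_inv_cancel_right]
    constructor
    · intro hh; rwa [key h hh]
    · intro hh
      have h2 := key _ hh
      have h3 : v * h * v⁻¹ = h := by
        have h4 := congrArg (fun z => v⁻¹ * z * v) h2
        simpa [mul_assoc] using h4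
      rwa [h3] at hh
  have hC₀N : C₀ ≤ N := Subgroup.le_normalizer
  have hCn : (C₀.subgroupOf N).Normal := Subgroup.normal_in_normalizer
  have hvP : IsPGroup q (Subgroup.zpowers (⟨v, hvN⟩ : N)) := by
    refine hv.of_injective ((N.subtype.comp (Subgroup.subtype _)).codRestrict _ fun y => ?_) ?_
    · obtain ⟨_, ⟨i, rfl⟩⟩ := y
      exact ⟨i, by simp⟩
    · intro y z hyz
      exact Subtype.ext (Subtype.ext (congrArg (fun t => ((t : Subgroup.zpowers v) : G)) hyz))
  obtain ⟨Q, hQ⟩ := hvP.exists_le_sylow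
  -- The subgroup is ⟨u⟩ extended by a Sylow q-subgroup of its normalizer N. It is
  -- q-hyperelementary, and its index in N is prime to q.
  set H' : Subgroup N := C₀.subgroupOf N ⊔ Q with hH'
  set H : Subgroup G := H'.map N.subtype with hH
  have hHN : H ≤ N := by rintro _ ⟨h, _, rfl⟩; exact h.2
  have hC₀H : C₀ ≤ H := fun c hc =>
    ⟨⟨c, hC₀N hc⟩, (le_sup_left : C₀.subgroupOf N ≤ H') (Subgroup.mem_subgroupOf.mpr hc), rfl⟩
  have hpow : ∀ h ∈ H, ∃ n : ℕ, h ^ q ^ n ∈ C₀ := by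
    rintro _ ⟨h, hh, rfl⟩
    obtain ⟨c, hc, s, hs, rfl⟩ := Subgroup.mem_sup_of_normal_left.mp hh
    obtain ⟨n, hn⟩ := Q.isPGroup' ⟨s, hs⟩
    refine ⟨n, ?_⟩
    have h1 : (c * s) ^ q ^ n ∈ C₀.subgroupOf N := by
      rw [← QuotientGroup.eq_one_iff, QuotientGroup.mk_pow, QuotientGroup.mk_mul,
        (QuotientGroup.eq_one_iff c).mpr hc, one_mul, ← QuotientGroup.mk_pow]
      have h2 : s ^ q ^ n = 1 := congrArg Subtype.val hn
      rw [h2, QuotientGroup.mk_one]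
    exact Subgroup.mem_subgroupOf.mp h1
  refine ⟨H, ⟨C₀.subgroupOf H, ?_, ?_, ?_⟩, ?_⟩
  · refine ⟨fun c hc h => ?_⟩
    rw [Subgroup.mem_subgroupOf] at hc ⊢
    exact (Subgroup.mem_normalizer_iff.mp (hHN h.2) c).mp hc
  · exact isCyclic_of_injective (H.subtype.subgroupComap C₀) fun y z hyz =>
      Subtype.ext (Subtype.ext (congrArg (fun t : C₀ => (t : G)) hyz))
  · intro h
    obtain ⟨n, hn⟩ := hpow h h.2
    exact ⟨n, Subgroup.mem_subgroupOf.mpr hn⟩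
  -- the fixed points of `u` form the orbit of the base point under `N`
  have hfix_u : ∀ y : G ⧸ H, u • y = y ↔ y ∈ MulAction.orbit N ((1 : G) : G ⧸ H) := by
    intro y
    obtain ⟨g, rfl⟩ := QuotientGroup.mk_surjective y
    have h1 : u • (g : G ⧸ H) = g ↔ g⁻¹ * u * g ∈ H := by
      rw [eq_comm, ← smul_eq_mul, MulAction.Quotient.smul_coe, QuotientGroup.eq, smul_eq_mul,
        smul_eq_mul, mul_assoc]
    rw [h1]
    constructor
    · intro h
      obtain ⟨n, hn⟩ := hpow _ h
      have ho : orderOf (g⁻¹ * u * g) = orderOf u := by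
        have := orderOf_injective (MulAut.conj g⁻¹).toMonoidHom (MulAut.conj g⁻¹).injective u
        simpa using this
      -- A q-power of this element lies in ⟨u⟩, and its order is prime to q, so it is a power of
      -- that q-power.
      have hw : g⁻¹ * u * g ∈ C₀ := by
        have h2 := mem_zpowers_pow_of_coprime (w := g⁻¹ * u * g) (n := q ^ n)
          (by rw [ho]; exact hu.pow_right n)
        exact (Subgroup.zpowers_le.mpr hn) h2
      have hgN : g⁻¹ ∈ N := by
        have h3 : C₀.map (MulAut.conj g⁻¹).toMonoidHom = C₀ := by
          refine Subgroup.eq_of_le_of_card_ge ?_ ?_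
          · rw [hC₀, MonoidHom.map_zpowers, Subgroup.zpowers_le]
            simpa using hw
          · rw [Subgroup.card_map_of_injective (MulAut.conj g⁻¹).injective]
        rw [hN, Subgroup.mem_normalizer_iff]
        intro c
        constructor
        · intro hc
          have : (MulAut.conj g⁻¹).toMonoidHom c ∈ C₀.map (MulAut.conj g⁻¹).toMonoidHom :=
            Subgroup.mem_map_of_mem _ hc
          rw [h3] at this
          simpa using this
        · intro hc
          rw [← h3] at hc
          obtain ⟨c', hc', h4⟩ := hc
          have h5 : c' = c := by simpa using h4
          rwa [← h5]
      refine ⟨⟨g, by simpa using N.inv_mem hgN⟩, ?_⟩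
      change ((g * 1 : G) : G ⧸ H) = g
      rw [mul_one]
    · rintro ⟨n, hn⟩
      have hn' : ((n : G) : G ⧸ H) = g := by
        rw [← hn]
        change _ = (((n : G) * 1 : G) : G ⧸ H)
        rw [mul_one]
      have hg : g ∈ N := by
        have := hHN (QuotientGroup.eq.mp hn')
        simpa using N.mul_mem n.2 this
      have := (Subgroup.mem_normalizer_iff.mp (N.inv_mem hg) u).mp (Subgroup.mem_zpowers u)
      rw [inv_inv] at this
      exact hC₀H this
  -- A coset is fixed by x exactly when it is fixed by u and by v. The fixed points of u form one
  -- N-orbit, of size prime to q, on which the q-group ⟨v⟩ acts. Passing to the fixed points of ⟨v⟩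
  -- does not change the number modulo q.
  let F : SubMulAction (Subgroup.zpowers v) (G ⧸ H) :=
    { carrier := {y | u • y = y}
      smul_mem' := by
        rintro ⟨_, i, rfl⟩ y hy
        change u • (v ^ i • y) = v ^ i • y
        rw [← mul_smul, (huv.zpow_right i).eq, mul_smul]
        exact congrArg (v ^ i • ·) hy }
  have hF : ¬ q ∣ Nat.card F := by
    have h1 : Nat.card F = (MulAction.stabilizer N ((1 : G) : G ⧸ H)).index := by
      rw [MulAction.index_stabilizer]
      have h2 : (F : Set (G ⧸ H)) = MulAction.orbit N ((1 : G) : G ⧸ H) := Set.ext hfix_u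
      rw [← h2]
      rfl
    rw [h1]
    intro hd
    refine Q.not_dvd_index (hd.trans (Subgroup.index_dvd_of_le fun s hs => ?_))
    change (((s : G) * 1 : G) : G ⧸ H) = ((1 : G) : G ⧸ H)
    rw [mul_one, eq_comm, QuotientGroup.eq, inv_one, one_mul]
    exact ⟨s, (le_sup_right : (Q : Subgroup N) ≤ H') hs, rfl⟩
  have hmod := hv.card_modEq_card_fixedPoints F
  have hcard : Nat.card (MulAction.fixedPoints (Subgroup.zpowers v) F) =
      Nat.card (MulAction.fixedBy (G ⧸ H) x) := by
    refine Nat.card_congr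
      { toFun := fun y => ⟨(y : F), ?_⟩
        invFun := fun y => ⟨⟨(y : G ⧸ H), ?_⟩, ?_⟩
        left_inv := fun y => rfl
        right_inv := fun y => rfl }
    · have h1 : Subgroup.zpowers u ⊔ Subgroup.zpowers v ≤ MulAction.stabilizer G ((y : F) : G ⧸ H) := by
        rw [sup_le_iff, Subgroup.zpowers_le, Subgroup.zpowers_le]
        refine ⟨(y : F).2, ?_⟩
        exact congrArg Subtype.val (y.2 ⟨v, Subgroup.mem_zpowers v⟩)
      exact h1 hx
    · have h1 : Subgroup.zpowers x ≤ MulAction.stabilizer G (y : G ⧸ H) := by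
        rw [Subgroup.zpowers_le]; exact y.2
      exact h1 hux
    · have h1 : Subgroup.zpowers x ≤ MulAction.stabilizer G (y : G ⧸ H) := by
        rw [Subgroup.zpowers_le]; exact y.2
      rintro ⟨_, i, rfl⟩
      exact Subtype.ext (h1 (Subgroup.zpow_mem _ hvx i))
  rw [← hcard]
  intro hd
  exact hF ((Nat.ModEq.dvd_iff hmod dvd_rfl).mpr hd)

end

namespace Representation

open Module

/-! ### Permutation characters -/

section Permutation

variable {G Y : Type*} [Group G] [MulAction G Y]

/-- The permutation representation on functions. -/
def permRep (G Y : Type*) [Group G] [MulAction G Y] : Representation ℂ G (Y → ℂ) where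
  toFun g := LinearMap.funLeft ℂ ℂ (fun y : Y => g⁻¹ • y)
  map_one' := by ext; simp [LinearMap.funLeft]
  map_mul' g h := by
    refine LinearMap.ext fun f => funext fun y => ?_
    simp [LinearMap.funLeft_apply, mul_smul]

theorem character_permRep [Finite Y] (g : G) :
    (permRep G Y).character g = Nat.card (MulAction.fixedBy Y g) := by
  classical
  have _ := Fintype.ofFinite Y
  rw [character, LinearMap.trace_eq_matrix_trace ℂ (Pi.basisFun ℂ Y), Matrix.trace]
  have h1 : ∀ y : Y, (LinearMap.toMatrix (Pi.basisFun ℂ Y) (Pi.basisFun ℂ Y) (permRep G Y g)).diag y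
      = if g • y = y then 1 else 0 := by
    intro y
    rw [Matrix.diag_apply, LinearMap.toMatrix_apply]
    simp only [permRep, Pi.basisFun_apply, Pi.basisFun_repr, MonoidHom.coe_mk, OneHom.coe_mk,
      LinearMap.funLeft_apply, Pi.single_apply, inv_smul_eq_iff]
    simp only [eq_comm]
  rw [Finset.sum_congr rfl fun y _ => h1 y, Finset.sum_boole, Nat.card_eq_fintype_card,
    Fintype.card_subtype]
  rfl

theorem character_permRep_inv [Finite Y] (g : G) :
    (permRep G Y).character g⁻¹ = (permRep G Y).character g := by
  rw [character_permRep, character_permRep]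
  rw [MulAction.fixedBy_inv]

/-- Frobenius reciprocity for the trivial character of H: summing over fixed cosets instead, each
coset contributes the sum of f over a conjugate of H. -/
theorem sum_mul_character_permRep [Fintype G] (H : Subgroup G) [Fintype H] (f : G → ℂ)
    (hf : ∀ g h : G, f (g * h * g⁻¹) = f h) :
    (∑ g : G, f g * (permRep G (G ⧸ H)).character g) =
      H.index * ∑ h : H, f h := by
  classical
  have _ := Fintype.ofFinite (G ⧸ H)
  have h1 : ∀ g : G, (permRep G (G ⧸ H)).character g =
      ∑ y : G ⧸ H, if g • y = y then (1 : ℂ) else 0 := by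
    intro g
    rw [character_permRep, Finset.sum_boole, Nat.card_eq_fintype_card, Fintype.card_subtype]
    rfl
  have h2 : ∀ y : G ⧸ H, (∑ g : G, f g * if g • y = y then (1 : ℂ) else 0) = ∑ h : H, f h := by
    intro y
    obtain ⟨a, rfl⟩ := QuotientGroup.mk_surjective y
    have h3 : ∀ g : G, g • (a : G ⧸ H) = a ↔ a⁻¹ * g * a ∈ H := by
      intro g
      rw [eq_comm, ← smul_eq_mul, MulAction.Quotient.smul_coe, QuotientGroup.eq, smul_eq_mul,
        smul_eq_mul, mul_assoc]
    simp only [h3]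
    rw [← Fintype.sum_equiv (MulAut.conj a).toEquiv (fun g => f g * if g ∈ H then (1 : ℂ) else 0)]
    · simp only [mul_ite, mul_one, mul_zero]
      rw [← Finset.sum_filter]
      exact Finset.sum_subtype _ (fun g => by simp) _
    · intro g
      have h4 := hf a g
      simp only [mul_assoc] at h4
      simp [h4, mul_assoc]
  rw [Finset.sum_congr rfl fun g _ => by rw [h1 g, Finset.mul_sum], Finset.sum_comm, Finset.sum_congr rfl fun y _ => h2 y, Finset.sum_const, nsmul_eq_mul,
    Finset.card_univ, Subgroup.index, Nat.card_eq_fintype_card]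

end Permutation

/-! ### Divisibility of multiplicities and induction from hyperelementary subgroups -/

section Rank

variable {G : Type} [Group G] [Finite G] {V : Type} [AddCommGroup V] [Module ℂ V]

/-- The class functions `F` whose products with all characters have multiplicities divisible
by `q` in `ρ`, formulated without division. -/
def dvdMultiplicity (ρ : Representation ℂ G V) (q : ℕ) : AddSubgroup (G → ℂ) where
  carrier := {F | ∀ (W : Type) [AddCommGroup W] [Module ℂ W] [FiniteDimensional ℂ W]
    (σ : Representation ℂ G W), ∃ z : ℤ,
      ∑ᶠ g : G, ρ.character g * F g * σ.character g⁻¹ = Nat.card G * q * z}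
  zero_mem' := fun W _ _ _ σ => ⟨0, by simp⟩
  add_mem' := by
    intro F F' h h' W _ _ _ σ
    have _ := Fintype.ofFinite G
    obtain ⟨z, hz⟩ := h W σ
    obtain ⟨z', hz'⟩ := h' W σ
    refine ⟨z + z', ?_⟩
    rw [finsum_eq_sum_of_fintype] at hz hz' ⊢
    simp only [Pi.add_apply, mul_add, add_mul, Finset.sum_add_distrib, hz, hz', Int.cast_add]
  neg_mem' := by
    intro F h W _ _ _ σ
    have _ := Fintype.ofFinite G
    obtain ⟨z, hz⟩ := h W σ
    refine ⟨-z, ?_⟩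
    rw [finsum_eq_sum_of_fintype] at hz ⊢
    simp only [Pi.neg_apply, mul_neg, neg_mul, Finset.sum_neg_distrib, hz, Int.cast_neg]

/-- The permutation character is real, so it can be moved to the other factor, where it is absorbed
by tensoring σ with the permutation representation. -/
theorem permRep_mul_mem_dvdMultiplicity {ρ : Representation ℂ G V} {q : ℕ} (Y : Type)
    [Finite Y] [MulAction G Y] {F : G → ℂ} (hF : F ∈ ρ.dvdMultiplicity q) :
    (permRep G Y).character * F ∈ ρ.dvdMultiplicity q := by
  intro W _ _ _ σ
  have _ := Fintype.ofFinite Y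
  obtain ⟨z, hz⟩ := hF _ ((permRep G Y).tprod σ)
  refine ⟨z, hz ▸ finsum_congr fun g => ?_⟩
  rw [char_tensor, Pi.mul_apply, Pi.mul_apply, character_permRep_inv]
  ring

variable [FiniteDimensional ℂ V]

/-- By Frobenius reciprocity the multiplicity in question is that of σ_H in ρ_H. Operators from the
group algebra of H are also operators from that of G, so the divisibility of ranks passes to H. -/
theorem character_permRep_mem_dvdMultiplicity {ρ : Representation ℂ G V} {q : ℕ} [Fact q.Prime]
    (hρ : ∀ x : MonoidAlgebra Qab G, q ∣ finrank ℂ (LinearMap.range (ρ.qabOp x)))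
    {H : Subgroup G} (hH : IsHyperelementary q H) :
    (permRep G (G ⧸ H)).character ∈ ρ.dvdMultiplicity q := by
  intro W _ _ _ σ
  classical
  have _ := Fintype.ofFinite G
  obtain ⟨C, hCn, hCc, hC⟩ := hH
  obtain ⟨m, hm⟩ := dvd_finrank_intertwiningMap C hC (ρ.comp H.subtype) (fun x => by
    rw [qabOp_comp]; exact hρ _) W (σ.comp H.subtype)
  refine ⟨m, ?_⟩
  rw [finsum_eq_sum_of_fintype]
  have h1 := sum_mul_character_permRep H (fun g => ρ.character g * σ.character g⁻¹) (fun g h => by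
    have h2 : (g * h * g⁻¹)⁻¹ = g * h⁻¹ * g⁻¹ := by group
    rw [h2, char_conj, char_conj])
  have h3 := sum_char_mul_char_inv (σ.comp H.subtype) (ρ.comp H.subtype)
  have h4 : ∑ h : H, ρ.character (h : G) * σ.character (h : G)⁻¹ =
      Nat.card H * finrank ℂ (IntertwiningMap (σ.comp H.subtype) (ρ.comp H.subtype)) := h3
  rw [h4, hm] at h1
  rw [← Subgroup.card_mul_index H]
  push_cast at h1 ⊢
  rw [show (Nat.card H : ℂ) * H.index * q * m = H.index * (Nat.card H * (q * m)) by ring, ← h1]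
  exact Finset.sum_congr rfl fun g _ => by ring

/-- If q divided all ranks, permutation characters on cosets of q-hyperelementary subgroups would
lie in an ideal of functions that multiply ρ into multiplicities divisible by q. A function
congruent to 1 modulo this ideal, yet with values divisible by a high power of q, gives the
contradiction. -/
theorem exists_not_dvd_finrank_range_qabOp (ρ : Representation ℂ G V) [ρ.IsIrreducible] (q : ℕ)
    [hq : Fact q.Prime] :
    ∃ x : MonoidAlgebra Qab G, ¬ q ∣ finrank ℂ (LinearMap.range (ρ.qabOp x)) := by
  by_contra! hρ
  have _ := Fintype.ofFinite G
  choose H hH hfix using fun x : G => exists_isHyperelementary_not_dvd_card_fixedBy q x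
  let c : G → (G → ℂ) := fun x => (permRep G (G ⧸ H x)).character
  -- the submonoid of functions congruent to one modulo the ideal
  let R : Subring (G → ℂ) :=
    { carrier := {P | ∀ F ∈ ρ.dvdMultiplicity q, P * F ∈ ρ.dvdMultiplicity q}
      mul_mem' := fun {a b} ha hb F hF => by rw [mul_assoc]; exact ha _ (hb F hF)
      one_mem' := fun F hF => by rwa [one_mul]
      add_mem' := fun {a b} ha hb F hF => by
        rw [add_mul]; exact AddSubgroup.add_mem _ (ha F hF) (hb F hF)
      zero_mem' := fun F hF => by rw [zero_mul]; exact AddSubgroup.zero_mem _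
      neg_mem' := fun {a} ha F hF => by rw [neg_mul]; exact AddSubgroup.neg_mem _ (ha F hF) }
  let J : Submonoid (G → ℂ) :=
    { carrier := {P | P ∈ R ∧ 1 - P ∈ ρ.dvdMultiplicity q}
      one_mem' := ⟨R.one_mem, by rw [sub_self]; exact AddSubgroup.zero_mem _⟩
      mul_mem' := by
        rintro a b ⟨ha, ha'⟩ ⟨hb, hb'⟩
        refine ⟨R.mul_mem ha hb, ?_⟩
        have h1 : 1 - a * b = (1 - a) + a * (1 - b) := by ring
        rw [h1]
        exact AddSubgroup.add_mem _ ha' (ha _ hb') }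
  have hcR : ∀ x, c x ∈ R := fun x F hF => permRep_mul_mem_dvdMultiplicity _ hF
  have hcI : ∀ x, c x ∈ ρ.dvdMultiplicity q := fun x => character_permRep_mem_dvdMultiplicity hρ (hH x)
  -- The exponent comes from Fermat: the value of `c x` at x is prime to q, so this function is
  -- divisible by q at x. It is congruent to 1 modulo the ideal because q - 1 is positive.
  have hJ : ∀ x, 1 - c x ^ (q - 1) ∈ J := by
    intro x
    refine ⟨R.sub_mem R.one_mem (R.pow_mem (hcR x) _), ?_⟩
    have h2 : q - 1 = (q - 2) + 1 := by have := hq.out.two_le; omega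
    rw [sub_sub_cancel, h2, pow_succ]
    exact R.pow_mem (hcR x) _ _ (hcI x)
  set N := Nat.card G with hN
  -- The N-th power makes all values divisible by q^N, which exceeds the denominator N = |G| of the
  -- inner product.
  have hP : (∏ x : G, (1 - c x ^ (q - 1))) ^ N ∈ J := J.pow_mem (J.prod_mem fun x _ => hJ x) N
  have hval : ∀ y : G, ∃ z : ℤ, ((∏ x : G, (1 - c x ^ (q - 1))) ^ N) y = (q : ℂ) ^ N * z := by
    intro y
    let f : G → ℤ := fun x => 1 - (Nat.card (MulAction.fixedBy (G ⧸ H x) y) : ℤ) ^ (q - 1)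
    have h1 : ((∏ x : G, (1 - c x ^ (q - 1))) ^ N) y = ((∏ x, f x : ℤ) : ℂ) ^ N := by
      rw [Pi.pow_apply, Finset.prod_apply, Int.cast_prod]
      congr 1
      refine Finset.prod_congr rfl fun x _ => ?_
      simp [c, f, character_permRep]
    have h2 : (q : ℤ) ∣ ∏ x, f x := by
      refine dvd_trans ?_ (Finset.dvd_prod_of_mem f (Finset.mem_univ y))
      have h3 : IsCoprime (Nat.card (MulAction.fixedBy (G ⧸ H y) y) : ℤ) q := by
        rw [Nat.isCoprime_iff_coprime]
        exact ((Nat.Prime.coprime_iff_not_dvd hq.out).mpr (hfix y)).symm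
      exact (Int.ModEq.pow_card_sub_one_eq_one hq.out h3).dvd
    obtain ⟨z, hz⟩ := h2
    exact ⟨z ^ N, by rw [h1, hz]; push_cast; ring⟩
  choose z hz using hval
  -- Testing against ρ itself, where [ρ, ρ] = 1, shows that N(1 - qt) is q^N times an algebraic
  -- integer. That integer is rational, so q^N divides N(1 - qt), hence N, against N < q^N.
  obtain ⟨t, ht⟩ := hP.2 V ρ
  rw [finsum_eq_sum_of_fintype] at ht
  have hρρ : ∑ g, ρ.character g * ρ.character g⁻¹ = N := by
    rw [sum_char_mul_char_inv, IsIrreducible.finrank_intertwiningMap_self, Nat.cast_one, mul_one]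
  have h5 : (q : ℂ) ^ N * ∑ g, ρ.character g * z g * ρ.character g⁻¹ = N * (1 - q * t) := by
    have h6 : ∀ g, ρ.character g * (1 - (∏ x : G, (1 - c x ^ (q - 1))) ^ N) g * ρ.character g⁻¹ =
        ρ.character g * ρ.character g⁻¹ -
          (q : ℂ) ^ N * (ρ.character g * z g * ρ.character g⁻¹) := by
      intro g
      rw [Pi.sub_apply, hz g, Pi.one_apply]
      ring
    rw [Finset.sum_congr rfl fun g _ => h6 g, Finset.sum_sub_distrib, hρρ, ← Finset.mul_sum] at ht
    linear_combination -ht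
  have hq0 : (q : ℂ) ^ N ≠ 0 := pow_ne_zero _ (Nat.cast_ne_zero.mpr hq.out.ne_zero)
  have hint : IsIntegral ℤ (∑ g, ρ.character g * z g * ρ.character g⁻¹) :=
    IsIntegral.sum _ fun g _ => ((ρ.isIntegral_character g).mul isIntegral_algebraMap).mul
      (ρ.isIntegral_character g⁻¹)
  have hrat : (∑ g, ρ.character g * z g * ρ.character g⁻¹) =
      algebraMap ℚ ℂ ((N : ℚ) * (1 - q * t) / (q : ℚ) ^ N) := by
    rw [eq_comm, map_div₀, div_eq_iff (by simpa using hq0)]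
    simp only [map_mul, map_sub, map_one, map_natCast, map_intCast, map_pow]
    rw [← h5]; ring
  rw [hrat, isIntegral_algebraMap_iff (algebraMap ℚ ℂ).injective,
    IsIntegrallyClosed.isIntegral_iff] at hint
  obtain ⟨s, hs⟩ := hint
  have hq0' : (q : ℚ) ^ N ≠ 0 := pow_ne_zero _ (Nat.cast_ne_zero.mpr hq.out.ne_zero)
  rw [eq_div_iff hq0'] at hs
  have hs' : s * (q : ℤ) ^ N = N * (1 - q * t) := by
    have : ((s * (q : ℤ) ^ N : ℤ) : ℚ) = ((N * (1 - q * t) : ℤ) : ℚ) := by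
      push_cast
      simpa using hs
    exact_mod_cast this
  have hcop : IsCoprime ((q : ℤ) ^ N) (1 - q * t) :=
    IsCoprime.pow_left ⟨t, 1, by ring⟩
  have hdvd : (q : ℤ) ^ N ∣ N := hcop.dvd_of_dvd_mul_right (hs' ▸ dvd_mul_left _ _)
  have hle : q ^ N ≤ N := Nat.le_of_dvd Nat.card_pos (by exact_mod_cast hdvd)
  exact absurd (Nat.lt_pow_self hq.out.one_lt) (not_lt.mpr hle)

end Rank

end Representation

/-! ### Left ideals of isotypic semisimple algebras -/

/-- Take for x a generator of a minimal left ideal S. Isotypicity makes every left ideal By a direct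
sum of copies of S. -/
theorem exists_finrank_range_mulRight_dvd {k B : Type*} [Field k] [Ring B] [Nontrivial B]
    [Algebra k B] [Module.Finite k B] [IsSemisimpleRing B] (hB : IsIsotypic B B) :
    ∃ x : B, x ≠ 0 ∧ ∀ y : B, Module.finrank k (LinearMap.range (LinearMap.mulRight k x)) ∣
      Module.finrank k (LinearMap.range (LinearMap.mulRight k y)) := by
  obtain ⟨S, hS⟩ := IsAtomic.exists_atom (Submodule B B)
  rw [← isSimpleModule_iff_isAtom] at hS
  have := IsSimpleModule.nontrivial B S
  obtain ⟨x, hx⟩ := exists_ne (0 : S)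
  have hleft : ∀ y : B, LinearMap.range (LinearMap.mulRight k y) =
      (Submodule.span B {y}).restrictScalars k := by
    intro y
    refine le_antisymm ?_ ?_
    · rintro _ ⟨b, rfl⟩
      exact Submodule.smul_mem _ b (Submodule.mem_span_singleton_self y)
    · intro b hb
      obtain ⟨c, rfl⟩ := Submodule.mem_span_singleton.mp hb
      exact ⟨c, rfl⟩
  have hSx : Submodule.span B {(x : B)} = S := by
    have h1 : Submodule.span B {(x : B)} ≤ S := (Submodule.span_singleton_le_iff_mem _ _).mpr x.2
    refine (isSimpleModule_iff_isAtom.mp hS).le_iff_eq ?_ |>.mp h1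
    rw [Ne, Submodule.span_singleton_eq_bot]
    exact fun h0 => hx (Subtype.ext h0)
  refine ⟨x, fun h0 => hx (Subtype.ext h0), fun y => ?_⟩
  rw [hleft, hleft, hSx]
  have h1 : IsIsotypicOfType B (Submodule.span B {y}) S :=
    (hB S).of_injective (Submodule.subtype _) (Submodule.subtype_injective _)
  obtain ⟨n, ⟨e⟩⟩ := h1.linearEquiv_fun
  have h2 := (e.restrictScalars k).finrank_eq
  rw [Module.finrank_pi_fintype, Finset.sum_const, Finset.card_univ, Fintype.card_fin,
    smul_eq_mul] at h2
  exact ⟨n, h2.trans (mul_comm _ _)⟩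

theorem Subalgebra.finrank_range_mulRight {k A : Type*} [Field k] [Ring A] [Algebra k A]
    (B : Subalgebra k A) (y : B) :
    Module.finrank k (LinearMap.range (LinearMap.mulRight k y)) =
      Module.finrank k ((Subalgebra.toSubmodule B).map (LinearMap.mulRight k (y : A))) := by
  have h1 : (Subalgebra.toSubmodule B).map (LinearMap.mulRight k (y : A)) =
      (LinearMap.range (LinearMap.mulRight k y)).map B.val.toLinearMap := by
    refine le_antisymm ?_ ?_
    · rintro _ ⟨b, hb, rfl⟩
      exact ⟨_, ⟨⟨b, hb⟩, rfl⟩, rfl⟩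
    · rintro _ ⟨_, ⟨c, rfl⟩, rfl⟩
      exact ⟨c, c.2, rfl⟩
  rw [h1]
  exact (Submodule.equivMapOfInjective B.val.toLinearMap Subtype.val_injective _).finrank_eq

theorem Subalgebra.exists_finrank_map_mulRight_dvd {k A : Type*} [Field k] [Ring A] [Nontrivial A]
    [Algebra k A] (B : Subalgebra k A) [Module.Finite k B] [IsSemisimpleRing B]
    (hB : IsIsotypic B B) :
    ∃ x : B, x ≠ 0 ∧ ∀ y : B,
      Module.finrank k ((Subalgebra.toSubmodule B).map (LinearMap.mulRight k (x : A))) ∣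
      Module.finrank k ((Subalgebra.toSubmodule B).map (LinearMap.mulRight k (y : A))) := by
  obtain ⟨x, hx, h⟩ := exists_finrank_range_mulRight_dvd (k := k) hB
  refine ⟨x, hx, fun y => ?_⟩
  rw [← B.finrank_range_mulRight, ← B.finrank_range_mulRight]
  exact h y

namespace Representation

open Module

/-! ### Brauer's theorem: realization over ℚ^ab -/

section Realization

variable {G V : Type*} [Group G] [AddCommGroup V] [Module ℂ V] [FiniteDimensional ℂ V]

/-- Burnside: the operators of an irreducible representation span the endomorphism ring. -/
theorem span_range_eq_top (ρ : Representation ℂ G V) [ρ.IsIrreducible] :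
    Submodule.span ℂ (Set.range ρ) = ⊤ := by
  rw [eq_top_iff]
  intro T _
  let R := MonoidAlgebra ℂ G
  have hbij : Function.Bijective (algebraMap ℂ (Module.End R ρ.asModule)) :=
    IsSimpleModule.algebraMap_end_bijective_of_isAlgClosed ℂ
  have : Module.Finite (Module.End R ρ.asModule) ρ.asModule :=
    Module.Finite.of_restrictScalars_finite ℂ _ _
  let T' : Module.End (Module.End R ρ.asModule) ρ.asModule :=
    { toFun := T
      map_add' := T.map_add
      map_smul' := by
        intro f v
        obtain ⟨z, rfl⟩ := hbij.2 f
        exact T.map_smul z v }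
  obtain ⟨r, hr⟩ := Module.Finite.toModuleEnd_moduleEnd_surjective (R := R) (M := ρ.asModule) T'
  have h1 : T = ρ.asAlgebraHom r := LinearMap.ext fun v => (LinearMap.congr_fun hr v).symm
  have key : ∀ r : R, ρ.asAlgebraHom r ∈ Submodule.span ℂ (Set.range ρ) := by
    intro r
    induction r using MonoidAlgebra.induction_linear with
    | zero => rw [map_zero]; exact Submodule.zero_mem _
    | add x y hx hy => rw [map_add]; exact Submodule.add_mem _ hx hy
    | single g a =>
      rw [asAlgebraHom_single]
      exact Submodule.smul_mem _ _ (Submodule.subset_span ⟨g, rfl⟩)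
  exact h1 ▸ key r

/-- The trace form is nondegenerate, as rank one operators already show. -/
theorem eq_zero_of_trace_mul_eq_zero {x : Module.End ℂ V}
    (h : ∀ T : Module.End ℂ V, LinearMap.trace ℂ V (T * x) = 0) : x = 0 := by
  refine LinearMap.ext fun v => ?_
  rw [LinearMap.zero_apply, ← Module.forall_dual_apply_eq_zero_iff ℂ]
  intro φ
  have h1 := h (dualTensorHom ℂ V V (φ ⊗ₜ v))
  rw [LinearMap.trace_mul_comm] at h1
  have h2 : x * dualTensorHom ℂ V V (φ ⊗ₜ v) = dualTensorHom ℂ V V (φ ⊗ₜ x v) := by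
    ext w; simp
  rwa [h2, LinearMap.trace_eq_contract_apply, contractLeft_apply] at h1

/-- For nonzero x and y in two minimal left ideals some b has ybx ≠ 0, since the algebra spans
End(V) over ℂ. Right multiplication by bx is then a nonzero map between simple modules. -/
theorem isIsotypic_range_qabOp (ρ : Representation ℂ G V) [ρ.IsIrreducible] :
    IsIsotypic ρ.qabOp.range ρ.qabOp.range := by
  intro m hm m' hm'
  have := IsSimpleModule.nontrivial ρ.qabOp.range m
  have := IsSimpleModule.nontrivial ρ.qabOp.range m'
  obtain ⟨x, hx⟩ := exists_ne (0 : m)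
  obtain ⟨y, hy⟩ := exists_ne (0 : m')
  -- some element `b` satisfies `y b x ≠ 0`
  obtain ⟨b, hb⟩ : ∃ b : ρ.qabOp.range, (y : ρ.qabOp.range) * b * x ≠ 0 := by
    by_contra! h
    have h1 : ∀ T : Module.End ℂ V, ((y : ρ.qabOp.range) : Module.End ℂ V) * T *
        ((x : ρ.qabOp.range) : Module.End ℂ V) = 0 := by
      intro T
      have hT : T ∈ Submodule.span ℂ (Set.range ρ) := ρ.span_range_eq_top ▸ Submodule.mem_top
      induction hT using Submodule.span_induction with
      | mem T hT =>
        obtain ⟨g, rfl⟩ := hT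
        exact congrArg Subtype.val (h ⟨ρ g, ⟨MonoidAlgebra.single g 1, by simp⟩⟩)
      | zero => simp
      | add T T' _ _ hT hT' => rw [mul_add, add_mul, hT, hT', add_zero]
      | smul z T _ hT => rw [mul_smul_comm, smul_mul_assoc, hT, smul_zero]
    have hx' : ((x : ρ.qabOp.range) : Module.End ℂ V) ≠ 0 := fun h0 =>
      hx (Subtype.ext (Subtype.ext h0))
    have hy' : ((y : ρ.qabOp.range) : Module.End ℂ V) ≠ 0 := fun h0 =>
      hy (Subtype.ext (Subtype.ext h0))
    obtain ⟨v, hv⟩ := DFunLike.ne_iff.mp hx'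
    obtain ⟨w, hw⟩ := DFunLike.ne_iff.mp hy'
    obtain ⟨φ, hφ⟩ := not_forall.mp (mt (Module.forall_dual_apply_eq_zero_iff ℂ _).mp hv)
    have h2 := LinearMap.congr_fun (h1 (φ.smulRight w)) v
    simp only [Module.End.mul_apply, LinearMap.smulRight_apply, map_smul, LinearMap.zero_apply] at h2
    exact hw ((smul_eq_zero.mp h2).resolve_left hφ)
  let f : m' →ₗ[ρ.qabOp.range] m :=
    { toFun := fun z => ⟨z * (b * x), m.smul_mem ((z : ρ.qabOp.range) * b) x.2 |> fun h => by
        simpa [mul_assoc] using h⟩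
      map_add' := fun z z' => Subtype.ext (add_mul _ _ _)
      map_smul' := fun c z => Subtype.ext (mul_assoc _ _ _) }
  have hf : f ≠ 0 := fun h0 => hb (by
    rw [mul_assoc]; exact congrArg Subtype.val (LinearMap.congr_fun h0 y))
  exact ⟨LinearEquiv.ofBijective f ((LinearMap.bijective_or_eq_zero f).resolve_right hf)⟩

variable [Finite G] (ρ : Representation ℂ G V)

theorem trace_qabOp_mem (x : MonoidAlgebra Qab G) : LinearMap.trace ℂ V (ρ.qabOp x) ∈ Qab := by
  induction x using MonoidAlgebra.induction_linear with
  | zero => simp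
  | add x y hx hy => rw [map_add, map_add]; exact Qab.add_mem hx hy
  | single g a =>
    rw [qabOp_single, map_smul, smul_eq_mul]
    exact Qab.mul_mem a.2 (ρ.character_mem_Qab g)

instance finite_range_qabOp : Module.Finite Qab ρ.qabOp.range :=
  Module.Finite.of_surjective ρ.qabOp.rangeRestrict.toLinearMap ρ.qabOp.rangeRestrict_surjective

variable [ρ.IsIrreducible]

/-- A basis of the endomorphism ring consisting of group elements is a `ℚ^ab`-basis of the
`ℚ^ab`-algebra they generate. -/
theorem finrank_range_qabOp_le : finrank Qab ρ.qabOp.range ≤ finrank ℂ (Module.End ℂ V) := by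
  classical
  let b := Basis.ofSpan ρ.span_range_eq_top.ge
  have hb : ∀ i, ∃ g, b i = ρ g := by
    intro i
    obtain ⟨g, hg⟩ := Basis.ofSpan_subset ρ.span_range_eq_top.ge ⟨i, rfl⟩
    exact ⟨g, hg.symm⟩
  have _ := FiniteDimensional.fintypeBasisIndex b
  choose g hg using hb
  have hbr : ∀ i, b i ∈ ρ.qabOp.range := fun i => ⟨MonoidAlgebra.single (g i) 1, by
    rw [hg]; simp⟩
  -- This Gram matrix is invertible, and its entries are character values, so lie in ℚ^ab.
  -- Coordinates of any ℚ^ab-operator are found by solving a linear system over ℚ^ab.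
  let M : Matrix _ _ ℂ := fun i j => LinearMap.trace ℂ V (b i * b j)
  have hM : ∀ i j, M i j ∈ Qab := by
    intro i j
    change LinearMap.trace ℂ V (b i * b j) ∈ Qab
    rw [hg, hg, ← map_mul]
    exact ρ.character_mem_Qab _
  let M₀ : Matrix _ _ Qab := fun i j => ⟨M i j, hM i j⟩
  have hMM : M₀.map (algebraMap Qab ℂ) = M := rfl
  have hdet : M.det ≠ 0 := by
    intro h0
    obtain ⟨v, hv, hMv⟩ := Matrix.exists_mulVec_eq_zero_iff.mpr h0
    have h1 : ∑ j, v j • b j = 0 := by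
      refine eq_zero_of_trace_mul_eq_zero fun T => ?_
      rw [← b.sum_repr T, Finset.sum_mul, map_sum]
      refine Finset.sum_eq_zero fun i _ => ?_
      rw [smul_mul_assoc, map_smul, Finset.mul_sum, map_sum]
      have h2 := congrFun hMv i
      simp only [Matrix.mulVec, dotProduct, Pi.zero_apply] at h2
      rw [Finset.sum_congr rfl fun j _ => by rw [mul_smul_comm, map_smul, smul_eq_mul, mul_comm],
        h2, smul_zero]
    exact hv (funext (Fintype.linearIndependent_iff.mp b.linearIndependent v h1))
  have hdet₀ : IsUnit M₀.det := by
    rw [isUnit_iff_ne_zero]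
    intro h0
    apply hdet
    rw [← hMM, ← RingHom.mapMatrix_apply, ← RingHom.map_det, h0, map_zero]
  have hspan : (⊤ : Submodule Qab ρ.qabOp.range) ≤
      Submodule.span Qab (Set.range fun i => (⟨b i, hbr i⟩ : ρ.qabOp.range)) := by
    rintro ⟨_, x, rfl⟩ _
    let w := fun i => show Qab from ⟨LinearMap.trace ℂ V (b i * ρ.qabOp x), by
      obtain ⟨y, hy⟩ := hbr i
      rw [← hy]
      change LinearMap.trace ℂ V (ρ.qabOp y * _) ∈ Qab
      rw [← map_mul]
      exact ρ.trace_qabOp_mem _⟩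
    let c := M₀⁻¹.mulVec w
    have hc : M₀.mulVec c = w := by
      rw [Matrix.mulVec_mulVec, Matrix.mul_nonsing_inv _ hdet₀, Matrix.one_mulVec]
    have h1 : ρ.qabOp x = ∑ j, (c j : ℂ) • b j := by
      rw [← sub_eq_zero]
      refine eq_zero_of_trace_mul_eq_zero fun T => ?_
      rw [← b.sum_repr T, Finset.sum_mul, map_sum]
      refine Finset.sum_eq_zero fun i _ => ?_
      have h2 := congrArg (algebraMap Qab ℂ) (congrFun hc i)
      simp only [Matrix.mulVec, dotProduct, map_sum, map_mul] at h2
      have h3 : LinearMap.trace ℂ V (b i * ∑ j, (c j : ℂ) • b j) =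
          LinearMap.trace ℂ V (b i * ρ.qabOp x) := by
        rw [Finset.mul_sum, map_sum]
        refine Eq.trans (Finset.sum_congr rfl fun j _ => ?_) h2
        rw [mul_smul_comm, map_smul, smul_eq_mul, mul_comm]
        rfl
      rw [smul_mul_assoc, map_smul, mul_sub, map_sub, h3, sub_self, smul_zero]
    have h4 : (⟨ρ.qabOp x, ⟨x, rfl⟩⟩ : ρ.qabOp.range) =
        ∑ j, c j • (⟨b j, hbr j⟩ : ρ.qabOp.range) := by
      apply Subtype.ext
      refine h1.trans ?_
      rw [AddSubmonoidClass.coe_finsetSum]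
      rfl
    change (⟨ρ.qabOp x, ⟨x, rfl⟩⟩ : ρ.qabOp.range) ∈ _
    rw [h4]
    exact Submodule.sum_mem _ fun j _ => Submodule.smul_mem _ _ (Submodule.subset_span ⟨j, rfl⟩)
  rw [← finrank_top, finrank_eq_card_basis b]
  refine (Submodule.finrank_mono hspan).trans ?_
  exact finrank_range_le_card _

/-- For a `ℚ^ab`-subspace of the algebra generated by an irreducible representation, linear
independence over `ℚ^ab` and over `ℂ` agree. -/
theorem finrank_eq_finrank_span {I : Submodule Qab (Module.End ℂ V)}
    (hI : I ≤ Subalgebra.toSubmodule ρ.qabOp.range) :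
    finrank Qab I = finrank ℂ (Submodule.span ℂ (I : Set (Module.End ℂ V))) := by
  have : Module.Finite Qab (Subalgebra.toSubmodule ρ.qabOp.range) := ρ.finite_range_qabOp
  have : Module.Finite Qab I := Submodule.finiteDimensional_of_le hI
  let bI := Module.finBasis Qab I
  let v : Fin (finrank Qab I) → ρ.qabOp.range := fun i => ⟨bI i, hI (bI i).2⟩
  have hv : LinearIndependent Qab v := by
    have h1 := bI.linearIndependent.map' (Submodule.inclusion hI) (Submodule.ker_inclusion _ _ _)
    exact h1
  let be := Basis.sumExtend hv
  have hbe : ∀ i, be (Sum.inl i) = v i := fun i => by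
    simp [be, Basis.sumExtend]
    rfl
  have _ := FiniteDimensional.fintypeBasisIndex be
  have htop : (⊤ : Submodule ℂ (Module.End ℂ V)) ≤
      Submodule.span ℂ (Set.range fun i => (be i : Module.End ℂ V)) := by
    rw [← ρ.span_range_eq_top, Submodule.span_le]
    rintro _ ⟨g, rfl⟩
    have h1 : (⟨ρ g, ⟨MonoidAlgebra.single g 1, by simp⟩⟩ : ρ.qabOp.range) ∈
      Submodule.span Qab (Set.range be) := be.span_eq ▸ Submodule.mem_top
    have h2 := Submodule.mem_map_of_mem (f := ρ.qabOp.range.val.toLinearMap) h1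
    rw [Submodule.map_span, ← Set.range_comp] at h2
    exact Submodule.span_subset_span Qab ℂ _ h2
  -- A ℚ^ab-basis of the algebra spans End(V) over ℂ and has at most dim End(V) members, so it stays
  -- independent over ℂ.
  have hli := linearIndependent_of_top_le_span_of_card_le_finrank htop (by
    rw [← finrank_eq_card_basis be]
    exact ρ.finrank_range_qabOp_le)
  have hli' : LinearIndependent ℂ fun i => (bI i : Module.End ℂ V) := by
    have h1 := hli.comp Sum.inl Sum.inl_injective
    convert h1 using 2 with i
    simp only [Function.comp, hbe]
    rfl
  have hspan : Submodule.span ℂ (I : Set (Module.End ℂ V)) =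
      Submodule.span ℂ (Set.range fun i => (bI i : Module.End ℂ V)) := by
    refine le_antisymm (Submodule.span_le.mpr fun x hx => ?_) (Submodule.span_mono ?_)
    · have h1 : (⟨x, hx⟩ : I) ∈ Submodule.span Qab (Set.range bI) :=
        bI.span_eq ▸ Submodule.mem_top
      have h2 := Submodule.mem_map_of_mem (f := I.subtype) h1
      rw [Submodule.map_span, ← Set.range_comp] at h2
      exact Submodule.span_subset_span Qab ℂ _ h2
    · rintro _ ⟨i, rfl⟩
      exact (bI i).2
  rw [hspan, finrank_span_eq_card hli', Fintype.card_fin]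

/-- The left ideal generated by an operator has dimension proportional to the rank. -/
theorem finrank_mul_right {b : Module.End ℂ V} (hb : b ∈ ρ.qabOp.range) :
    finrank Qab ((Subalgebra.toSubmodule ρ.qabOp.range).map (LinearMap.mulRight Qab b)) =
      finrank ℂ V * finrank ℂ (LinearMap.range b) := by
  rw [ρ.finrank_eq_finrank_span]
  swap
  · rintro _ ⟨x, hx, rfl⟩
    exact ρ.qabOp.range.mul_mem hx hb
  -- Over ℂ the left ideal End(V)b consists of the operators factoring through the image of b.
  let Φ : (LinearMap.range b →ₗ[ℂ] V) →ₗ[ℂ] Module.End ℂ V :=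
    LinearMap.lcomp ℂ V b.rangeRestrict
  have hΦ : Function.Injective Φ := by
    intro S S' h
    refine LinearMap.ext fun w => ?_
    obtain ⟨v, rfl⟩ := b.surjective_rangeRestrict w
    exact LinearMap.congr_fun h v
  have h1 : Submodule.span ℂ (((Subalgebra.toSubmodule ρ.qabOp.range).map
      (LinearMap.mulRight Qab b) : Submodule Qab (Module.End ℂ V)) : Set (Module.End ℂ V)) =
      LinearMap.range Φ := by
    have h2 : (((Subalgebra.toSubmodule ρ.qabOp.range).map (LinearMap.mulRight Qab b) :
      Submodule Qab (Module.End ℂ V)) : Set (Module.End ℂ V)) =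
      LinearMap.mulRight ℂ b '' (ρ.qabOp.range : Set (Module.End ℂ V)) := rfl
    have h3 : Submodule.span ℂ (ρ.qabOp.range : Set (Module.End ℂ V)) = ⊤ := by
      rw [eq_top_iff, ← ρ.span_range_eq_top]
      refine Submodule.span_mono ?_
      rintro _ ⟨g, rfl⟩
      exact ⟨MonoidAlgebra.single g 1, by simp⟩
    rw [h2, ← Submodule.map_span, h3, Submodule.map_top]
    refine le_antisymm ?_ ?_
    · rintro _ ⟨T, rfl⟩
      exact ⟨T ∘ₗ (LinearMap.range b).subtype, LinearMap.ext fun v => rfl⟩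
    · rintro _ ⟨S, rfl⟩
      obtain ⟨T, hT⟩ := LinearMap.exists_extend S
      exact ⟨T, LinearMap.ext fun v => LinearMap.congr_fun hT ⟨b v, v, rfl⟩⟩
  rw [h1, LinearMap.finrank_range_of_inj hΦ, finrank_linearMap, mul_comm]

instance isSemisimpleRing_range_qabOp : IsSemisimpleRing ρ.qabOp.range :=
  ρ.qabOp.rangeRestrict.toRingHom.isSemisimpleRing_of_surjective ρ.qabOp.rangeRestrict_surjective

/-- There is an operator of rank one with coefficients in `ℚ^ab`. -/
theorem exists_mem_range_qabOp_finrank_eq_one {G V : Type} [Group G] [Finite G] [AddCommGroup V]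
    [Module ℂ V] [FiniteDimensional ℂ V] (ρ : Representation ℂ G V) [ρ.IsIrreducible] :
    ∃ b ∈ ρ.qabOp.range, finrank ℂ (LinearMap.range b) = 1 := by
  have hV : Nontrivial V := by
    by_contra hV
    rw [not_nontrivial_iff_subsingleton] at hV
    exact bot_ne_top (α := Subrepresentation ρ)
      (Subrepresentation.toSubmodule_injective (Subsingleton.elim _ _))
  obtain ⟨x, hx, hdvd⟩ := ρ.qabOp.range.exists_finrank_map_mulRight_dvd ρ.isIsotypic_range_qabOp
  set r := finrank ℂ (LinearMap.range (x : Module.End ℂ V)) with hr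
  replace hdvd : ∀ y : ρ.qabOp.range, r ∣ finrank ℂ (LinearMap.range (y : Module.End ℂ V)) := by
    intro y
    have h1 := hdvd y
    rw [ρ.finrank_mul_right x.2, ρ.finrank_mul_right y.2] at h1
    exact Nat.dvd_of_mul_dvd_mul_left finrank_pos h1
  refine ⟨x, x.2, ?_⟩
  rw [← hr]
  -- Left ideal dimensions are dim V times ranks, so the minimal rank r divides all ranks. A prime
  -- divisor of r would then divide the rank of every ℚ^ab-operator.
  by_contra h1
  obtain ⟨q, hq, hqr⟩ := Nat.exists_prime_and_dvd h1
  have := Fact.mk hq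
  obtain ⟨z, hz⟩ := ρ.exists_not_dvd_finrank_range_qabOp q
  exact hz (hqr.trans (hdvd ⟨ρ.qabOp z, z, rfl⟩))

/-- Brauer: an irreducible representation of a finite group can be realized over `ℚ^ab`. -/
theorem exists_basis_repr_mem_Qab {G V : Type} [Group G] [Finite G] [AddCommGroup V]
    [Module ℂ V] [FiniteDimensional ℂ V] (ρ : Representation ℂ G V) [ρ.IsIrreducible] :
    ∃ b : Basis (Fin (finrank ℂ V)) ℂ V, ∀ g i j, b.repr (ρ g (b j)) i ∈ Qab := by
  obtain ⟨x, hx, hx1⟩ := ρ.exists_mem_range_qabOp_finrank_eq_one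
  obtain ⟨⟨w, v, hv⟩, hw0, hw⟩ := finrank_eq_one_iff'.mp hx1
  -- The ℚ^ab-form of V is Bw, where B is the algebra and w spans the image of the rank one operator
  -- x. It is a quotient of the left ideal Bx, which bounds its dimension by dim V. It spans V by
  -- irreducibility.
  let V₀ : Submodule Qab V := (Subalgebra.toSubmodule ρ.qabOp.range).map
    ((LinearMap.applyₗ (R := ℂ) w).restrictScalars Qab)
  have hle : finrank Qab V₀ ≤ finrank ℂ V := by
    have h1 := ρ.finrank_mul_right hx
    rw [hx1, mul_one] at h1
    rw [← h1]
    have h2 : V₀ = ((Subalgebra.toSubmodule ρ.qabOp.range).map (LinearMap.mulRight Qab x)).map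
        ((LinearMap.applyₗ (R := ℂ) v).restrictScalars Qab) := by
      rw [← Submodule.map_comp]
      refine congrArg (fun f => Submodule.map f _) (LinearMap.ext fun T => ?_)
      change T w = T (x v)
      rw [hv]
    rw [h2]
    have : Module.Finite Qab (Subalgebra.toSubmodule ρ.qabOp.range) := ρ.finite_range_qabOp
    exact Submodule.finrank_map_le _ _
  have : Module.Finite Qab (Subalgebra.toSubmodule ρ.qabOp.range) := ρ.finite_range_qabOp
  have : Module.Finite Qab V₀ := inferInstanceAs (Module.Finite Qab (Submodule.map _ _))
  let e := Module.finBasis Qab V₀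
  have hgV₀ : ∀ g, ∀ u ∈ V₀, ρ g u ∈ V₀ := by
    rintro g _ ⟨T, hT, rfl⟩
    exact ⟨ρ g * T, ρ.qabOp.range.mul_mem ⟨MonoidAlgebra.single g 1, by simp⟩ hT, rfl⟩
  have hexp : ∀ u ∈ V₀, ∃ c : Fin (finrank Qab V₀) → Qab, u = ∑ i, (c i : ℂ) • (e i : V) := by
    intro u hu
    refine ⟨fun i => e.repr ⟨u, hu⟩ i, ?_⟩
    have h1 := congrArg Subtype.val (e.sum_repr ⟨u, hu⟩)
    rw [AddSubmonoidClass.coe_finsetSum] at h1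
    exact h1.symm
  have htop : (⊤ : Submodule ℂ V) ≤ Submodule.span ℂ (Set.range fun i => (e i : V)) := by
    have h1 : ∀ u ∈ V₀, u ∈ Submodule.span ℂ (Set.range fun i => (e i : V)) := by
      intro u hu
      obtain ⟨c, rfl⟩ := hexp u hu
      exact Submodule.sum_mem _ fun i _ => Submodule.smul_mem _ _ (Submodule.subset_span ⟨i, rfl⟩)
    have hwV : w ∈ V₀ := ⟨1, ρ.qabOp.range.one_mem, rfl⟩
    have hw0' : w ≠ 0 := fun h0 => hw0 (Subtype.ext h0)
    let A : Subrepresentation ρ :=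
      { toSubmodule := Submodule.span ℂ (Set.range fun i => (e i : V))
        apply_mem_toSubmodule := by
          intro g u hu
          induction hu using Submodule.span_induction with
          | mem u hu =>
            obtain ⟨i, rfl⟩ := hu
            exact h1 _ (hgV₀ g _ (e i).2)
          | zero => rw [map_zero]; exact Submodule.zero_mem _
          | add u u' _ _ hu hu' => rw [map_add]; exact Submodule.add_mem _ hu hu'
          | smul z u _ hu => rw [map_smul]; exact Submodule.smul_mem _ _ hu }
    rcases eq_bot_or_eq_top A with hA | hA
    · have h2 : w ∈ A.toSubmodule := h1 w hwV
      rw [hA] at h2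
      exact absurd h2 hw0'
    · exact (congrArg Subrepresentation.toSubmodule hA).ge
  have hcard : finrank Qab V₀ = finrank ℂ V := by
    refine le_antisymm hle ?_
    rw [← finrank_top]
    refine (Submodule.finrank_mono htop).trans ((finrank_range_le_card _).trans ?_)
    rw [Fintype.card_fin]
  let b₀ := basisOfTopLeSpanOfCardEqFinrank (fun i => (e i : V)) htop (by
    rw [Fintype.card_fin, hcard])
  have hb₀ : ∀ i, b₀ i = e i := fun i => by simp [b₀]
  refine ⟨b₀.reindex (finCongr hcard), fun g i j => ?_⟩
  rw [Basis.repr_reindex_apply, Basis.reindex_apply, hb₀]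
  obtain ⟨c, hc⟩ := hexp _ (hgV₀ g _ (e ((finCongr hcard).symm j)).2)
  rw [hc]
  simp only [← hb₀]
  rw [Basis.repr_sum_self]
  exact (c _).2

end Realization

end Representation

/-! ### Projective homomorphisms with determinant -/

section Cocycle

variable {A Γ Z : Type*} [Group A] [Group Γ] [CommGroup Z]

theorem prod_mul_left_out [Finite A] (M : Subgroup A) [M.Normal] [Fintype (A ⧸ M)] (f : A → Z)
    (hf : ∀ x, ∀ y ∈ M, f (x * y) = f x) (a : A) :
    ∏ q : A ⧸ M, f (a * q.out) = ∏ q : A ⧸ M, f q.out := by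
  refine Fintype.prod_equiv (Equiv.mulLeft (a : A ⧸ M)) _ _ fun q => ?_
  have h : (((Equiv.mulLeft (a : A ⧸ M)) q).out)⁻¹ * (a * q.out) ∈ M := by
    rw [← QuotientGroup.eq]
    simp
  have h2 := hf ((Equiv.mulLeft (a : A ⧸ M)) q).out _ h
  rwa [mul_inv_cancel_left] at h2

/-- A projective homomorphism `R` into a group with a determinant of degree `m`, trivial on a normal
subgroup of index prime to `m`, can be rescaled to a homomorphism of determinant one. -/
theorem exists_rescale_det_eq_one [Finite A] (M : Subgroup A) [M.Normal] {m : ℕ}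
    (hm : M.index.Coprime m) {s : Z →* Γ} (hs : Function.Injective s) (hc : ∀ z g, Commute (s z) g)
    {det : Γ →* Z} (hdet : ∀ z, det (s z) = z ^ m)
    (hroot : ∀ z : Z, IsOfFinOrder z → ∃ w, IsOfFinOrder w ∧ w ^ m = z)
    {R : A → Γ} {β : A → A → Z} (hβ : ∀ x y, IsOfFinOrder (β x y))
    (hR : ∀ x y, R (x * y) = s (β x y) * (R x * R y)) (hM : ∀ y ∈ M, R y = 1)
    (hMl : ∀ y ∈ M, ∀ x, R (y * x) = R x) (hMr : ∀ x, ∀ y ∈ M, R (x * y) = R x) :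
    ∃ ν : A → Z, (∀ x, IsOfFinOrder (ν x)) ∧ (∀ y ∈ M, ν y = 1) ∧ (∀ y ∈ M, ∀ x, ν (y * x) = ν x) ∧
      (∀ x, ∀ y ∈ M, ν (x * y) = ν x) ∧
      (∀ x y, s (ν (x * y)) * R (x * y) = (s (ν x) * R x) * (s (ν y) * R y)) ∧
      ∀ x, det (s (ν x) * R x) = 1 := by
  classical
  have : Fintype (A ⧸ M) := Fintype.ofFinite _
  have hpow : ∀ (x : A) (n : ℕ), ∃ z : Z, IsOfFinOrder z ∧ R (x ^ n) = s z * R x ^ n := by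
    intro x n
    induction n with
    | zero => exact ⟨1, IsOfFinOrder.one, by simp [hM 1 M.one_mem]⟩
    | succ n ih =>
      obtain ⟨z, hz, h⟩ := ih
      refine ⟨β (x ^ n) x * z, (hβ _ _).mul hz, ?_⟩
      rw [pow_succ, hR, h, map_mul, pow_succ]
      simp only [mul_assoc]
  have hfin : ∀ x, IsOfFinOrder (det (R x)) := by
    intro x
    obtain ⟨z, hz, h⟩ := hpow x (Nat.card A)
    rw [pow_card_eq_one', hM 1 M.one_mem] at h
    have h2 := congrArg det h
    rw [map_one, map_mul, hdet, map_pow] at h2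
    refine (isOfFinOrder_pow.mp ?_).resolve_right (Nat.card_pos (α := A)).ne'
    rw [← inv_eq_of_mul_eq_one_right h2.symm]
    exact hz.pow.inv
  have hroot' : ∀ z : Z, ∃ w, IsOfFinOrder z → IsOfFinOrder w ∧ w ^ m = z := by
    intro z
    by_cases hz : IsOfFinOrder z
    · obtain ⟨w, h⟩ := hroot z hz
      exact ⟨w, fun _ => h⟩
    · exact ⟨1, fun h => absurd h hz⟩
  choose r hr using hroot'
  -- The m-th root of 1 is chosen to be 1, so that the first rescaling is trivial on M.
  let ρ : Z → Z := fun z => if z = 1 then 1 else r z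
  have hρ1 : ρ 1 = 1 := if_pos rfl
  have hρ : ∀ z, IsOfFinOrder z → IsOfFinOrder (ρ z) ∧ ρ z ^ m = z := by
    intro z hz
    by_cases h : z = 1
    · simp [h, hρ1]
    · simpa [ρ, h] using hr z hz
  let c : A → Z := fun x => ρ (det (R x))⁻¹
  have hc1 : ∀ x, IsOfFinOrder (c x) ∧ c x ^ m = (det (R x))⁻¹ := fun x => hρ _ (hfin x).inv
  have hcM : ∀ y ∈ M, c y = 1 := fun y hy => by simp [c, hM y hy, hρ1]
  have hcl : ∀ y ∈ M, ∀ x, c (y * x) = c x := fun y hy x => by simp only [c, hMl y hy x]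
  have hcr : ∀ x, ∀ y ∈ M, c (x * y) = c x := fun x y hy => by simp only [c, hMr x y hy]
  let R₁ : A → Γ := fun x => s (c x) * R x
  have hd1 : ∀ x, det (R₁ x) = 1 := fun x => by simp [R₁, hdet, (hc1 x).2]
  obtain ⟨b, hb⟩ : ∃ b : A → A → Z, ∀ x y, R₁ (x * y) = s (b x y) * (R₁ x * R₁ y) := by
    refine ⟨fun x y => β x y * c (x * y) * (c x)⁻¹ * (c y)⁻¹, fun x y => ?_⟩
    simp only [R₁, hR, map_mul, map_inv]
    have e1 := (hc (c y) (R x)).eq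
    calc s (c (x * y)) * (s (β x y) * (R x * R y))
        = s (c (x * y)) * s (β x y) * (R x * R y) := by rw [mul_assoc]
      _ = s (β x y * c (x * y) * (c x)⁻¹ * (c y)⁻¹ * c x * c y) * (R x * R y) := by
          rw [← map_mul]; congr 2; simp [mul_comm, mul_left_comm]
      _ = s (β x y) * s (c (x * y)) * (s (c x))⁻¹ * (s (c y))⁻¹ * s (c x) * (s (c y) * R x) * R y := by
          simp only [map_mul, map_inv, mul_assoc]
      _ = _ := by rw [e1]; simp only [mul_assoc]
  have hbm : ∀ x y, b x y ^ m = 1 := by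
    intro x y
    have := congrArg det (hb x y)
    rwa [hd1, map_mul, map_mul, hd1, hd1, hdet, mul_one, mul_one, eq_comm] at this
  have hbr : ∀ x z, ∀ y ∈ M, b x (z * y) = b x z := by
    intro x z y hy
    apply hs
    have h1 := hb x (z * y)
    have e2 : R₁ (x * (z * y)) = R₁ (x * z) := by
      rw [← mul_assoc]; simp only [R₁, hcr _ y hy, hMr _ y hy]
    have e3 : R₁ (z * y) = R₁ z := by simp only [R₁, hcr _ y hy, hMr _ y hy]
    rw [e2, e3, hb] at h1
    exact (mul_right_cancel h1).symm
  have hbl : ∀ x z, ∀ y ∈ M, b (x * y) z = b x z := by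
    intro x z y hy
    apply hs
    have h1 := hb (x * y) z
    have e2 : R₁ (x * y * z) = R₁ (x * z) := by
      have hy' : z⁻¹ * y * z ∈ M := by
        simpa using Subgroup.Normal.conj_mem inferInstance y hy z⁻¹
      rw [show x * y * z = x * z * (z⁻¹ * y * z) by group]
      simp only [R₁, hcr _ _ hy', hMr _ _ hy']
    have e3 : R₁ (x * y) = R₁ x := by simp only [R₁, hcr _ y hy, hMr _ y hy]
    rw [e2, e3, hb] at h1
    exact (mul_right_cancel h1).symm
  have hbl' : ∀ x z, ∀ y ∈ M, b (y * x) z = b x z := by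
    intro x z y hy
    have hy' : x⁻¹ * y * x ∈ M := by
      simpa using Subgroup.Normal.conj_mem inferInstance y hy x⁻¹
    rw [show y * x = x * (x⁻¹ * y * x) by group, hbl _ _ _ hy']
  have hb1 : ∀ y ∈ M, ∀ z, b y z = 1 := by
    intro y hy z
    have h := hbl 1 z y hy
    rw [one_mul] at h
    rw [h]
    apply hs
    have h1 := hb 1 z
    have e : R₁ 1 = 1 := by simp [R₁, hcM 1 M.one_mem, hM 1 M.one_mem]
    rw [one_mul, e, one_mul] at h1
    rw [map_one]
    exact (mul_eq_right.mp h1.symm)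
  have hcoc : ∀ x y z, b (x * y) z * b x y = b x (y * z) * b y z := by
    intro x y z
    apply hs
    have h1 := hb (x * y) z
    have h2 := hb x (y * z)
    rw [mul_assoc, h2, hb y z, hb x y] at h1
    have e := (hc (b y z) (R₁ x)).eq
    apply mul_right_cancel (b := R₁ x * R₁ y * R₁ z)
    rw [map_mul s (b (x * y) z), map_mul s (b x (y * z))]
    calc s (b (x * y) z) * s (b x y) * (R₁ x * R₁ y * R₁ z)
        = s (b (x * y) z) * (s (b x y) * (R₁ x * R₁ y) * R₁ z) := by simp only [mul_assoc]
      _ = s (b x (y * z)) * (R₁ x * s (b y z) * (R₁ y * R₁ z)) := by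
        rw [← h1]; simp only [mul_assoc]
      _ = _ := by rw [← e]; simp only [mul_assoc]
  -- Multiplying the cocycle identity over the cosets of M shows that the |A : M|-th power of the
  -- factor set b is the coboundary of γ.
  let γ : A → Z := fun x => ∏ q : A ⧸ M, b x q.out
  have hγ : ∀ x y, b x y ^ M.index * γ (x * y) = γ x * γ y := by
    intro x y
    have h : ∏ q : A ⧸ M, (b (x * y) q.out * b x y) = ∏ q : A ⧸ M, (b x (y * q.out) * b y q.out) :=
      Finset.prod_congr rfl fun q _ => hcoc x y q.out
    rw [Finset.prod_mul_distrib, Finset.prod_mul_distrib, Finset.prod_const, Finset.card_univ,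
      prod_mul_left_out M (fun z => b x z) (fun z y hy => hbr x z y hy), ← Nat.card_eq_fintype_card,
      ← Subgroup.index_eq_card] at h
    rw [mul_comm]
    exact h
  have hγm : ∀ x, γ x ^ m = 1 := fun x => by
    simp only [γ, ← Finset.prod_pow, hbm, Finset.prod_const_one]
  -- An inverse of |A : M| modulo m turns b^|A : M| back into b, whose values are m-th roots of
  -- unity.
  obtain ⟨q, hq⟩ : ∃ q : ℤ, ∀ z : Z, z ^ m = 1 → z ^ ((M.index : ℤ) * q) = z := by
    refine ⟨Nat.gcdA M.index m, fun z hz => ?_⟩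
    have h := Nat.gcd_eq_gcd_ab M.index m
    rw [hm.gcd_eq_one] at h
    have h2 : (M.index : ℤ) * Nat.gcdA M.index m = 1 - m * Nat.gcdB M.index m := by
      push_cast at h; linarith
    rw [h2, zpow_sub, zpow_one, zpow_mul, zpow_natCast, hz, one_zpow, inv_one, mul_one]
  have hγq : ∀ x y, γ (x * y) ^ q * b x y = γ x ^ q * γ y ^ q := by
    intro x y
    rw [← mul_zpow, ← hγ, mul_zpow, ← zpow_natCast, ← zpow_mul, hq _ (hbm x y), mul_comm]
  refine ⟨fun x => γ x ^ q * c x, fun x => ?_, fun y hy => ?_, fun y hy x => ?_, fun x y hy => ?_,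
    fun x y => ?_, fun x => ?_⟩
  · refine IsOfFinOrder.mul (IsOfFinOrder.zpow ?_) (hc1 x).1
    -- For m = 0 coprimality forces M to be the whole group, and γ is constantly 1.
    by_cases h0 : m = 0
    · subst h0
      have hi : M.index = 1 := by simpa using hm
      have : M = ⊤ := Subgroup.index_eq_one.mp hi
      have : γ x = 1 := Finset.prod_eq_one fun q _ => hb1 x (this ▸ Subgroup.mem_top x) _
      rw [this]; exact IsOfFinOrder.one
    · exact isOfFinOrder_iff_pow_eq_one.mpr ⟨m, Nat.pos_of_ne_zero h0, hγm x⟩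
  · have : γ y = 1 := Finset.prod_eq_one fun q _ => hb1 y hy _
    simp [this, hcM y hy]
  · simp only [γ, hcl y hy, hbl' x _ y hy]
  · simp only [γ, hcr x y hy, hbl x _ y hy]
  · have h1 : ∀ x, s (γ x ^ q * c x) * R x = s (γ x ^ q) * R₁ x := fun x => by
      simp only [R₁, map_mul, mul_assoc]
    rw [h1, h1, h1, hb, ← mul_assoc, ← map_mul, hγq, map_mul]
    have e := (hc (γ y ^ q) (R₁ x)).eq
    calc s (γ x ^ q) * s (γ y ^ q) * (R₁ x * R₁ y)
        = s (γ x ^ q) * (s (γ y ^ q) * R₁ x) * R₁ y := by simp only [mul_assoc]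
      _ = _ := by rw [e]; simp only [mul_assoc]
  · have h1 : s (γ x ^ q * c x) * R x = s (γ x ^ q) * R₁ x := by
      simp only [R₁, map_mul, mul_assoc]
    rw [h1, map_mul, hd1, hdet, mul_one, ← zpow_natCast, zpow_comm, zpow_natCast, hγm, one_zpow]

end Cocycle

/-! ### Determinants and semilinear conjugation -/

/-- Φ carries a basis to a basis, in which the matrix of g is σ applied to the matrix of f. -/
theorem LinearMap.det_eq_of_semilinear {k W : Type*} [Field k] [AddCommGroup W] [Module k W]
    [FiniteDimensional k W] (σ : k ≃+* k) (Φ : W ≃+ W) (hΦ : ∀ (a : k) w, Φ (a • w) = σ a • Φ w)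
    {f g : W →ₗ[k] W} (h : ∀ w, Φ (f w) = g (Φ w)) : LinearMap.det g = σ (LinearMap.det f) := by
  let b := Module.finBasis k W
  have hΦ' : ∀ (a : k) w, Φ.symm (a • w) = σ.symm a • Φ.symm w := fun a w => by
    apply Φ.injective
    rw [hΦ, Φ.apply_symm_apply, Φ.apply_symm_apply, σ.apply_symm_apply]
  let b' : Module.Basis (Fin (Module.finrank k W)) k W := Module.Basis.ofEquivFun
    { toFun := fun w i => σ (b.equivFun (Φ.symm w) i)
      invFun := fun c => Φ (b.equivFun.symm fun i => σ.symm (c i))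
      left_inv := fun w => by simp
      right_inv := fun c => by
        ext i
        simp only [Φ.symm_apply_apply, LinearEquiv.apply_symm_apply, σ.apply_symm_apply]
      map_add' := fun w w' => by ext i; simp
      map_smul' := fun a w => by ext i; simp [hΦ'] }
  have hb' : ∀ i, b' i = Φ (b i) := by
    intro i
    have hs : (fun j => σ.symm (Pi.single (M := fun _ => k) i 1 j)) = Pi.single i 1 := by
      ext j
      by_cases hij : j = i
      · subst hij; simp
      · simp [hij]
    simp only [b', Module.Basis.coe_ofEquivFun, LinearEquiv.coe_symm_mk', hs]
    congr 1
    rw [Module.Basis.equivFun_symm_apply]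
    simp [Pi.single_apply]
  rw [← LinearMap.det_toMatrix b', ← LinearMap.det_toMatrix b, RingEquiv.map_det]
  congr 1
  ext i j
  rw [LinearMap.toMatrix_apply, hb', ← h]
  simp [b', LinearMap.toMatrix_apply]

/-! ### Projective extensions over a field -/

section SubmoduleStabilizer

variable {k V : Type*} [Field k] [AddCommGroup V] [Module k V]

/-- The group of automorphisms of a space that stabilize a subspace. -/
def Submodule.autStabilizer (W : Submodule k V) : Subgroup (V ≃ₗ[k] V) where
  carrier := {g | ∀ v, g v ∈ W ↔ v ∈ W}
  one_mem' := fun _ => Iff.rfl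
  mul_mem' := fun {a b} ha hb v => (ha (b v)).trans (hb v)
  inv_mem' := fun {a} ha v => by
    rw [← ha (a⁻¹ v)]
    exact Iff.of_eq (congrArg (· ∈ W) (a.apply_symm_apply v))

/-- Restriction of automorphisms to a stable subspace. -/
def Submodule.autRestrict (W : Submodule k V) : W.autStabilizer →* (W ≃ₗ[k] W) where
  toFun g :=
    { toFun := fun w => ⟨(g : V ≃ₗ[k] V) w, (g.2 w).2 w.2⟩
      invFun := fun w => ⟨(g : V ≃ₗ[k] V).symm w, ((g⁻¹).2 w).2 w.2⟩
      left_inv := fun w => Subtype.ext ((g : V ≃ₗ[k] V).symm_apply_apply w)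
      right_inv := fun w => Subtype.ext ((g : V ≃ₗ[k] V).apply_symm_apply w)
      map_add' := fun w w' => Subtype.ext (map_add (g : V ≃ₗ[k] V) (w : V) w')
      map_smul' := fun a w => Subtype.ext (map_smul (g : V ≃ₗ[k] V) a (w : V)) }
  map_one' := rfl
  map_mul' _ _ := rfl

end SubmoduleStabilizer

namespace Matrix.GeneralLinearGroup

variable {k : Type*} [Field k] {d e : ℕ}

/-- The action of `GL_d × GL_e` on `d × e` matrices by `(A, B) T = A T B⁻¹`. -/
def twoSided (k : Type*) [Field k] (d e : ℕ) :
    GL (Fin d) k × GL (Fin e) k →* (Matrix (Fin d) (Fin e) k ≃ₗ[k] Matrix (Fin d) (Fin e) k) where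
  toFun g :=
    { toFun := fun T => g.1.val * T * (g.2⁻¹).val
      invFun := fun T => (g.1⁻¹).val * T * g.2.val
      left_inv := fun T => by
        beta_reduce
        rw [Matrix.mul_assoc, Matrix.mul_assoc, Units.inv_mul, Matrix.mul_one, ← Matrix.mul_assoc,
          Units.inv_mul, Matrix.one_mul]
      right_inv := fun T => by
        beta_reduce
        rw [Matrix.mul_assoc, Matrix.mul_assoc, Units.mul_inv, Matrix.mul_one, ← Matrix.mul_assoc,
          Units.mul_inv, Matrix.one_mul]
      map_add' := fun T T' => by rw [Matrix.mul_add, Matrix.add_mul]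
      map_smul' := fun a T => by simp }
  map_one' := by
    ext1 T
    simp
  map_mul' g h := by
    ext1 T
    simp [Matrix.mul_assoc]

theorem twoSided_apply (A : GL (Fin d) k) (B : GL (Fin e) k) (T : Matrix (Fin d) (Fin e) k) :
    twoSided k d e (A, B) T = A.val * T * (B⁻¹).val := rfl

theorem twoSided_scalar (a : kˣ) (b : kˣ) (T : Matrix (Fin d) (Fin e) k) :
    twoSided k d e (scalar (Fin d) a, scalar (Fin e) b) T = (a * b⁻¹ : kˣ) • T := by
  rw [twoSided_apply, ← _root_.map_inv, coe_scalar, coe_scalar, Matrix.scalar_apply, Matrix.scalar_apply,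
    ← Matrix.smul_one_eq_diagonal, ← Matrix.smul_one_eq_diagonal]
  simp [Units.smul_def, smul_smul, mul_comm]

/-- `P(ng) = P(n)P(g)`, `P(gn) = P(g)P(n)` for `n ∈ N`, and `P` is multiplicative up to scalars
of finite order. -/
structure IsProjExt {T : Type*} [Group T] (N : Subgroup T) (P : T → GL (Fin d) k) : Prop where
  mul_left : ∀ n ∈ N, ∀ g, P (n * g) = P n * P g
  mul_right : ∀ g, ∀ n ∈ N, P (g * n) = P g * P n
  factor : ∀ g h, ∃ z : kˣ, IsOfFinOrder z ∧ P (g * h) = scalar (Fin d) z * (P g * P h)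

variable {A : Type*} [Group A]

theorem IsProjExt.map_one {M : Subgroup A} {P : A → GL (Fin d) k} (hP : IsProjExt M P) : P 1 = 1 := by
  have h := hP.mul_right 1 1 M.one_mem
  rwa [mul_one, eq_comm, mul_eq_left] at h

theorem IsProjExt.conj_mul {M : Subgroup A} [M.Normal] {P : A → GL (Fin d) k} (hP : IsProjExt M P)
    (x : A) {y : A} (hy : y ∈ M) : P (x * y * x⁻¹) * P x = P x * P y := by
  rw [← hP.mul_left _ (Subgroup.Normal.conj_mem inferInstance y hy x), ← hP.mul_right _ _ hy,
    inv_mul_cancel_right]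

theorem IsProjExt.comp {T B : Type*} [Group T] [Group B] {N : Subgroup T} {P : T → GL (Fin d) k}
    (hP : IsProjExt N P) (f : B →* T) {M : Subgroup B} (hM : ∀ y ∈ M, f y ∈ N) :
    IsProjExt M (fun b => P (f b)) where
  mul_left n hn g := by rw [_root_.map_mul, hP.mul_left _ (hM n hn)]
  mul_right g n hn := by rw [_root_.map_mul, hP.mul_right _ _ (hM n hn)]
  factor g h := by rw [_root_.map_mul]; exact hP.factor _ _

theorem IsProjExt.map {T F : Type*} [Group T] [Field F] {N : Subgroup T} {P : T → GL (Fin d) k}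
    (hP : IsProjExt N P) (σ : k →+* F) :
    IsProjExt N (fun b => map σ (P b)) where
  mul_left n hn g := by rw [hP.mul_left _ hn, _root_.map_mul]
  mul_right g n hn := by rw [hP.mul_right _ _ hn, _root_.map_mul]
  factor g h := by
    obtain ⟨z, hz, h⟩ := hP.factor g h
    refine ⟨Units.map (σ : k →* F) z, ?_, ?_⟩
    · obtain ⟨n, hn, hzn⟩ := isOfFinOrder_iff_pow_eq_one.mp hz
      exact isOfFinOrder_iff_pow_eq_one.mpr ⟨n, hn, by rw [← _root_.map_pow, hzn, _root_.map_one]⟩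
    · rw [h, _root_.map_mul, _root_.map_mul, map_scalar]

/-- The space of matrices intertwining the restrictions of `P` and `Q` to `M`. -/
def intertwiners (M : Subgroup A) (P : A → GL (Fin d) k) (Q : A → GL (Fin e) k) :
    Submodule k (Matrix (Fin d) (Fin e) k) where
  carrier := {T | ∀ y ∈ M, twoSided k d e (P y, Q y) T = T}
  add_mem' := fun {T T'} h h' y hy => by rw [_root_.map_add, h y hy, h' y hy]
  zero_mem' := fun _ _ => _root_.map_zero _
  smul_mem' := fun a T h y hy => by rw [_root_.map_smul, h y hy]

variable {M : Subgroup A} {P : A → GL (Fin d) k} {Q Q' : A → GL (Fin e) k}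

theorem mem_intertwiners_iff {T : Matrix (Fin d) (Fin e) k} : T ∈ intertwiners M P Q ↔
    ∀ y ∈ M, (P y).val * T = T * (Q y).val := by
  refine forall₂_congr fun y _ => ?_
  rw [twoSided_apply]
  constructor
  · intro h
    conv_rhs => rw [← h]
    rw [Matrix.mul_assoc, Units.inv_mul, Matrix.mul_one]
  · intro h
    rw [h, Matrix.mul_assoc, Units.mul_inv, Matrix.mul_one]

/-- M is normal, and P and Q both satisfy P(xyx⁻¹)P(x) = P(x)P(y) for y in M, so the action of x
permutes the conditions defining the intertwining space. -/
theorem twoSided_mem_autStabilizer [M.Normal] (hP : IsProjExt M P) (hQ : IsProjExt M Q) (x : A) :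
    twoSided k d e (P x, Q x) ∈ (intertwiners M P Q).autStabilizer := by
  intro T
  have key : ∀ y ∈ M, ∀ T, twoSided k d e (P (x * y * x⁻¹), Q (x * y * x⁻¹))
      (twoSided k d e (P x, Q x) T) = twoSided k d e (P x, Q x) (twoSided k d e (P y, Q y) T) := by
    intro y hy T
    rw [← LinearEquiv.mul_apply, ← LinearEquiv.mul_apply, ← _root_.map_mul, ← _root_.map_mul,
      Prod.mk_mul_mk, Prod.mk_mul_mk, hP.conj_mul x hy, hQ.conj_mul x hy]
  constructor
  · intro h y hy
    apply (twoSided k d e (P x, Q x)).injective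
    rw [← key y hy]
    exact h _ (Subgroup.Normal.conj_mem inferInstance y hy x)
  · intro h y hy
    have hy' : x⁻¹ * y * x ∈ M := by
      simpa using Subgroup.Normal.conj_mem inferInstance y hy x⁻¹
    have h2 := key _ hy' T
    rw [h _ hy'] at h2
    rwa [show x * (x⁻¹ * y * x) * x⁻¹ = y by group] at h2

end Matrix.GeneralLinearGroup

/-! ### Comparison of two projective extensions -/

namespace Matrix.GeneralLinearGroup

variable {k : Type*} [Field k] {d e : ℕ} {A : Type*} [Group A] {M : Subgroup A}
  {P : A → GL (Fin d) k} {Q Q' : A → GL (Fin e) k}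

theorem IsProjExt.rescale (hQ : IsProjExt M Q) {ν : A → kˣ} (hν : ∀ x, IsOfFinOrder (ν x))
    (hν1 : ∀ y ∈ M, ν y = 1) (hνl : ∀ y ∈ M, ∀ x, ν (y * x) = ν x)
    (hνr : ∀ x, ∀ y ∈ M, ν (x * y) = ν x) :
    IsProjExt M (fun x => scalar (Fin e) (ν x) * Q x) where
  mul_left n hn g := by rw [hνl n hn, hν1 n hn, hQ.mul_left n hn, _root_.map_one, one_mul,
    ← mul_assoc, ← mul_assoc, scalar_commute]
  mul_right g n hn := by rw [hνr g n hn, hν1 n hn, hQ.mul_right g n hn, _root_.map_one, one_mul,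
    mul_assoc]
  factor g h := by
    obtain ⟨z, hz, hgh⟩ := hQ.factor g h
    refine ⟨z * ν (g * h) * (ν g)⁻¹ * (ν h)⁻¹,
      ((hz.mul (hν _)).mul (hν g).inv).mul (hν h).inv, ?_⟩
    have e1 := scalar_commute (ν h) (Q g)
    rw [hgh]
    calc scalar (Fin e) (ν (g * h)) * (scalar (Fin e) z * (Q g * Q h))
        = scalar (Fin e) (z * ν (g * h) * (ν g)⁻¹ * (ν h)⁻¹ * ν g * ν h) * (Q g * Q h) := by
          rw [← mul_assoc, ← _root_.map_mul]
          congr 2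
          simp [mul_comm, mul_left_comm]
      _ = scalar (Fin e) (z * ν (g * h) * (ν g)⁻¹ * (ν h)⁻¹) * (scalar (Fin e) (ν g) *
            (scalar (Fin e) (ν h) * Q g) * Q h) := by
          simp only [_root_.map_mul, mul_assoc]
      _ = _ := by rw [e1]; simp only [mul_assoc]

variable [M.Normal]

/-- The action of `x` by `T ↦ P(x) T Q(x)⁻¹` on the intertwining matrices. -/
def interAct (hP : IsProjExt M P) (hQ : IsProjExt M Q) (x : A) :
    intertwiners M P Q ≃ₗ[k] intertwiners M P Q :=
  (intertwiners M P Q).autRestrict ⟨_, twoSided_mem_autStabilizer hP hQ x⟩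

theorem coe_interAct (hP : IsProjExt M P) (hQ : IsProjExt M Q) (x : A) (T : intertwiners M P Q) :
    (interAct hP hQ x T : Matrix (Fin d) (Fin e) k) = twoSided k d e (P x, Q x) T := rfl

theorem interAct_of_mem (hP : IsProjExt M P) (hQ : IsProjExt M Q) {y : A} (hy : y ∈ M) :
    interAct hP hQ y = 1 := by
  ext1 T
  exact Subtype.ext (T.2 y hy)

/-- Scalars as automorphisms of a space. -/
abbrev scalarAut (k : Type*) [Field k] (W : Type*) [AddCommGroup W] [Module k W] :
    kˣ →* (W ≃ₗ[k] W) := DistribMulAction.toModuleAut k W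

theorem interAct_mul (hP : IsProjExt M P) (hQ : IsProjExt M Q) {x y : A} {a b : kˣ}
    (ha : P (x * y) = scalar (Fin d) a * (P x * P y))
    (hb : Q (x * y) = scalar (Fin e) b * (Q x * Q y)) :
    interAct hP hQ (x * y) =
      scalarAut k _ (a * b⁻¹) * (interAct hP hQ x * interAct hP hQ y) := by
  ext1 T
  apply Subtype.ext
  rw [coe_interAct, ha, hb, ← Prod.mk_mul_mk, _root_.map_mul, LinearEquiv.mul_apply,
    twoSided_scalar, ← Prod.mk_mul_mk, _root_.map_mul]
  rfl

theorem interAct_mul_left (hP : IsProjExt M P) (hQ : IsProjExt M Q) {y : A} (hy : y ∈ M) (x : A) :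
    interAct hP hQ (y * x) = interAct hP hQ x := by
  have h := interAct_mul hP hQ (x := y) (y := x) (a := 1) (b := 1)
    (by rw [hP.mul_left y hy, _root_.map_one, one_mul])
    (by rw [hQ.mul_left y hy, _root_.map_one, one_mul])
  rwa [interAct_of_mem hP hQ hy, inv_one, one_mul, _root_.map_one, one_mul, one_mul] at h

theorem interAct_mul_right (hP : IsProjExt M P) (hQ : IsProjExt M Q) (x : A) {y : A} (hy : y ∈ M) :
    interAct hP hQ (x * y) = interAct hP hQ x := by
  have h := interAct_mul hP hQ (x := x) (y := y) (a := 1) (b := 1)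
    (by rw [hP.mul_right x y hy, _root_.map_one, one_mul])
    (by rw [hQ.mul_right x y hy, _root_.map_one, one_mul])
  rwa [interAct_of_mem hP hQ hy, inv_one, one_mul, _root_.map_one, one_mul, mul_one] at h

theorem det_scalarAut {W : Type*} [AddCommGroup W] [Module k W] [FiniteDimensional k W] (z : kˣ) :
    LinearEquiv.det (scalarAut k W z) = z ^ Module.finrank k W := by
  ext
  rw [LinearEquiv.coe_det, Units.val_pow_eq_pow_val]
  have : ((scalarAut k W z : W ≃ₗ[k] W) : W →ₗ[k] W) = (z : k) • LinearMap.id := rfl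
  rw [this, LinearMap.det_smul, LinearMap.det_id, mul_one]

theorem scalarAut_injective {W : Type*} [AddCommGroup W] [Module k W] [Nontrivial W] :
    Function.Injective (scalarAut k W) := by
  intro a b h
  obtain ⟨w, hw⟩ := exists_ne (0 : W)
  have h2 : (a : k) • w = (b : k) • w := LinearEquiv.congr_fun h w
  exact Units.ext (smul_left_injective k hw h2)

theorem commute_scalarAut {W : Type*} [AddCommGroup W] [Module k W] (z : kˣ) (g : W ≃ₗ[k] W) :
    Commute (scalarAut k W z) g := by
  ext1 w
  exact (g.map_smul (z : k) w).symm

/-- Two projective extensions are matched if the action on the intertwining matrices is a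
homomorphism with values of determinant one. -/
structure IsMatched (hP : IsProjExt M P) (hQ : IsProjExt M Q) : Prop where
  mul : ∀ x y, interAct hP hQ (x * y) = interAct hP hQ x * interAct hP hQ y
  det : ∀ x, LinearEquiv.det (interAct hP hQ x) = 1

/-- The cocycle rescaling is applied to the projective action on the intertwining space, whose
factor set is the quotient of those of P and Q. -/
theorem exists_isMatched [Finite A]
    (hroot : ∀ (m : ℕ), 0 < m → ∀ z : kˣ, IsOfFinOrder z → ∃ w : kˣ, IsOfFinOrder w ∧ w ^ m = z)
    (hP : IsProjExt M P) (hQ : IsProjExt M Q)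
    (h0 : Module.finrank k (intertwiners M P Q) ≠ 0)
    (hm : M.index.Coprime (Module.finrank k (intertwiners M P Q))) :
    ∃ (Q' : A → GL (Fin e) k) (hQ' : IsProjExt M Q'), (∀ y ∈ M, Q' y = Q y) ∧
      IsMatched hP hQ' := by
  choose α hα hα' using hP.factor
  choose α' hα1 hα1' using hQ.factor
  have : Nontrivial (intertwiners M P Q) :=
    Module.nontrivial_of_finrank_pos (R := k) (Nat.pos_of_ne_zero h0)
  obtain ⟨ν, hν, hν1, hνl, hνr, hmul, hdet⟩ := exists_rescale_det_eq_one M hm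
    (s := scalarAut k (intertwiners M P Q)) scalarAut_injective commute_scalarAut
    (det := LinearEquiv.det) det_scalarAut (hroot _ (Nat.pos_of_ne_zero h0))
    (R := interAct hP hQ) (β := fun x y => α x y * (α' x y)⁻¹)
    (fun x y => (hα x y).mul (hα1 x y).inv) (fun x y => interAct_mul hP hQ (hα' x y) (hα1' x y))
    (fun y hy => interAct_of_mem hP hQ hy) (fun y hy => interAct_mul_left hP hQ hy)
    (fun x y hy => interAct_mul_right hP hQ x hy)
  -- The inverse appears because Q enters the action through Q(x)⁻¹.
  let Q' : A → GL (Fin e) k := fun x => scalar (Fin e) (ν x)⁻¹ * Q x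
  have hQ' : IsProjExt M Q' := hQ.rescale (ν := fun x => (ν x)⁻¹) (fun x => (hν x).inv)
    (fun y hy => by simp [hν1 y hy]) (fun y hy x => by simp only [hνl y hy])
    (fun x y hy => by simp only [hνr x y hy])
  have hM : ∀ y ∈ M, Q' y = Q y := fun y hy => by simp [Q', hν1 y hy]
  have hW : intertwiners M P Q = intertwiners M P Q' := by
    ext T
    exact forall₂_congr fun y hy => by rw [hM y hy]
  let E := LinearEquiv.ofEq _ _ hW
  have key : ∀ x, interAct hP hQ' x =
      (E.symm.trans (scalarAut k _ (ν x) * interAct hP hQ x)).trans E := by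
    intro x
    ext1 T
    apply Subtype.ext
    rw [coe_interAct]
    change twoSided k d e (P x, scalar (Fin e) (ν x)⁻¹ * Q x) T =
      (ν x : k) • twoSided k d e (P x, Q x) T
    have h : (P x, scalar (Fin e) (ν x)⁻¹ * Q x) =
        (scalar (Fin d) 1, scalar (Fin e) (ν x)⁻¹) * (P x, Q x) := by
      rw [Prod.mk_mul_mk, _root_.map_one, one_mul]
    rw [h, _root_.map_mul, LinearEquiv.mul_apply, twoSided_scalar, one_mul, inv_inv]
    rfl
  refine ⟨Q', hQ', hM, ⟨fun x y => ?_, fun x => ?_⟩⟩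
  · rw [key, key, key, hmul]
    rfl
  · rw [key, LinearEquiv.det_conj]
    exact hdet x

theorem inv_mul_scalar_mul_conj (z : kˣ) (S B : GL (Fin d) k) :
    S⁻¹ * (scalar (Fin d) z * (S * B * S⁻¹)) * S = scalar (Fin d) z * B := by
  rw [← mul_assoc, ← scalar_commute]
  group

namespace IsMatched

variable {hP : IsProjExt M P} {hQ : IsProjExt M Q}

/-- The quotient of the two factors measures the failure of multiplicativity on the intertwining
space, and there is none. -/
theorem factor_eq (h : IsMatched hP hQ) [Nontrivial (intertwiners M P Q)] {x y : A} {a b : kˣ}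
    (ha : P (x * y) = scalar (Fin d) a * (P x * P y))
    (hb : Q (x * y) = scalar (Fin e) b * (Q x * Q y)) : a = b := by
  have h1 := h.mul x y
  rw [interAct_mul hP hQ ha hb, mul_eq_right] at h1
  have h2 : a * b⁻¹ = 1 := scalarAut_injective (h1.trans (_root_.map_one _).symm)
  rwa [mul_inv_eq_one] at h2

omit [M.Normal] in
theorem eq_one_of_pow (hm : M.index.Coprime (Module.finrank k (intertwiners M P Q))) {z : kˣ}
    (h1 : z ^ M.index = 1) (h2 : z ^ Module.finrank k (intertwiners M P Q) = 1) : z = 1 := by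
  have := pow_gcd_eq_one.mpr ⟨h1, h2⟩
  rwa [hm.gcd_eq_one, pow_one] at this

/-- The action of a matched pair as a homomorphism. -/
def hom (h : IsMatched hP hQ) : A →* (intertwiners M P Q ≃ₗ[k] intertwiners M P Q) where
  toFun := interAct hP hQ
  map_one' := interAct_of_mem hP hQ M.one_mem
  map_mul' := h.mul

/-- The element c acts on the intertwining space as the scalar a/b. The determinant and the fact
that c^|A : M| lies in M give two coprime exponents killing a/b. -/
theorem scalar_eq (h : IsMatched hP hQ) [Nontrivial (intertwiners M P Q)]
    (hm : M.index.Coprime (Module.finrank k (intertwiners M P Q))) {c : A} {a b : kˣ}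
    (ha : P c = scalar (Fin d) a) (hb : Q c = scalar (Fin e) b) : a = b := by
  have hR : h.hom c = scalarAut k _ (a * b⁻¹) := by
    ext1 T
    apply Subtype.ext
    change twoSided k d e (P c, Q c) T = _
    rw [ha, hb, twoSided_scalar]
    rfl
  rw [← mul_inv_eq_one]
  refine eq_one_of_pow hm ?_ ?_
  · apply scalarAut_injective (W := intertwiners M P Q)
    rw [_root_.map_pow, ← hR, ← _root_.map_pow, _root_.map_one]
    exact interAct_of_mem hP hQ (M.pow_index_mem c)
  · rw [← det_scalarAut, ← hR]
    exact h.det c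

/-- Entrywise application of `σ` followed by the action of a pair of matrices. -/
theorem exists_semilinear_equiv (σ : k ≃+* k) (S : GL (Fin d) k) (S' : GL (Fin e) k) :
    ∃ Φ : Matrix (Fin d) (Fin e) k ≃+ Matrix (Fin d) (Fin e) k,
      (∀ (a : k) T, Φ (a • T) = σ a • Φ T) ∧ ∀ (A : GL (Fin d) k) (B : GL (Fin e) k) T,
        Φ (twoSided k d e (A, B) T) =
          twoSided k d e (S⁻¹ * map (σ : k →+* k) A * S, S'⁻¹ * map (σ : k →+* k) B * S') (Φ T) := by
  refine ⟨(σ.toAddEquiv.mapMatrix).trans (twoSided k d e (S⁻¹, S'⁻¹)).toAddEquiv, ?_, ?_⟩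
  · intro a T
    change twoSided k d e (S⁻¹, S'⁻¹) ((a • T).map σ) =
      σ a • twoSided k d e (S⁻¹, S'⁻¹) (T.map σ)
    rw [← _root_.map_smul]
    congr 1
    ext i j
    exact _root_.map_mul σ a _
  · intro A B T
    change twoSided k d e (S⁻¹, S'⁻¹) ((twoSided k d e (A, B) T).map σ) =
      twoSided k d e _ (twoSided k d e (S⁻¹, S'⁻¹) (T.map σ))
    have hmp : (twoSided k d e (A, B) T).map σ =
        twoSided k d e (map (σ : k →+* k) A, map (σ : k →+* k) B) (T.map σ) := by
      rw [twoSided_apply, twoSided_apply, ← _root_.map_inv]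
      change (A.val * T * (B⁻¹).val).map (σ : k →+* k) = _
      rw [Matrix.map_mul, Matrix.map_mul]
      rfl
    rw [hmp]
    simp only [← LinearEquiv.mul_apply, ← _root_.map_mul, Prod.mk_mul_mk, mul_inv_cancel_right]

/-- Similarities between the Galois twists of `P`, `Q` and rescalings of `P`, `Q` induce a semilinear
map on the intertwining matrices. -/
theorem exists_semilinear (hP : IsProjExt M P) (hQ : IsProjExt M Q) (σ : k ≃+* k) (τ : A ≃* A)
    (hτ : ∀ y, τ y ∈ M ↔ y ∈ M) {S : GL (Fin d) k} {S' : GL (Fin e) k} {μ μ' : A → kˣ}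
    (hμ : ∀ y ∈ M, μ y = 1) (hμ' : ∀ y ∈ M, μ' y = 1)
    (hS : ∀ x, map (σ : k →+* k) (P (τ x)) = scalar (Fin d) (μ x) * (S * P x * S⁻¹))
    (hS' : ∀ x, map (σ : k →+* k) (Q (τ x)) = scalar (Fin e) (μ' x) * (S' * Q x * S'⁻¹)) :
    ∃ Φ : intertwiners M P Q ≃+ intertwiners M P Q, (∀ (a : k) T, Φ (a • T) = σ a • Φ T) ∧
      ∀ x T, Φ (interAct hP hQ (τ x) T) =
        (scalarAut k (intertwiners M P Q) (μ x * (μ' x)⁻¹) * interAct hP hQ x) (Φ T) := by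
  obtain ⟨Φ₀, hΦs, hΦ⟩ := exists_semilinear_equiv σ S S'
  have hΦ₀ : ∀ x T, Φ₀ (twoSided k d e (P (τ x), Q (τ x)) T) =
      (μ x * (μ' x)⁻¹) • twoSided k d e (P x, Q x) (Φ₀ T) := by
    intro x T
    rw [hΦ, hS, hS', ← twoSided_scalar, ← LinearEquiv.mul_apply, ← _root_.map_mul, Prod.mk_mul_mk,
      inv_mul_scalar_mul_conj, inv_mul_scalar_mul_conj]
  have h1 : ∀ y ∈ M, ∀ T, (twoSided k d e (P y, Q y) (Φ₀ T) = Φ₀ T ↔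
      twoSided k d e (P (τ y), Q (τ y)) T = T) := by
    intro y hy T
    rw [← Φ₀.injective.eq_iff (b := T), hΦ₀, hμ y hy, hμ' y hy, inv_one, one_mul, one_smul]
  have hmem : ∀ T, Φ₀ T ∈ intertwiners M P Q ↔ T ∈ intertwiners M P Q := by
    intro T
    constructor
    · intro hT y hy
      have hy' : τ.symm y ∈ M := (hτ _).mp (by rwa [τ.apply_symm_apply])
      have := (h1 (τ.symm y) hy' T).mp (hT _ hy')
      rwa [τ.apply_symm_apply] at this
    · intro hT y hy
      exact (h1 y hy T).mpr (hT _ ((hτ y).mpr hy))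
  refine ⟨
    { toFun := fun T => ⟨Φ₀ T, (hmem T).mpr T.2⟩
      invFun := fun T => ⟨Φ₀.symm T, (hmem _).mp (by rw [Φ₀.apply_symm_apply]; exact T.2)⟩
      left_inv := fun T => Subtype.ext (Φ₀.symm_apply_apply T)
      right_inv := fun T => Subtype.ext (Φ₀.apply_symm_apply T)
      map_add' := fun T T' => Subtype.ext (_root_.map_add Φ₀ T.1 T'.1) }, ?_, ?_⟩
  · exact fun a T => Subtype.ext (hΦs a T.1)
  · exact fun x T => Subtype.ext (hΦ₀ x T.1)

/-- The semilinear map intertwines the action of τ(x) with μ(x)/μ'(x) times that of x.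
Multiplicativity makes the quotient μ/μ' a homomorphism trivial on M, and comparing determinants
kills its m-th power, m being the dimension of the intertwining space. The two exponents |A : M| and
m are coprime. -/
theorem twist_eq (h : IsMatched hP hQ) [Nontrivial (intertwiners M P Q)]
    (hm : M.index.Coprime (Module.finrank k (intertwiners M P Q))) (σ : k ≃+* k) (τ : A ≃* A)
    (hτ : ∀ y, τ y ∈ M ↔ y ∈ M) {S : GL (Fin d) k} {S' : GL (Fin e) k} {μ μ' : A → kˣ}
    (hμ : ∀ y ∈ M, μ y = 1) (hμ' : ∀ y ∈ M, μ' y = 1)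
    (hS : ∀ x, map (σ : k →+* k) (P (τ x)) = scalar (Fin d) (μ x) * (S * P x * S⁻¹))
    (hS' : ∀ x, map (σ : k →+* k) (Q (τ x)) = scalar (Fin e) (μ' x) * (S' * Q x * S'⁻¹)) :
    μ = μ' := by
  obtain ⟨Φ, hΦs, hΦ'⟩ := exists_semilinear hP hQ σ τ hτ hμ hμ' hS hS'
  let lam : A → kˣ := fun x => μ x * (μ' x)⁻¹
  have hΦ : ∀ x T, Φ (h.hom (τ x) T) = (scalarAut k (intertwiners M P Q) (lam x) * h.hom x) (Φ T) := hΦ'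
  have hmul : ∀ x y, lam (x * y) = lam x * lam y := by
    intro x y
    have e1 : scalarAut k _ (lam (x * y)) * h.hom (x * y) =
        (scalarAut k _ (lam x) * h.hom x) * (scalarAut k _ (lam y) * h.hom y) := by
      ext1 T
      obtain ⟨T, rfl⟩ := Φ.surjective T
      rw [← hΦ, LinearEquiv.mul_apply, ← hΦ, ← hΦ, _root_.map_mul, _root_.map_mul]
      rfl
    have e2 := (commute_scalarAut (lam y) (h.hom x)).eq
    rw [mul_assoc, ← mul_assoc (h.hom x), ← e2, mul_assoc, ← mul_assoc, ← _root_.map_mul (h.hom),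
      ← _root_.map_mul] at e1
    exact scalarAut_injective (mul_right_cancel e1)
  have hdet : ∀ x, lam x ^ Module.finrank k (intertwiners M P Q) = 1 := by
    intro x
    have e := LinearMap.det_eq_of_semilinear σ Φ hΦs
      (f := ((h.hom (τ x) : _ ≃ₗ[k] _) : intertwiners M P Q →ₗ[k] intertwiners M P Q))
      (g := ((scalarAut k _ (lam x) * h.hom x : _ ≃ₗ[k] _) :
        intertwiners M P Q →ₗ[k] intertwiners M P Q)) (hΦ x)
    rw [← LinearEquiv.coe_det, ← LinearEquiv.coe_det, _root_.map_mul, det_scalarAut] at e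
    have e1 : LinearEquiv.det (h.hom x) = 1 := h.det x
    have e2 : LinearEquiv.det (h.hom (τ x)) = 1 := h.det (τ x)
    rw [e1, e2, mul_one, Units.val_one, _root_.map_one] at e
    exact Units.ext e
  let L : A →* kˣ := MonoidHom.mk' lam hmul
  funext x
  rw [← mul_inv_eq_one]
  refine eq_one_of_pow hm ?_ (hdet x)
  change L x ^ M.index = 1
  rw [← _root_.map_pow]
  change μ _ * (μ' _)⁻¹ = 1
  rw [hμ _ (M.pow_index_mem x), hμ' _ (M.pow_index_mem x), inv_one, one_mul]

end IsMatched

end Matrix.GeneralLinearGroup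

/-! ### Characters and intertwining matrices -/

namespace Matrix.GeneralLinearGroup

section Trace

variable {k : Type*} [Field k] {d e : ℕ}

theorem trace_twoSided (A : GL (Fin d) k) (B : GL (Fin e) k) :
    LinearMap.trace k (Matrix (Fin d) (Fin e) k) (twoSided k d e (A, B)).toLinearMap =
      A.val.trace * (B⁻¹).val.trace := by
  rw [LinearMap.trace_eq_matrix_trace k (Matrix.stdBasis k (Fin d) (Fin e)), Matrix.trace,
    Fintype.sum_prod_type, Matrix.trace, Matrix.trace, Finset.sum_mul_sum]
  refine Finset.sum_congr rfl fun i _ => Finset.sum_congr rfl fun j _ => ?_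
  rw [Matrix.diag_apply, LinearMap.toMatrix_apply, Matrix.stdBasis_eq_single]
  change (A.val * Matrix.single i j (1 : k) * (B⁻¹).val) i j = A.val i i * (B⁻¹).val j j
  simp [Matrix.mul_apply, Matrix.single_apply, ite_and]

variable {A : Type*} [Group A] {M : Subgroup A} {P : A → GL (Fin d) k} {Q : A → GL (Fin e) k}

/-- The restriction of a projective extension to `M` as a homomorphism. -/
def IsProjExt.homOn (hP : IsProjExt M P) : M →* GL (Fin d) k :=
  MonoidHom.mk' (fun y => P y) fun a b => hP.mul_left a a.2 b

/-- The intertwining matrices are the fixed points of M acting by T ↦ P(y)TQ(y)⁻¹, and the average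
of the trace is the dimension of the fixed space. -/
theorem sum_trace_mul_trace_inv [CharZero k] [Finite A] (hP : IsProjExt M P) (hQ : IsProjExt M Q)
    [Fintype M] :
    ∑ y : M, (P y).val.trace * (Q (y⁻¹ : M)).val.trace =
      Nat.card M * Module.finrank k (intertwiners M P Q) := by
  let ρ : Representation k M (Matrix (Fin d) (Fin e) k) :=
    (LinearEquiv.automorphismGroup.toLinearMapMonoidHom).comp
      ((twoSided k d e).comp (hP.homOn.prod hQ.homOn))
  have h0 : (Nat.card M : k) ≠ 0 := Nat.cast_ne_zero.mpr Nat.card_pos.ne'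
  let _ : Invertible (Nat.card M : k) := invertibleOfNonzero h0
  have h := Representation.card_inv_mul_sum_char_eq_finrank ρ
  have hinv : ρ.invariants = intertwiners M P Q := by
    ext T
    exact ⟨fun h y hy => h ⟨y, hy⟩, fun h y => h y y.2⟩
  rw [hinv, inv_mul_eq_iff_eq_mul₀ h0] at h
  rw [← h]
  refine Finset.sum_congr rfl fun y _ => ?_
  have hy : Q (y⁻¹ : M) = (Q y)⁻¹ := _root_.map_inv hQ.homOn y
  rw [hy]
  exact (trace_twoSided _ _).symm

end Trace

/-! ### Absolutely irreducible matrix groups -/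

section Span

variable {k : Type*} [Field k] {d : ℕ} {H : Type*} [Group H]

theorem exists_eq_scalar {ι : Type*} {D : ι → GL (Fin d) k}
    (hD : Submodule.span k (Set.range fun h => (D h).val) = ⊤) {A : GL (Fin d) k}
    (hA : ∀ h, A * D h = D h * A) : ∃ z : kˣ, A = scalar (Fin d) z := by
  have hcomm : ∀ B : Matrix (Fin d) (Fin d) k, A.val * B = B * A.val := by
    intro B
    have hB : B ∈ Submodule.span k (Set.range fun h => (D h).val) := hD ▸ Submodule.mem_top
    induction hB using Submodule.span_induction with
    | mem x hx =>
      obtain ⟨h, rfl⟩ := hx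
      exact congrArg Units.val (hA h)
    | zero => simp
    | add x y _ _ hx hy => rw [Matrix.mul_add, Matrix.add_mul, hx, hy]
    | smul a x _ hx => rw [Matrix.mul_smul, Matrix.smul_mul, hx]
  have hc : A ∈ Subgroup.center (GL (Fin d) k) :=
    Subgroup.mem_center_iff.mpr fun B => Units.ext (hcomm B.val).symm
  rw [center_eq_range_scalar] at hc
  obtain ⟨z, hz⟩ := hc
  exact ⟨z, hz.symm⟩

/-- Schur's lemma without an algebraically closed field: a nonzero vector in the kernel of S would
generate everything under the spanning family, forcing S = 0. -/
theorem isUnit_of_intertwines {ι : Type*} {D D' : ι → GL (Fin d) k}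
    (hD : Submodule.span k (Set.range fun h => (D h).val) = ⊤) {S : Matrix (Fin d) (Fin d) k}
    (hS0 : S ≠ 0) (hS : ∀ h, S * (D h).val = (D' h).val * S) : IsUnit S := by
  rw [Matrix.isUnit_iff_isUnit_det, isUnit_iff_ne_zero]
  intro hdet
  obtain ⟨v, hv, hSv⟩ := Matrix.exists_mulVec_eq_zero_iff.mpr hdet
  have key : ∀ B : Matrix (Fin d) (Fin d) k, S *ᵥ (B *ᵥ v) = 0 := by
    intro B
    have hB : B ∈ Submodule.span k (Set.range fun h => (D h).val) := hD ▸ Submodule.mem_top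
    induction hB using Submodule.span_induction with
    | mem x hx =>
      obtain ⟨h, rfl⟩ := hx
      rw [Matrix.mulVec_mulVec, hS, ← Matrix.mulVec_mulVec, hSv, Matrix.mulVec_zero]
    | zero => simp
    | add x y _ _ hx hy => rw [Matrix.add_mulVec, Matrix.mulVec_add, hx, hy, add_zero]
    | smul a x _ hx => rw [Matrix.smul_mulVec, Matrix.mulVec_smul, hx, smul_zero]
  obtain ⟨j, hj⟩ := Function.ne_iff.mp hv
  apply hS0
  ext a b
  have h := congrFun (key (Matrix.single b j (v j)⁻¹)) a
  have hb : Matrix.single b j (v j)⁻¹ *ᵥ v = Pi.single b 1 := by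
    ext i
    rw [Matrix.single_mulVec]
    have : (v j)⁻¹ * v j = 1 := inv_mul_cancel₀ hj
    simp [this, Function.update_apply, Pi.single_apply]
  rw [hb, Matrix.mulVec_single_one] at h
  exact h

/-- The complex representation defined by a matrix group over `ℚ^ab`. -/
def complexRep (D : H →* GL (Fin d) Qab) : Representation ℂ H (Fin d → ℂ) :=
  ((Matrix.toLinAlgEquiv' (R := ℂ) (n := Fin d)).toMonoidHom).comp
    ((Units.coeHom _).comp ((map (algebraMap Qab ℂ)).comp D))

theorem complexRep_apply (D : H →* GL (Fin d) Qab) (h : H) :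
    complexRep D h = Matrix.toLin' ((D h).val.map (algebraMap Qab ℂ)) := rfl

theorem character_complexRep (D : H →* GL (Fin d) Qab) (h : H) :
    (complexRep D).character h = ((D h).val.trace : Qab) := by
  rw [Representation.character, complexRep_apply, Matrix.trace_toLin'_eq,
    ← AddMonoidHom.map_trace (algebraMap Qab ℂ)]
  rfl

/-- A nonzero functional over ℚ^ab killing the span would extend to a functional over ℂ killing the
complex span. -/
theorem span_eq_top_of_complex {ι : Type*} {D : ι → GL (Fin d) Qab}
    (hD : Submodule.span ℂ (Set.range fun h => (D h).val.map (algebraMap Qab ℂ)) = ⊤) :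
    Submodule.span Qab (Set.range fun h => (D h).val) = ⊤ := by
  by_contra hne
  obtain ⟨f, hf0, hf⟩ := Submodule.exists_le_ker_of_lt_top _ (lt_top_iff_ne_top.mpr hne)
  let F : Matrix (Fin d) (Fin d) ℂ →ₗ[ℂ] ℂ :=
    ∑ i, ∑ j, ((f (Matrix.single i j 1) : Qab) : ℂ) • Matrix.entryLinearMap ℂ ℂ i j
  have hF : ∀ B : Matrix (Fin d) (Fin d) Qab, F (B.map (algebraMap Qab ℂ)) = (f B : Qab) := by
    intro B
    conv_rhs => rw [Matrix.matrix_eq_sum_single B]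
    have hs : ∀ i j, Matrix.single i j (B i j) = B i j • Matrix.single i j (1 : Qab) := by
      intro i j; rw [Matrix.smul_single, smul_eq_mul, mul_one]
    simp only [map_sum, hs, _root_.map_smul, F, LinearMap.sum_apply, LinearMap.smul_apply,
      Matrix.entryLinearMap_apply, Matrix.map_apply, smul_eq_mul]
    push_cast
    refine Finset.sum_congr rfl fun i _ => Finset.sum_congr rfl fun j _ => ?_
    rw [mul_comm]
    rfl
  have hF0 : F = 0 := by
    apply LinearMap.ext_on_range (v := fun h => (D h).val.map (algebraMap Qab ℂ)) hD
    intro h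
    rw [hF, LinearMap.mem_ker.mp (hf (Submodule.subset_span ⟨h, rfl⟩))]
    rfl
  apply hf0
  ext1 B
  have := hF B
  rw [hF0, LinearMap.zero_apply] at this
  exact Subtype.ext this.symm

end Span

section Irreducible

variable {d : ℕ} {H : Type*} [Group H] [Finite H]

theorem _root_.Representation.span_range_eq_top_of_character_eq {V W : Type*}
    [AddCommGroup V] [Module ℂ V] [FiniteDimensional ℂ V] [AddCommGroup W] [Module ℂ W]
    [FiniteDimensional ℂ W] (ρ : Representation ℂ H V) [ρ.IsIrreducible]
    (σ : Representation ℂ H W) (h : ρ.character = σ.character) :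
    Submodule.span ℂ (Set.range σ) = ⊤ := by
  obtain ⟨f, hf⟩ : ∃ f : ρ.IntertwiningMap σ, Function.Bijective f := by
    have h1 : Module.finrank ℂ (ρ.IntertwiningMap σ) = 1 := by
      have h2 := Representation.finrank_intertwiningMap_eq_of_char_eq (ρ := ρ) (ρ' := ρ) rfl h
      rw [← h2]
      exact Representation.IsIrreducible.finrank_intertwiningMap_self ρ
    have : Nontrivial (ρ.IntertwiningMap σ) :=
      Module.nontrivial_of_finrank_pos (R := ℂ) (by rw [h1]; exact one_pos)
    obtain ⟨f, hf⟩ := exists_ne (0 : ρ.IntertwiningMap σ)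
    have hi := (Representation.IsIrreducible.injective_or_eq_zero f).resolve_right hf
    have hd : Module.finrank ℂ V = Module.finrank ℂ W := by
      have := congrFun h 1
      rw [Representation.char_one, Representation.char_one] at this
      exact_mod_cast this
    exact ⟨f, hi, (LinearMap.injective_iff_surjective_of_finrank_eq_finrank hd
      (f := f.toLinearMap)).mp hi⟩
  let E : V ≃ₗ[ℂ] W := LinearEquiv.ofBijective f.toLinearMap hf
  have hE : ∀ g, σ g = E.conj (ρ g) := by
    intro g
    ext w
    obtain ⟨v, rfl⟩ := E.surjective w
    rw [LinearEquiv.conj_apply_apply, E.symm_apply_apply]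
    exact (LinearMap.congr_fun (f.isIntertwining' g) v).symm
  have hr : Set.range σ = E.conj.toLinearMap '' Set.range ρ := by
    rw [← Set.range_comp]
    exact congrArg Set.range (funext hE)
  rw [hr, ← Submodule.map_span, ρ.span_range_eq_top, Submodule.map_top, LinearMap.range_eq_top]
  exact E.conj.surjective

/-- Burnside's theorem descended to ℚ^ab. It makes Schur's lemma available for matrices over ℚ^ab.
-/
theorem span_eq_top_of_isIrrChar (D : H →* GL (Fin d) Qab) {θ : H → ℂ} (hθ : IsIrrChar θ)
    (hD : ∀ h, (((D h).val.trace : Qab) : ℂ) = θ h) :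
    Submodule.span Qab (Set.range fun h => (D h).val) = ⊤ := by
  obtain ⟨n, ρ, hρ, rfl⟩ := hθ
  have h := ρ.span_range_eq_top_of_character_eq (complexRep D)
    (funext fun g => by rw [character_complexRep, hD])
  apply span_eq_top_of_complex
  have h2 : (fun h => (D h).val.map (algebraMap Qab ℂ)) =
      fun h => Matrix.toLin'.symm (complexRep D h) := by
    funext h
    rw [complexRep_apply, LinearEquiv.symm_apply_apply]
  have h3 : Set.range (fun h => Matrix.toLin'.symm (complexRep D h)) =
      (Matrix.toLin' (R := ℂ) (m := Fin d) (n := Fin d)).symm.toLinearMap ''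
        Set.range (complexRep D) := by
    rw [← Set.range_comp]; rfl
  rw [h2, h3, ← Submodule.map_span, h, Submodule.map_top, LinearMap.range_eq_top]
  exact LinearEquiv.surjective _

end Irreducible

end Matrix.GeneralLinearGroup

/-! ### Existence and uniqueness of projective extensions -/

open Module

theorem Representation.isIrreducible_of_comp {G H V : Type*} [Group G] [Group H] [AddCommGroup V]
    [Module ℂ V] (σ : Representation ℂ H V) (f : G →* H)
    (h : Representation.IsIrreducible (σ.comp f)) : σ.IsIrreducible := by
  have : Nontrivial V := IsSimpleModule.nontrivial (MonoidAlgebra ℂ G)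
    (Representation.asModule (σ.comp f))
  have : Nontrivial (Subrepresentation σ) := ⟨⊥, ⊤, fun h' =>
    bot_ne_top (α := Submodule ℂ V) (congrArg Subrepresentation.toSubmodule h')⟩
  refine ⟨fun A => ?_⟩
  let A' : Subrepresentation (σ.comp f : Representation ℂ G V) :=
    { toSubmodule := A.toSubmodule
      apply_mem_toSubmodule := fun g => A.apply_mem_toSubmodule (f g) }
  refine (eq_bot_or_eq_top A').imp (fun h' => ?_) fun h' => ?_
  · exact Subrepresentation.toSubmodule_injective
      (congrArg Subrepresentation.toSubmodule h' :)
  · exact Subrepresentation.toSubmodule_injective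
      (congrArg Subrepresentation.toSubmodule h' :)

namespace Matrix.GeneralLinearGroup

theorem scalar_injective {k : Type*} [Field k] {d : ℕ} [NeZero d] :
    Function.Injective (scalar (Fin d) : kˣ →* GL (Fin d) k) :=
  fun _ _ h => Units.ext (Matrix.scalar_inj.mp (congrArg Units.val h))

/-- The tautological representation of a group of operators. -/
def unitsRep {V : Type*} [AddCommGroup V] [Module ℂ V] (Γ : Subgroup (Module.End ℂ V)ˣ) :
    Representation ℂ Γ V := (Units.coeHom (Module.End ℂ V)).comp Γ.subtype

/-- A finite irreducible group of operators on a complex space can be realized over `ℚ^ab`. -/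
theorem exists_hom_trace_eq {V : Type} [AddCommGroup V] [Module ℂ V] [FiniteDimensional ℂ V]
    (Γ : Subgroup (Module.End ℂ V)ˣ) [Finite Γ]
    [(unitsRep Γ).IsIrreducible] :
    ∃ E : Γ →* GL (Fin (finrank ℂ V)) Qab,
      ∀ g : Γ, (((E g).val.trace : Qab) : ℂ) = LinearMap.trace ℂ V (g : (Module.End ℂ V)ˣ).val := by
  obtain ⟨b, hb⟩ := Representation.exists_basis_repr_mem_Qab (unitsRep Γ)
  let E₀ : Γ → Matrix (Fin (finrank ℂ V)) (Fin (finrank ℂ V)) Qab :=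
    fun g => Matrix.of fun i j => ⟨_, hb g i j⟩
  have hE₀ : ∀ g, (E₀ g).map (algebraMap Qab ℂ) =
      LinearMap.toMatrix b b (g : (Module.End ℂ V)ˣ).val := by
    intro g
    ext i j
    rw [LinearMap.toMatrix_apply]
    rfl
  have hinj : Function.Injective fun B : Matrix (Fin (finrank ℂ V)) (Fin (finrank ℂ V)) Qab =>
      B.map (algebraMap Qab ℂ) := Matrix.map_injective (algebraMap Qab ℂ).injective
  let E : Γ →* Matrix (Fin (finrank ℂ V)) (Fin (finrank ℂ V)) Qab :=
    { toFun := E₀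
      map_one' := by
        apply hinj
        beta_reduce
        rw [hE₀, Matrix.map_one _ (_root_.map_zero _) (_root_.map_one _)]
        exact LinearMap.toMatrix_one b
      map_mul' := fun g h => by
        apply hinj
        beta_reduce
        rw [Matrix.map_mul, hE₀, hE₀, hE₀, ← LinearMap.toMatrix_mul]
        rfl }
  refine ⟨E.toHomUnits, fun g => ?_⟩
  rw [LinearMap.trace_eq_matrix_trace ℂ b, ← hE₀, ← AddMonoidHom.map_trace (algebraMap Qab ℂ)]
  rfl

section Existence

variable {T : Type*} [Group T] [Finite T] (N : Subgroup T) [N.Normal] {V : Type} [AddCommGroup V]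
  [Module ℂ V] [FiniteDimensional ℂ V] (ρ : Representation ℂ N V)

/-- The operators `A` with `A ρ(n) A⁻¹ = ρ(t n t⁻¹)` for some `t`, with determinant of order
dividing the order of `N`. -/
def normalizingGroup : Subgroup (Module.End ℂ V)ˣ where
  carrier := {A | LinearMap.det A.val ^ Nat.card N = 1 ∧
    ∃ t : T, ∀ n : N, A.val * ρ n = ρ (MulAut.conjNormal t n) * A.val}
  one_mem' := ⟨by simp, 1, fun n => by simp⟩
  mul_mem' := by
    rintro A B ⟨hA, t, ht⟩ ⟨hB, s, hs⟩
    refine ⟨by rw [Units.val_mul, _root_.map_mul, mul_pow, hA, hB, one_mul], t * s, fun n => ?_⟩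
    rw [Units.val_mul, mul_assoc, hs, ← mul_assoc, ht, mul_assoc, _root_.map_mul, MulAut.mul_apply]
  inv_mem' := by
    rintro A ⟨hA, t, ht⟩
    refine ⟨?_, t⁻¹, fun n => ?_⟩
    · have h : LinearMap.det A.val * LinearMap.det (A⁻¹).val = 1 := by
        rw [← _root_.map_mul, Units.mul_inv, _root_.map_one]
      have h2 := congrArg (· ^ Nat.card N) h
      simpa only [mul_pow, hA, one_mul, one_pow] using h2
    · have h := ht (MulAut.conjNormal t⁻¹ n)
      rw [← MulAut.mul_apply, ← _root_.map_mul, mul_inv_cancel, _root_.map_one,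
        MulAut.one_apply] at h
      rw [Units.inv_mul_eq_iff_eq_mul, ← mul_assoc, h, Units.mul_inv_cancel_right]

variable [ρ.IsIrreducible]

omit [Finite T] [N.Normal] in
theorem exists_smul_of_commute (f : Module.End ℂ V) (hf : ∀ n, f * ρ n = ρ n * f) :
    ∃ z : ℂ, f = z • 1 := by
  let F : ρ.IntertwiningMap ρ := ⟨f, fun n => hf n⟩
  obtain ⟨z, hz⟩ :=
    (Representation.IsIrreducible.algebraMap_intertwiningMap_bijective_of_isAlgClosed
      (ρ := ρ)).2 F
  exact ⟨z, (congrArg (fun G => G.toLinearMap) hz).symm⟩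

/-- The twist of ρ by t has the same character, so there is an invertible intertwiner. A complex
root scales its determinant to one. -/
theorem exists_mem_normalizingGroup (t : T)
    (hinv : ∀ n, ρ.character (MulAut.conjNormal t n) = ρ.character n) :
    ∃ A ∈ normalizingGroup N ρ, ∀ n : N, A.val * ρ n = ρ (MulAut.conjNormal t n) * A.val := by
  let σ : Representation ℂ N V := ρ.comp (MulAut.conjNormal t : MulAut N).toMonoidHom
  have hσ : ρ.character = σ.character := funext fun n => (hinv n).symm
  have h1 : finrank ℂ (ρ.IntertwiningMap σ) = 1 := by
    have h2 := Representation.finrank_intertwiningMap_eq_of_char_eq (ρ := ρ) (ρ' := ρ) rfl hσ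
    rw [← h2]
    exact Representation.IsIrreducible.finrank_intertwiningMap_self ρ
  have : Nontrivial (ρ.IntertwiningMap σ) :=
    Module.nontrivial_of_finrank_pos (R := ℂ) (by rw [h1]; exact one_pos)
  obtain ⟨f, hf⟩ := exists_ne (0 : ρ.IntertwiningMap σ)
  have hi := (Representation.IsIrreducible.injective_or_eq_zero f).resolve_right hf
  have hu : IsUnit f.toLinearMap := by
    rw [LinearMap.isUnit_iff_ker_eq_bot, LinearMap.ker_eq_bot]
    exact hi
  have hdet : LinearMap.det f.toLinearMap ≠ 0 := (hu.map LinearMap.det).ne_zero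
  have : Nontrivial V := IsSimpleModule.nontrivial (MonoidAlgebra ℂ N) ρ.asModule
  obtain ⟨z, hz⟩ := IsAlgClosed.exists_pow_nat_eq (LinearMap.det f.toLinearMap)⁻¹
    (finrank_pos (R := ℂ) (M := V))
  have hd1 : LinearMap.det (z • f.toLinearMap) = 1 := by
    rw [LinearMap.det_smul, hz, inv_mul_cancel₀ hdet]
  have hu' : IsUnit (z • f.toLinearMap) := by
    rw [LinearMap.isUnit_iff_isUnit_det, hd1]; exact isUnit_one
  have hA : ∀ n : N, hu'.unit.val * ρ n = ρ (MulAut.conjNormal t n) * hu'.unit.val := by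
    intro n
    rw [IsUnit.unit_spec, smul_mul_assoc, mul_smul_comm]
    exact congrArg (z • ·) (f.isIntertwining' n)
  exact ⟨hu'.unit, ⟨by rw [IsUnit.unit_spec, hd1, one_pow], t, hA⟩, hA⟩

/-- By Schur's lemma an element is determined by t up to a scalar, and the determinant condition
makes that scalar a root of unity of order dividing dim V · |N|. The determinant bound in the
definition serves this purpose. -/
theorem finite_normalizingGroup : Finite (normalizingGroup N ρ) := by
  classical
  have : Nontrivial V := IsSimpleModule.nontrivial (MonoidAlgebra ℂ N) ρ.asModule
  let F : T → (Module.End ℂ V)ˣ := fun t =>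
    if h : ∃ A ∈ normalizingGroup N ρ, ∀ n : N, A.val * ρ n = ρ (MulAut.conjNormal t n) * A.val then
      h.choose else 1
  have hk : finrank ℂ V * Nat.card N ≠ 0 :=
    mul_ne_zero (finrank_pos (R := ℂ) (M := V)).ne' Nat.card_pos.ne'
  have : NeZero (finrank ℂ V * Nat.card N) := ⟨hk⟩
  let g : T × rootsOfUnity (finrank ℂ V * Nat.card N) ℂ → (Module.End ℂ V) :=
    fun x => ((x.2 : ℂˣ) : ℂ) • (F x.1).val
  have hfin : (Set.range g).Finite := Set.finite_range g
  have hsub : (normalizingGroup N ρ : Set (Module.End ℂ V)ˣ) ⊆ Units.val ⁻¹' Set.range g := by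
    rintro A ⟨hA, t, ht⟩
    have h : ∃ A ∈ normalizingGroup N ρ,
        ∀ n : N, A.val * ρ n = ρ (MulAut.conjNormal t n) * A.val := ⟨A, ⟨hA, t, ht⟩, ht⟩
    have hF : F t = h.choose := dif_pos h
    obtain ⟨⟨hB, -⟩, hB'⟩ := h.choose_spec
    rw [← hF] at hB hB'
    obtain ⟨z, hz⟩ := exists_smul_of_commute N ρ ((F t)⁻¹.val * A.val) fun n => by
      rw [mul_assoc, ht, Units.inv_mul_eq_iff_eq_mul, ← mul_assoc, ← mul_assoc, hB',
        Units.mul_inv_cancel_right]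
    have hz' : A.val = z • (F t).val := by
      rw [Units.inv_mul_eq_iff_eq_mul] at hz
      rw [hz, mul_smul_comm, mul_one]
    have hz1 : z ^ (finrank ℂ V * Nat.card N) = 1 := by
      rw [hz', LinearMap.det_smul, mul_pow, hB, mul_one, ← pow_mul] at hA
      exact hA
    have hzu : IsUnit z := IsUnit.of_pow_eq_one hz1 hk
    refine ⟨(t, ⟨hzu.unit, ?_⟩), hz'.symm⟩
    rw [mem_rootsOfUnity]
    exact Units.ext (by rw [Units.val_pow_eq_pow_val, IsUnit.unit_spec, hz1, Units.val_one])
  exact ((hfin.preimage Units.val_injective.injOn).subset hsub).to_subtype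

end Existence

/-- An invariant irreducible character of a normal subgroup has a projective extension with
entries in `ℚ^ab`. -/
theorem exists_isProjExt {T : Type*} [Group T] [Finite T] (N : Subgroup T) [N.Normal] {θ : N → ℂ}
    (hθ : IsIrrChar θ) (hinv : ∀ (t : T) (n : N), θ (MulAut.conjNormal t n) = θ n) :
    ∃ (d : ℕ) (P : T → GL (Fin d) Qab), IsProjExt N P ∧
      ∀ n : N, (((P n).val.trace : Qab) : ℂ) = θ n := by
  classical
  have hθ' := hθ
  obtain ⟨m, ρ, hρ, rfl⟩ := hθ
  have hfin := finite_normalizingGroup N ρ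
  let D₀ : N →* (Module.End ℂ (Fin m → ℂ))ˣ := MonoidHom.toHomUnits ρ
  have hD₀ : ∀ n, (D₀ n).val = ρ n := fun n => rfl
  have hconj : ∀ n n' : N, D₀ n * D₀ n' = D₀ (MulAut.conjNormal (n : T) n') * D₀ n := by
    intro n n'
    rw [← _root_.map_mul, ← _root_.map_mul]
    congr 1
    ext
    simp
  let D : N →* normalizingGroup N ρ := D₀.codRestrict _ fun n => by
    refine ⟨?_, (n : T), fun n' => congrArg Units.val (hconj n n')⟩
    rw [hD₀, ← _root_.map_pow, ← _root_.map_pow, pow_card_eq_one', _root_.map_one, _root_.map_one]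
  -- The finite group of normalizing operators contains ρ(N), so it is irreducible, and Brauer's
  -- theorem realizes all these operators over ℚ^ab simultaneously.
  have _ : (unitsRep (normalizingGroup N ρ)).IsIrreducible :=
    Representation.isIrreducible_of_comp _ D hρ
  obtain ⟨E, hE⟩ := exists_hom_trace_eq (normalizingGroup N ρ)
  have hspan : Submodule.span Qab (Set.range fun n => ((E.comp D) n).val) = ⊤ :=
    span_eq_top_of_isIrrChar (E.comp D) hθ' fun n => hE (D n)
  have hex : ∀ t : T, ∃ A : normalizingGroup N ρ,
      (∀ n : N, A * D n = D (MulAut.conjNormal t n) * A) ∧ ∀ h : t ∈ N, A = D ⟨t, h⟩ := by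
    intro t
    by_cases h : t ∈ N
    · exact ⟨D ⟨t, h⟩, fun n => Subtype.ext (hconj ⟨t, h⟩ n), fun _ => rfl⟩
    · obtain ⟨A, hA, hA'⟩ := exists_mem_normalizingGroup N ρ t (hinv t)
      exact ⟨⟨A, hA⟩, fun n => Subtype.ext (Units.ext (hA' n)), fun h' => absurd h' h⟩
  choose F hF hFN using hex
  -- Operators are chosen on coset representatives and extended by ρ along each coset, which forces
  -- compatibility with N on the right; compatibility on the left follows by conjugation.
  let r : T → T := fun t => (QuotientGroup.mk t : T ⧸ N).out
  have hr : ∀ t, (r t)⁻¹ * t ∈ N := fun t => by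
    rw [← QuotientGroup.eq]; exact QuotientGroup.out_eq' _
  let G : T → normalizingGroup N ρ := fun t => F (r t) * D ⟨_, hr t⟩
  have hG : ∀ (t : T) (n : N), G t * D n = D (MulAut.conjNormal t n) * G t := by
    intro t n
    have h1 : D ⟨_, hr t⟩ * D n = D (MulAut.conjNormal ((r t)⁻¹ * t) n) * D ⟨_, hr t⟩ :=
      Subtype.ext (hconj ⟨_, hr t⟩ n)
    simp only [G]
    rw [mul_assoc, h1, ← mul_assoc, hF, ← MulAut.mul_apply, ← _root_.map_mul, mul_inv_cancel_left,
      mul_assoc]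
  have hGr : ∀ (t : T) (n : N), G (t * n) = G t * D n := by
    intro t n
    have h1 : r (t * n) = r t := by
      simp only [r]
      congr 1
      rw [QuotientGroup.eq]
      simp
    simp only [G]
    have h2 : D ⟨_, hr (t * n)⟩ = D ⟨_, hr t⟩ * D n := by
      rw [← _root_.map_mul]
      congr 1
      ext
      simp [h1, mul_assoc]
    rw [h2, h1, mul_assoc]
  have hGN : ∀ n : N, G n = D n := by
    intro n
    have h1 : r n ∈ N := by
      have := N.mul_mem n.2 (N.inv_mem (hr n))
      simpa using this
    simp only [G]
    rw [hFN _ h1, ← _root_.map_mul]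
    congr 1
    ext
    simp
  have hGl : ∀ (n : N) (t : T), G (n * t) = D n * G t := by
    intro n t
    have h1 := hGr t (MulAut.conjNormal t⁻¹ n)
    rw [hG, ← MulAut.mul_apply, ← _root_.map_mul, mul_inv_cancel, _root_.map_one,
      MulAut.one_apply] at h1
    rw [← h1]
    congr 1
    simp [mul_assoc]
  clear_value G
  refine ⟨_, fun t => E (G t), ⟨fun n hn g => ?_, fun g n hn => ?_, fun g h => ?_⟩, fun n => ?_⟩
  · rw [hGl ⟨n, hn⟩, hGN ⟨n, hn⟩, _root_.map_mul]
  · rw [hGr g ⟨n, hn⟩, hGN ⟨n, hn⟩, _root_.map_mul]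
  -- The defect of multiplicativity commutes with the image of N, so it is scalar. It has finite
  -- order because it lies in the image of a finite group.
  · obtain ⟨z, hz⟩ := exists_eq_scalar (D := fun n => (E.comp D) n) hspan
      (A := E (G (g * h) * (G g * G h)⁻¹)) fun n => by
        have h1 : G (g * h) * (G g * G h)⁻¹ * D n = D n * (G (g * h) * (G g * G h)⁻¹) := by
          obtain ⟨n, rfl⟩ := (MulAut.conjNormal (g * h) : MulAut N).surjective n
          have h2 : (G g * G h) * D n = D (MulAut.conjNormal (g * h) n) * (G g * G h) := by
            rw [mul_assoc, hG, ← mul_assoc, hG, mul_assoc, _root_.map_mul, MulAut.mul_apply]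
          rw [← mul_assoc, ← hG, mul_assoc, mul_assoc]
          congr 1
          rw [inv_mul_eq_iff_eq_mul, ← mul_assoc, h2, mul_inv_cancel_right]
        change E _ * E (D n) = E (D n) * E _
        rw [← _root_.map_mul, h1, _root_.map_mul]
    refine ⟨z, ?_, ?_⟩
    · have : Nontrivial (Fin m → ℂ) := IsSimpleModule.nontrivial (MonoidAlgebra ℂ N) ρ.asModule
      have : NeZero (finrank ℂ (Fin m → ℂ)) := ⟨finrank_pos.ne'⟩
      have h1 : IsOfFinOrder (scalar (Fin (finrank ℂ (Fin m → ℂ))) z) := by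
        rw [← hz]; exact E.isOfFinOrder (isOfFinOrder_of_finite _)
      exact scalar_injective.isOfFinOrder_iff.mp h1
    · rw [← hz, ← _root_.map_mul, ← _root_.map_mul, inv_mul_cancel_right]
  · exact (congrArg (fun g => (((E g).val.trace : Qab) : ℂ)) (hGN n)).trans (hE (D n))

/-- Two projective extensions with the same character differ by a similarity and a function on the
quotient. -/
theorem exists_similar {T : Type*} [Group T] [Finite T] {N : Subgroup T} [N.Normal] {d : ℕ}
    {k : Type*} [Field k] [CharZero k] {P Q : T → GL (Fin d) k} (hP : IsProjExt N P)
    (hQ : IsProjExt N Q)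
    (hspan : Submodule.span k (Set.range fun n : N => (P n).val) = ⊤)
    (htr : ∀ n ∈ N, (P n).val.trace = (Q n).val.trace) :
    ∃ (S : GL (Fin d) k) (μ : T → kˣ), (∀ n ∈ N, μ n = 1) ∧ (∀ n ∈ N, ∀ x, μ (n * x) = μ x) ∧
      ∀ x, Q x = scalar (Fin d) (μ x) * (S * P x * S⁻¹) := by
  have _ := Fintype.ofFinite N
  rcases Nat.eq_zero_or_pos d with rfl | hd
  · exact ⟨1, fun _ => 1, fun _ _ => rfl, fun _ _ _ => rfl, fun x => Subsingleton.elim _ _⟩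
  have : NeZero d := ⟨hd.ne'⟩
  have hfr : finrank k (intertwiners N P P) = finrank k (intertwiners N Q P) := by
    have h0 : (Nat.card N : k) ≠ 0 := Nat.cast_ne_zero.mpr Nat.card_pos.ne'
    have h1 := sum_trace_mul_trace_inv hP hP
    have h2 := sum_trace_mul_trace_inv hQ hP
    rw [Finset.sum_congr rfl fun y _ => by rw [htr y y.2], h2] at h1
    exact_mod_cast (mul_left_cancel₀ h0 h1).symm
  have : Nontrivial (intertwiners N P P) :=
    ⟨⟨⟨1, mem_intertwiners_iff.mpr fun y _ => by rw [Matrix.mul_one, Matrix.one_mul]⟩, 0,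
      fun h => one_ne_zero (congrArg Subtype.val h)⟩⟩
  have : Nontrivial (intertwiners N Q P) :=
    Module.nontrivial_of_finrank_pos (R := k) (hfr ▸ finrank_pos)
  obtain ⟨⟨S₀, hS₀⟩, hne⟩ := exists_ne (0 : intertwiners N Q P)
  have hne' : S₀ ≠ 0 := fun h => hne (Subtype.ext h)
  rw [mem_intertwiners_iff] at hS₀
  obtain ⟨S, rfl⟩ := isUnit_of_intertwines (D := fun n : N => P n) (D' := fun n : N => Q n)
    hspan hne' fun n => (hS₀ n n.2).symm
  have hS : ∀ n ∈ N, Q n * S = S * P n := fun n hn => Units.ext (hS₀ n hn)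
  have hex : ∀ x, ∃ z : kˣ, Q x = scalar (Fin d) z * (S * P x * S⁻¹) := by
    intro x
    -- After conjugation by S both P(x) and Q(x) induce the same action on P(N), so their quotient
    -- commutes with P(N).
    obtain ⟨z, hz⟩ := exists_eq_scalar (D := fun n : N => P n) hspan
      (A := S⁻¹ * Q x * S * (P x)⁻¹) fun n => by
        obtain ⟨n, rfl⟩ := (MulAut.conjNormal x : MulAut N).surjective n
        rw [MulAut.conjNormal_apply]
        have e1 : (P x)⁻¹ * P (x * n * x⁻¹) = P n * (P x)⁻¹ := by
          rw [inv_mul_eq_iff_eq_mul, ← mul_assoc, eq_mul_inv_iff_mul_eq, hP.conj_mul x n.2]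
        have e2 : Q x * Q n = Q (x * n * x⁻¹) * Q x := (hQ.conj_mul x n.2).symm
        have e3 : S⁻¹ * Q (x * n * x⁻¹) = P (x * n * x⁻¹) * S⁻¹ := by
          rw [inv_mul_eq_iff_eq_mul, ← mul_assoc, eq_mul_inv_iff_mul_eq,
            hS _ (Subgroup.Normal.conj_mem inferInstance _ n.2 x)]
        calc S⁻¹ * Q x * S * (P x)⁻¹ * P (x * n * x⁻¹)
            = S⁻¹ * Q x * (S * P n) * (P x)⁻¹ := by rw [mul_assoc, e1]; simp only [mul_assoc]
          _ = S⁻¹ * (Q x * Q n) * S * (P x)⁻¹ := by rw [← hS n n.2]; simp only [mul_assoc]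
          _ = _ := by rw [e2, ← mul_assoc, e3]; simp only [mul_assoc]
    refine ⟨z, ?_⟩
    rw [mul_inv_eq_iff_eq_mul] at hz
    have e : Q x = S * (S⁻¹ * Q x * S) * S⁻¹ := by group
    rw [e, hz, ← mul_assoc, ← scalar_commute]
    simp only [mul_assoc]
  choose μ hμ using hex
  have h1 : ∀ n ∈ N, Q n = S * P n * S⁻¹ := fun n hn => by rw [← hS n hn, mul_inv_cancel_right]
  refine ⟨S, μ, fun n hn => scalar_injective (d := d) ?_, fun n hn x => scalar_injective (d := d) ?_, hμ⟩
  · have := hμ n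
    rw [h1 n hn, right_eq_mul] at this
    rw [this, _root_.map_one]
  · have h2 := hμ (n * x)
    have h3 : Q (n * x) = scalar (Fin d) (μ x) * (S * P (n * x) * S⁻¹) := by
      rw [hQ.mul_left n hn, h1 n hn, hμ x, hP.mul_left n hn, ← mul_assoc, ← scalar_commute]
      group
    exact mul_right_cancel (h2.symm.trans h3)

end Matrix.GeneralLinearGroup

/-! ### Irreducible characters -/

section IrrChar

variable {G : Type*} [Group G]

theorem IsIrrChar.comp_equiv {H : Type*} [Group H] {θ : G → ℂ} (hθ : IsIrrChar θ) (e : H ≃* G) :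
    IsIrrChar (fun h => θ (e h)) := by
  obtain ⟨n, ρ, hρ, rfl⟩ := hθ
  refine ⟨n, ρ.comp e.toMonoidHom, ?_, rfl⟩
  refine Representation.isIrreducible_of_comp _ e.symm.toMonoidHom ?_
  convert hρ
  ext g : 1
  exact congrArg ρ (e.apply_symm_apply g)

theorem IsIrrChar.conj {θ : G → ℂ} (hθ : IsIrrChar θ) (g h : G) : θ (g * h * g⁻¹) = θ h := by
  obtain ⟨n, ρ, hρ, rfl⟩ := hθ
  rw [Representation.char_mul_comm, inv_mul_cancel_left]

/-- On the cyclic group generated by g all irreducible representations are one-dimensional, with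
values of absolute value one. -/
theorem Representation.conj_character {V : Type} [Finite G] [AddCommGroup V] [Module ℂ V]
    [FiniteDimensional ℂ V] (ρ : Representation ℂ G V) (g : G) :
    starRingEnd ℂ (ρ.character g) = ρ.character g⁻¹ := by
  have key : ∀ σ : Representation ℂ (Subgroup.zpowers g) V, ∀ h,
      starRingEnd ℂ (σ.character h) = σ.character h⁻¹ := by
    intro σ
    refine Representation.induction_on_irreducible
      (P := fun W _ _ _ σ => ∀ h : Subgroup.zpowers g,
        starRingEnd ℂ (σ.character h) = σ.character h⁻¹) ?_ ?_ ?_ ?_ V σ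
    · intro W _ _ _ σ hW h
      have h0 : ∀ x, σ.character x = 0 := fun x => by
        rw [Representation.character, Subsingleton.elim (σ x) 0, map_zero]
      rw [h0, h0, map_zero]
    · intro W _ _ _ σ hσ h
      have h1 := Representation.IsIrreducible.finrank_eq_one_of_isMulCommutative σ
      have hs : ∀ x, ∃ z : ℂ, σ x = z • 1 := by
        intro x
        obtain ⟨z, hz⟩ := (LinearMap.existsUnique_eq_smul_id_of_finrank_eq_one h1 (σ x)).exists
        exact ⟨z, hz⟩
      choose z hz using hs
      have hc : ∀ x, σ.character x = z x := fun x => by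
        rw [Representation.character, hz, map_smul, LinearMap.trace_one, h1]; simp
      have : Nontrivial W := Module.nontrivial_of_finrank_pos (R := ℂ) (by rw [h1]; exact one_pos)
      have hinj : Function.Injective fun c : ℂ => c • (1 : Module.End ℂ W) :=
        smul_left_injective ℂ one_ne_zero
      have hone : z 1 = 1 := hinj (by beta_reduce; rw [← hz, map_one, one_smul])
      have hmul : ∀ x y, z (x * y) = z x * z y := fun x y => hinj (by
        beta_reduce; rw [← hz, map_mul, hz, hz, smul_mul_smul_comm, mul_one])
      let Z : Subgroup.zpowers g →* ℂ := ⟨⟨z, hone⟩, hmul⟩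
      have hn : ‖Z h‖ = 1 := (Z.isOfFinOrder (isOfFinOrder_of_finite h)).norm_eq_one
      rw [hc, hc]
      change starRingEnd ℂ (Z h) = Z h⁻¹
      rw [← Complex.inv_eq_conj hn]
      exact (eq_inv_of_mul_eq_one_left (by rw [← map_mul, inv_mul_cancel, map_one])).symm
    · intro W W' _ _ _ _ _ _ σ σ' h h' x
      rw [Representation.char_prod, Representation.char_prod, map_add, h, h']
    · intro W W' _ _ _ _ _ _ σ σ' e h x
      rw [← Representation.char_iso e, h]
  exact key (ρ.comp (Subgroup.zpowers g).subtype) ⟨g, Subgroup.mem_zpowers g⟩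

theorem IsIrrChar.conj_apply [Finite G] {θ : G → ℂ} (hθ : IsIrrChar θ) (g : G) :
    starRingEnd ℂ (θ g) = θ g⁻¹ := by
  obtain ⟨n, ρ, hρ, rfl⟩ := hθ
  exact ρ.conj_character g

end IrrChar

/-- A complex root of a root of unity is a root of unity, so the rescaling never leaves ℚ^ab. -/
theorem exists_pow_eq_of_isOfFinOrder (m : ℕ) (hm : 0 < m) (z : (Qab)ˣ) (hz : IsOfFinOrder z) :
    ∃ w : (Qab)ˣ, IsOfFinOrder w ∧ w ^ m = z := by
  obtain ⟨n, hn, hzn⟩ := isOfFinOrder_iff_pow_eq_one.mp hz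
  obtain ⟨w, hw⟩ := IsAlgClosed.exists_pow_nat_eq ((z : Qab) : ℂ) hm
  have hz1 : ((z : Qab) : ℂ) ^ n = 1 := by
    have := congrArg (fun u : (Qab)ˣ => ((u : Qab) : ℂ)) hzn
    simpa using this
  have hw1 : w ^ (m * n) = 1 := by rw [pow_mul, hw, hz1]
  have hw2 : (⟨w, mem_Qab_of_pow_eq_one (Nat.mul_pos hm hn) hw1⟩ : Qab) ^ (m * n) = 1 :=
    Subtype.ext hw1
  have hu := IsUnit.of_pow_eq_one hw2 (Nat.mul_pos hm hn).ne'
  refine ⟨hu.unit, isOfFinOrder_iff_pow_eq_one.mpr ⟨m * n, Nat.mul_pos hm hn, ?_⟩, ?_⟩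
  · exact Units.ext (by rw [Units.val_pow_eq_pow_val, IsUnit.unit_spec, hw2, Units.val_one])
  · exact Units.ext (Subtype.ext (by rw [Units.val_pow_eq_pow_val, IsUnit.unit_spec]; exact hw))

namespace Matrix.GeneralLinearGroup

theorem charInner_eq_finrank {A : Type*} [Group A] [Finite A] {M : Subgroup A} {d e : ℕ}
    {P : A → GL (Fin d) Qab} {Q : A → GL (Fin e) Qab} (hP : IsProjExt M P) (hQ : IsProjExt M Q)
    {f g : M → ℂ} (hf : ∀ y : M, (((P y).val.trace : Qab) : ℂ) = f y)
    (hg : ∀ y : M, (((Q y).val.trace : Qab) : ℂ) = g y) (hirr : IsIrrChar g) :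
    charInner f g = Module.finrank Qab (intertwiners M P Q) := by
  have _ := Fintype.ofFinite M
  have h0 : (Nat.card M : ℂ) ≠ 0 := Nat.cast_ne_zero.mpr Nat.card_pos.ne'
  have h := congrArg (algebraMap Qab ℂ) (sum_trace_mul_trace_inv hP hQ)
  rw [charInner, finsum_eq_sum_of_fintype, div_eq_iff h0, mul_comm]
  rw [_root_.map_sum, _root_.map_mul, map_natCast, map_natCast] at h
  rw [← h]
  refine Finset.sum_congr rfl fun y _ => ?_
  rw [hirr.conj_apply, ← hf, ← hg, _root_.map_mul]
  rfl

end Matrix.GeneralLinearGroup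

/-! ### Stabilizers under the combined group and Galois action -/

section Stabilizers

variable {A N : Type*} [Group A] [Group N] {act : A →* MulAut N} {J : Subgroup GalQab} {θ : N → ℂ}

theorem galAct_injective (σ : GalQab) : Function.Injective (galAct σ) :=
  fun a b h => by rw [← galAct_inv_self σ a, h, galAct_inv_self]

/-- The translate of θ by a is a Galois conjugate of θ, and Galois conjugate functions have the same
stabilizer. -/
theorem conj_mem_charStab_iff {a : A} {σ : GalQab} (ha : ∀ x, galAct σ (θ (act a x)) = θ x) (b : A) :
    a * b * a⁻¹ ∈ charStab act θ ↔ b ∈ charStab act θ := by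
  have key : ∀ x, θ (act (a * b * a⁻¹) (act a x)) = θ (act a x) ↔ θ (act b x) = θ x := by
    intro x
    rw [← MulAut.mul_apply, ← map_mul, inv_mul_cancel_right, map_mul, MulAut.mul_apply,
      ← (galAct_injective σ).eq_iff, ha, ha]
  constructor
  · exact fun h x => (key x).mp (h _)
  · intro h x
    obtain ⟨x, rfl⟩ := (act a).surjective x
    exact (key x).mpr (h x)

/-- Conjugation by an element `a` on a subgroup that it normalizes. -/
def Subgroup.conjEquiv (T : Subgroup A) (a : A) (h : ∀ b, a * b * a⁻¹ ∈ T ↔ b ∈ T) : T ≃* T where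
  toFun t := ⟨a * t * a⁻¹, (h t).mpr t.2⟩
  invFun t := ⟨a⁻¹ * t * a, (h _).mp (by simp [mul_assoc])⟩
  left_inv t := by ext; simp [mul_assoc]
  right_inv t := by ext; simp [mul_assoc]
  map_mul' s t := by ext; simp [mul_assoc]

end Stabilizers

/-! ### Matched projective extensions in the overgroup -/

theorem charInner_comp_equiv {G H : Type*} [Group G] [Group H] (e : H ≃* G) (f g : G → ℂ) :
    charInner (fun h => f (e h)) (fun h => g (e h)) = charInner f g := by
  rw [charInner, charInner, Nat.card_congr e.toEquiv]
  congr 1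
  exact finsum_comp_equiv e.toEquiv (f := fun x => f x * starRingEnd ℂ (g x))

/-- The hypotheses compare stabilizers for particular acting groups, such as Aut(X)_U. Every other
group that occurs maps to one of these, so the comparison can be pulled back. -/
theorem pairStab_iff_of_comp {G A N N' : Type*} [Group G] [Group A] [Group N] [Group N']
    {J : Subgroup GalQab} {θ : N → ℂ} {φ : N' → ℂ} {act : A →* MulAut N} {act' : A →* MulAut N'}
    (h : pairStab act J θ = pairStab act' J φ) (f : G →* A) (g : G) {σ : GalQab} (hσ : σ ∈ J) :
    (∀ x, galAct σ (θ (act (f g) x)) = θ x) ↔ ∀ x, galAct σ (φ (act' (f g) x)) = φ x := by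
  have h1 : (f g, σ) ∈ pairStab act J θ ↔ (f g, σ) ∈ pairStab act' J φ := by rw [h]
  exact ⟨fun h2 => (h1.mp ⟨hσ, h2⟩).2, fun h2 => (h1.mpr ⟨hσ, h2⟩).2⟩

section Overgroup

variable {G : Type*} [Group G] (X : Subgroup G) [X.Normal] (U : Subgroup X)

/-- The factorization `G = X N_G(U)` for an intravariant subgroup `U` of `X`. -/
theorem exists_mul_mem_normIn {U : Subgroup X} (hU : IsIntravariant U) (g : G) :
    ∃ x : X, (x : G)⁻¹ * g ∈ normIn X U := by
  obtain ⟨x, hx⟩ := hU (MulAut.conjNormal g)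
  refine ⟨x, ?_⟩
  change MulAut.conjNormal ((x : G)⁻¹ * g) • U = U
  have h1 : (MulAut.conjNormal (x : G) : MulAut X) = MulAut.conj x := by
    ext y; simp
  rw [map_mul, mul_smul, hx, map_inv, h1, inv_smul_smul]

/-- The subgroup `U` of the stabilizer of `μ` in `N_G(U)`. -/
def baseIn (μ : U → ℂ) : Subgroup (charStab (normInAct X U) μ) :=
  (U.map X.subtype).comap ((normIn X U).subtype.comp (charStab (normInAct X U) μ).subtype)

theorem exists_hom_baseIn {U : Subgroup X} {μ : U → ℂ} (hμ : IsIrrChar μ) :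
    ∃ f : U →* baseIn X U μ, ∀ u : U, (((f u : charStab (normInAct X U) μ) : normIn X U) : G) = u := by
  have h1 : ∀ u : U, ((u : X) : G) ∈ normIn X U := fun u => by
    rw [mem_normIn_iff]
    exact Subgroup.le_normalizer ⟨u, u.2, rfl⟩
  have h2 : ∀ u : U, (⟨_, h1 u⟩ : normIn X U) ∈ charStab (normInAct X U) μ := fun u v => by
    have : normInAct X U ⟨_, h1 u⟩ v = u * v * u⁻¹ := by
      apply Subtype.ext
      apply Subtype.ext
      change ((u : X) : G) * v * ((u : X) : G)⁻¹ = _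
      simp
    rw [this, hμ.conj]
  exact ⟨MonoidHom.mk' (fun u => ⟨⟨⟨_, h1 u⟩, h2 u⟩, ⟨u, u.2, rfl⟩⟩) fun _ _ => rfl, fun _ => rfl⟩

end Overgroup

namespace Matrix.GeneralLinearGroup

/-- Projective extensions of `χ` and `μ` over `ℚ^ab`, to the stabilizers of `χ` in `G` and of `μ` in
`N_G(U)`, with the same factor sets, scalars on `C_G(X)` and twisting functions. -/
structure IsMatchedPair {G : Type*} [Group G] (X : Subgroup G) [X.Normal] (J : Subgroup GalQab)
    (χ : X → ℂ) (U : Subgroup X) (μ : U → ℂ) {d e : ℕ} (P : inertia X χ → GL (Fin d) Qab)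
    (Q : charStab (normInAct X U) μ → GL (Fin e) Qab) : Prop where
  left : IsProjExt (X.subgroupOf (inertia X χ)) P
  right : IsProjExt (baseIn X U μ) Q
  left_ne_zero : d ≠ 0
  right_ne_zero : e ≠ 0
  trace_left : ∀ (t : inertia X χ) (x : X), (t : G) = x → (((P t).val.trace : Qab) : ℂ) = χ x
  trace_right : ∀ (t : charStab (normInAct X U) μ) (u : U),
    ((t : normIn X U) : G) = ((u : X) : G) → (((Q t).val.trace : Qab) : ℂ) = μ u
  mem_iff : ∀ h : normIn X U, (h : G) ∈ inertia X χ ↔ h ∈ charStab (normInAct X U) μ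
  factor : ∀ (x y : charStab (normInAct X U) μ) (x' y' : inertia X χ),
    (x' : G) = (x : normIn X U) → (y' : G) = (y : normIn X U) → ∃ z : (Qab)ˣ, IsOfFinOrder z ∧
      P (x' * y') = scalar (Fin d) z * (P x' * P y') ∧ Q (x * y) = scalar (Fin e) z * (Q x * Q y)
  central : ∀ (c : charStab (normInAct X U) μ) (c' : inertia X χ),
    (c' : G) = (c : normIn X U) → (c' : G) ∈ Subgroup.centralizer (X : Set G) →
      ∃ z : (Qab)ˣ, P c' = scalar (Fin d) z ∧ Q c = scalar (Fin e) z
  twist : ∀ (h : normIn X U), ∀ σ ∈ J,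
    (∀ x, galAct σ (χ (MulAut.conjNormal (h : G) x)) = χ x) →
      ∃ (S : GL (Fin d) Qab) (S' : GL (Fin e) Qab) (ν : inertia X χ → (Qab)ˣ)
        (ν' : charStab (normInAct X U) μ → (Qab)ˣ),
        (∀ x : inertia X χ, (x : G) ∈ X → ν x = 1) ∧ (∀ x ∈ baseIn X U μ, ν' x = 1) ∧
        (∀ x y : inertia X χ, (y : G) = h * x * (h : G)⁻¹ →
          map ((σ : Qab ≃+* Qab) : Qab →+* Qab) (P y) = scalar (Fin d) (ν x) * (S * P x * S⁻¹)) ∧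
        (∀ x y : charStab (normInAct X U) μ, (y : normIn X U) = h * x * h⁻¹ →
          map ((σ : Qab ≃+* Qab) : Qab →+* Qab) (Q y) = scalar (Fin e) (ν' x) * (S' * Q x * S'⁻¹)) ∧
        ∀ (x : charStab (normInAct X U) μ) (x' : inertia X χ), (x' : G) = (x : normIn X U) →
          ν x' = ν' x

/-- The twist of a projective extension by a Galois automorphism and conjugation by an element that
stabilize its character. -/
theorem exists_twist {A : Type*} [Group A] [Finite A] {T : Subgroup A} {N : Subgroup A} [N.Normal]
    (hNT : N ≤ T) {θ : N → ℂ} (hθ : IsIrrChar θ) {d : ℕ} {P : T → GL (Fin d) Qab}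
    (hP : IsProjExt (N.subgroupOf T) P)
    (htr : ∀ (t : T) (n : N), (t : A) = n → (((P t).val.trace : Qab) : ℂ) = θ n)
    (σ : GalQab) (a : A) (ha : ∀ b, a * b * a⁻¹ ∈ T ↔ b ∈ T)
    (hθa : ∀ n, galAct σ (θ (MulAut.conjNormal a n)) = θ n) :
    ∃ (S : GL (Fin d) Qab) (ν : T → (Qab)ˣ), (∀ n ∈ N.subgroupOf T, ν n = 1) ∧
      ∀ x : T, map ((σ : Qab ≃+* Qab) : Qab →+* Qab) (P (T.conjEquiv a ha x)) =
        scalar (Fin d) (ν x) * (S * P x * S⁻¹) := by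
  have hn : ∀ n ∈ N.subgroupOf T, T.conjEquiv a ha n ∈ N.subgroupOf T := by
    intro n hn
    exact Subgroup.Normal.conj_mem (H := N) inferInstance _ hn a
  have hQ := (hP.comp (T.conjEquiv a ha).toMonoidHom hn).map ((σ : Qab ≃+* Qab) : Qab →+* Qab)
  let E : N.subgroupOf T ≃* N := Subgroup.subgroupOfEquivOfLe hNT
  have hspan := span_eq_top_of_isIrrChar (hP.homOn) (hθ.comp_equiv E) fun n => htr n (E n) rfl
  obtain ⟨S, ν, hν1, -, hν⟩ := exists_similar hP hQ hspan fun n hn' => by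
    apply Subtype.ext
    rw [htr n (E ⟨n, hn'⟩) rfl, ← hθa (E ⟨n, hn'⟩)]
    have h1 := htr (T.conjEquiv a ha n) (MulAut.conjNormal a (E ⟨n, hn'⟩)) rfl
    rw [← h1, galAct_coe]
    change _ = ((Matrix.trace ((P (T.conjEquiv a ha n)).val.map
      ((σ : Qab ≃+* Qab) : Qab →+* Qab)) : Qab) : ℂ)
    rw [← AddMonoidHom.map_trace ((σ : Qab ≃+* Qab) : Qab →+* Qab)]
    rfl
  exact ⟨S, ν, hν1, hν⟩

/-- The heart of the argument, inside the overgroup: χ* and μ* are extended projectively, and the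
coprimality of [χ*_M, μ*] to p matches the two extensions. -/
theorem exists_isMatchedPair {G : Type*} [Group G] [Finite G] (X : Subgroup G) [X.Normal]
    (J : Subgroup GalQab) (χ : X → ℂ) (hχ : IsIrrChar χ) (U : Subgroup X)
    (hUintra : IsIntravariant U) (μ : U → ℂ) (hμ : IsIrrChar μ)
    (hstab : pairStab (autStab U).subtype J χ = pairStab (autRestrict U) J μ)
    (p : ℕ) (hp : p.Prime) (K : Subgroup G) [K.Normal] (hXK : X ≤ K) (hK : ∃ n : ℕ, K.index = p ^ n)
    [(stabIn X K χ).Normal] (χs : stabIn X K χ → ℂ) (hχs : IsIrrChar χs)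
    (hχs_ext : ∀ (y : stabIn X K χ) (x : X), (y : G) = x → χs y = χ x)
    (hχs_stab :
      pairStab ((MulAut.conjNormal : G →* MulAut X).comp (normIn X U).subtype) J χ =
      pairStab ((MulAut.conjNormal : G →* MulAut (stabIn X K χ)).comp (normIn X U).subtype) J χs)
    [(stabInNorm X U K μ).Normal] (μs : stabInNorm X U K μ → ℂ) (hμs : IsIrrChar μs)
    (hμs_ext : ∀ (y : stabInNorm X U K μ) (u : U),
      ((y : normIn X U) : G) = ((u : X) : G) → μs y = μ u)
    (hμs_stab : pairStab (normInAct X U) J μ =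
      pairStab (MulAut.conjNormal : normIn X U →* MulAut (stabInNorm X U K μ)) J μs)
    (hmult : ∃ m : ℕ, m.Coprime p ∧
      charInner (fun y : stabInNorm X U K μ =>
        Function.extend Subtype.val χs 0 ((y : normIn X U) : G)) μs = m) :
    ∃ (d e : ℕ) (P : inertia X χ → GL (Fin d) Qab)
      (Q : charStab (normInAct X U) μ → GL (Fin e) Qab), IsMatchedPair X J χ U μ P Q := by
  have hiff : ∀ (h : normIn X U), ∀ σ ∈ J,
      (∀ x, galAct σ (χ (MulAut.conjNormal (h : G) x)) = χ x) ↔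
        ∀ u, galAct σ (μ (normInAct X U h u)) = μ u := fun h σ hσ =>
    pairStab_iff_of_comp hstab
      ((MulAut.conjNormal : G →* MulAut X).subgroupComap (autStab U)) h hσ
  have hχs' : ∀ (h : normIn X U), ∀ σ ∈ J,
      (∀ x, galAct σ (χ (MulAut.conjNormal (h : G) x)) = χ x) →
        ∀ y, galAct σ (χs (MulAut.conjNormal (h : G) y)) = χs y := fun h σ hσ =>
    (pairStab_iff_of_comp hχs_stab (MonoidHom.id _) h hσ).mp
  have hμs' : ∀ (h : normIn X U), ∀ σ ∈ J, (∀ u, galAct σ (μ (normInAct X U h u)) = μ u) →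
        ∀ y, galAct σ (μs (MulAut.conjNormal h y)) = μs y := fun h σ hσ =>
    (pairStab_iff_of_comp hμs_stab (MonoidHom.id _) h hσ).mp
  have hmem : ∀ h : normIn X U, (h : G) ∈ inertia X χ ↔ h ∈ charStab (normInAct X U) μ := by
    intro h
    have := hiff h 1 J.one_mem
    simp only [galAct_one] at this
    exact this
  set T := inertia X χ with hT
  set A := charStab (normInAct X U) μ with hA
  let i : A →* T := ((normIn X U).subtype.comp A.subtype).codRestrict T fun a => (hmem a).mpr a.2
  have hi : ∀ a : A, (i a : G) = (a : normIn X U) := fun a => rfl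
  have hNT : stabIn X K χ ≤ T := inf_le_right
  have hMA : stabInNorm X U K μ ≤ A := inf_le_right
  let N : Subgroup T := (stabIn X K χ).subgroupOf T
  let M : Subgroup A := (stabInNorm X U K μ).subgroupOf A
  let eN : N ≃* stabIn X K χ := Subgroup.subgroupOfEquivOfLe hNT
  let eM : M ≃* stabInNorm X U K μ := Subgroup.subgroupOfEquivOfLe hMA
  have hXT : X ≤ T := fun x hx y => by
    have : MulAut.conjNormal x y = (⟨x, hx⟩ : X) * y * (⟨x, hx⟩ : X)⁻¹ := by ext; simp
    rw [this, hχ.conj]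
  have hXs : X ≤ stabIn X K χ := le_inf hXK hXT
  -- Write t = xh with x in X and h in N_G(U). The stabilizer hypothesis for χ* covers h, and x acts
  -- by an inner automorphism of K_χ.
  have hinvN : ∀ (t : T) (n : N), χs (eN (MulAut.conjNormal t n)) = χs (eN n) := by
    intro t n
    obtain ⟨x, hx⟩ := exists_mul_mem_normIn X hUintra (t : G)
    have hxT : (x : G)⁻¹ * t ∈ T := T.mul_mem (T.inv_mem (hXT x.2)) t.2
    have h1 := hχs' ⟨_, hx⟩ 1 J.one_mem (fun y => by rw [galAct_one]; exact hxT y) (eN n)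
    rw [galAct_one] at h1
    have h2 := hχs.conj ⟨x, hXs x.2⟩ (MulAut.conjNormal ((x : G)⁻¹ * t) (eN n))
    rw [← h1, ← h2]
    congr 1
    apply Subtype.ext
    change (t : G) * (n : T) * (t : G)⁻¹ =
      (x : G) * ((x : G)⁻¹ * t * (n : T) * ((x : G)⁻¹ * t)⁻¹) * (x : G)⁻¹
    group
  have hinvM : ∀ (t : A) (n : M), μs (eM (MulAut.conjNormal t n)) = μs (eM n) := by
    intro t n
    have h1 := hμs' t 1 J.one_mem (fun y => by rw [galAct_one]; exact t.2 y) (eM n)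
    rw [galAct_one] at h1
    rw [← h1]
    rfl
  obtain ⟨d, P, hP, hPtr⟩ := exists_isProjExt N (hχs.comp_equiv eN) hinvN
  obtain ⟨e, Q₀, hQ₀, hQ₀tr⟩ := exists_isProjExt M (hμs.comp_equiv eM) hinvM
  have hMN : ∀ y ∈ M, i y ∈ N := fun y hy => ⟨hy.1, (i y).2⟩
  have hPi := hP.comp i hMN
  obtain ⟨m, hmp, hm⟩ := hmult
  have hfr : Module.finrank Qab (intertwiners M (fun a => P (i a)) Q₀) = m := by
    have h1 := charInner_eq_finrank hPi hQ₀
      (f := fun y : M => χs (eN ⟨i y, hMN y y.2⟩)) (g := fun y : M => μs (eM y))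
      (fun y => hPtr ⟨i y, hMN y y.2⟩) hQ₀tr (hμs.comp_equiv eM)
    have h2 := charInner_comp_equiv eM (fun y : stabInNorm X U K μ =>
        Function.extend Subtype.val χs 0 ((y : normIn X U) : G)) μs
    -- The default value 0 is never taken, since elements of K ∩ Δ_μ lie in K_χ.
    have h3 : (fun y : M => Function.extend Subtype.val χs 0 (((eM y : normIn X U)) : G)) =
        fun y : M => χs (eN ⟨i y, hMN y y.2⟩) :=
      funext fun y => Subtype.val_injective.extend_apply χs 0 (eN ⟨i y, hMN y y.2⟩)
    rw [h3, h1, hm] at h2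
    exact_mod_cast h2
  have hm0 : m ≠ 0 := by
    rintro rfl
    exact hp.one_lt.ne' ((Nat.coprime_zero_left p).mp hmp)
  -- The index of K ∩ Δ_μ in Δ_μ divides that of K in G, a power of p.
  have hidx : M.index.Coprime m := by
    obtain ⟨n, hn⟩ := hK
    have h1 : M.index ∣ K.index := by
      change (stabInNorm X U K μ).relIndex A ∣ _
      rw [Subgroup.inf_relIndex_right]
      exact (Subgroup.relIndex_dvd_index_of_normal _ _).trans
        (Subgroup.relIndex_dvd_index_of_normal K _)
    rw [hn] at h1
    exact (hmp.symm.pow_left n).coprime_dvd_left h1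
  obtain ⟨Q, hQ, hQM, hmat⟩ := exists_isMatched exists_pow_eq_of_isOfFinOrder hPi hQ₀
    (by rw [hfr]; exact hm0) (by rw [hfr]; exact hidx)
  have hW : intertwiners M (fun a => P (i a)) Q₀ = intertwiners M (fun a => P (i a)) Q := by
    ext T
    exact forall₂_congr fun y hy => by rw [hQM y hy]
  rw [hW] at hfr
  have hnt : Nontrivial (intertwiners M (fun a => P (i a)) Q) :=
    Module.nontrivial_of_finrank_pos (R := Qab) (by rw [hfr]; exact Nat.pos_of_ne_zero hm0)
  have hidx' : M.index.Coprime (Module.finrank Qab (intertwiners M (fun a => P (i a)) Q)) := by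
    rwa [hfr]
  have hQtr : ∀ n : M, (((Q n).val.trace : Qab) : ℂ) = μs (eM n) := fun n => by
    rw [hQM n n.2, hQ₀tr]
  have hPX : ∀ (t : T) (x : X), (t : G) = x → (((P t).val.trace : Qab) : ℂ) = χ x := by
    intro t x h
    rw [← hχs_ext (eN ⟨t, (by rw [Subgroup.mem_subgroupOf, h]; exact hXs x.2 : t ∈ N)⟩) x h]
    exact hPtr ⟨t, _⟩
  have hPX' : IsProjExt (X.subgroupOf T) P := hP.comp (MonoidHom.id T) fun y hy => hXs hy
  have hQU : IsProjExt (baseIn X U μ) Q := hQ.comp (MonoidHom.id A) fun y hy => by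
    obtain ⟨u, -, hu⟩ := hy
    refine ⟨hXK ?_, y.2⟩
    change ((y : normIn X U) : G) ∈ X
    rw [show ((y : normIn X U) : G) = u from hu.symm]
    exact u.2
  have hQtrU : ∀ (t : A) (u : U), ((t : normIn X U) : G) = ((u : X) : G) →
      (((Q t).val.trace : Qab) : ℂ) = μ u := by
    intro t u h
    have htM : t ∈ M := by
      refine ⟨?_, t.2⟩
      change ((t : normIn X U) : G) ∈ K
      rw [h]; exact hXK u.1.2
    rw [← hμs_ext (eM ⟨t, htM⟩) u h]
    exact hQtr ⟨t, htM⟩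
  have hconj : ∀ h y : normIn X U, h * y * h⁻¹ ∈ stabInNorm X U K μ ↔ y ∈ stabInNorm X U K μ := by
    refine fun h y => ⟨fun hy => ?_, fun hy => Subgroup.Normal.conj_mem inferInstance _ hy h⟩
    have h1 := Subgroup.Normal.conj_mem inferInstance _ hy h⁻¹
    rwa [show h⁻¹ * (h * y * h⁻¹) * h⁻¹⁻¹ = y by group] at h1
  refine ⟨d, e, P, Q, ⟨hPX', hQU, ?_, ?_, hPX, hQtrU, hmem, ?_, ?_, ?_⟩⟩
  -- In degree zero the intertwining space would vanish, but its dimension m is nonzero.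
  · rintro rfl
    exact not_subsingleton _ (inferInstance : Subsingleton (intertwiners M (fun a => P (i a)) Q))
  · rintro rfl
    exact not_subsingleton _ (inferInstance : Subsingleton (intertwiners M (fun a => P (i a)) Q))
  · intro x y x' y' hx hy
    obtain rfl : x' = i x := Subtype.ext hx
    obtain rfl : y' = i y := Subtype.ext hy
    obtain ⟨a, ha, hPa⟩ := hPi.factor x y
    obtain ⟨b, hb, hQb⟩ := hQ.factor x y
    obtain rfl := hmat.factor_eq hPa hQb
    exact ⟨a, ha, by rw [← hPa, _root_.map_mul], hQb⟩
  · intro c c' hc hcent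
    obtain rfl : c' = i c := Subtype.ext hc
    have hcx : ∀ x : X, ((i c : T) : G) * x = x * (i c : T) := fun x =>
      (Subgroup.mem_centralizer_iff.mp hcent x x.2).symm
    let E : X.subgroupOf T ≃* X := Subgroup.subgroupOfEquivOfLe hXT
    have hspan := span_eq_top_of_isIrrChar hPX'.homOn (hχ.comp_equiv E) fun n => hPX n (E n) rfl
    -- Since c centralizes X, P(c) commutes with the absolutely irreducible P(X). Likewise Q(c)
    -- commutes with Q(U) below.
    obtain ⟨a, ha⟩ := exists_eq_scalar (A := P (i c)) hspan fun x => by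
      change P (i c) * P x = P x * P (i c)
      rw [← hPX'.mul_right _ _ x.2, ← hPX'.mul_left _ x.2]
      congr 1
      exact Subtype.ext (hcx (E x))
    obtain ⟨f, hf⟩ := exists_hom_baseIn X hμ
    have hspan' := span_eq_top_of_isIrrChar (hQU.homOn.comp f) hμ fun u => hQtrU _ u (hf u)
    obtain ⟨b, hb⟩ := exists_eq_scalar (A := Q c) hspan' fun u => by
      change Q c * Q (f u) = Q (f u) * Q c
      rw [← hQU.mul_right _ _ (f u).2, ← hQU.mul_left _ (f u).2]
      congr 1
      apply Subtype.ext
      apply Subtype.ext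
      change ((c : normIn X U) : G) * ((f u : A) : normIn X U) =
        ((f u : A) : normIn X U) * ((c : normIn X U) : G)
      rw [hf u]
      exact hcx u
    obtain rfl := hmat.scalar_eq hidx' ha hb
    exact ⟨a, ha, hb⟩
  · intro h σ hσ hχh
    have hμh := (hiff h σ hσ).mp hχh
    obtain ⟨S, ν, hν1, hν⟩ := exists_twist hNT hχs hP
      (fun t n htn => by
        have := hPtr ⟨t, (by rw [Subgroup.mem_subgroupOf, htn]; exact n.2 : t ∈ N)⟩
        rw [this]
        congr 1
        exact Subtype.ext htn) σ (h : G)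
      (conj_mem_charStab_iff hχh) (hχs' h σ hσ hχh)
    obtain ⟨S', ν', hν1', hν'⟩ := exists_twist hMA hμs hQ
      (fun t n htn => by
        have := hQtr ⟨t, (by rw [Subgroup.mem_subgroupOf, htn]; exact n.2 : t ∈ M)⟩
        rw [this]
        congr 1
        exact Subtype.ext htn) σ h
      (conj_mem_charStab_iff hμh) (hμs' h σ hσ hμh)
    -- Both twist functions are trivial on M because h and σ fix χ* and μ*, not only χ and μ.
    have heq := hmat.twist_eq hidx' (σ : Qab ≃+* Qab)
      (A.conjEquiv h (conj_mem_charStab_iff hμh))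
      (fun y => hconj h y)
      (fun y hy => hν1 _ (hMN y hy)) hν1' (fun x => hν (i x)) hν'
    refine ⟨S, S', ν, ν', fun x hx => hν1 x (hXs hx), fun x hx => hν1' x ?_, fun x y hy => ?_,
      fun x y hy => ?_, fun x x' hx => ?_⟩
    · obtain ⟨u, -, hu⟩ := hx
      refine ⟨hXK ?_, x.2⟩
      change ((x : normIn X U) : G) ∈ X
      rw [show ((x : normIn X U) : G) = u from hu.symm]
      exact u.2
    · rw [← hν]
      congr 2
      exact Subtype.ext hy
    · rw [← hν']
      congr 2
      exact Subtype.ext hy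
    · obtain rfl : x' = i x := Subtype.ext hx
      exact congrFun heq x

end Matrix.GeneralLinearGroup

/-! ### Semidirect products with groups of automorphisms -/

section Semidirect

variable {X : Type*} [Group X] {Λ : Subgroup (MulAut X)} {U : Subgroup X} {J : Subgroup GalQab}

/-- The action of `X ⋊ Λ` on `X`. -/
def sdAct (Λ : Subgroup (MulAut X)) : AutSemidirect Λ →* MulAut X :=
  SemidirectProduct.lift MulAut.conj Λ.subtype fun γ => by
    ext x y
    simp

theorem sdAct_apply (g : AutSemidirect Λ) (x : X) :
    sdAct Λ g x = g.left * (g.right : MulAut X) x * g.left⁻¹ := rfl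

theorem sdAct_eq (g : AutSemidirect Λ) : sdAct Λ g = MulAut.conj g.left * (g.right : MulAut X) := rfl

theorem right_eq_one_of_mem_sdBase {n : AutSemidirect Λ} (hn : n ∈ sdBase Λ) : n.right = 1 := hn

theorem left_conjNormal_sdBase (g : AutSemidirect Λ) (n : sdBase Λ) :
    ((MulAut.conjNormal g n : sdBase Λ) : AutSemidirect Λ).left =
      sdAct Λ g (n : AutSemidirect Λ).left := by
  have hn : (n : AutSemidirect Λ).right = 1 := n.2
  rw [MulAut.conjNormal_apply, sdAct_apply, SemidirectProduct.mul_left, SemidirectProduct.mul_left,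
    SemidirectProduct.mul_right, SemidirectProduct.inv_left, hn, mul_one, ← MulAut.mul_apply,
    ← map_mul, mul_inv_cancel, map_one, MulAut.one_apply]
  rfl

/-- The identification of the base of `X ⋊ Λ` with `X`. -/
def sdBaseEquiv (Λ : Subgroup (MulAut X)) : sdBase Λ ≃* X where
  toFun n := (n : AutSemidirect Λ).left
  invFun x := ⟨SemidirectProduct.inl x, rfl⟩
  left_inv n := Subtype.ext (SemidirectProduct.ext rfl (right_eq_one_of_mem_sdBase n.2).symm)
  right_inv _ := rfl
  map_mul' n m := by
    change (n : AutSemidirect Λ).left *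
      ((n : AutSemidirect Λ).right : MulAut X) (m : AutSemidirect Λ).left = _
    rw [right_eq_one_of_mem_sdBase n.2]
    rfl

theorem sdBase_stab_iff {χ : X → ℂ} (g : AutSemidirect Λ) (σ : GalQab) :
    (∀ n, galAct σ (sdBaseChar Λ χ (MulAut.conjNormal g n)) = sdBaseChar Λ χ n) ↔
      ∀ x, galAct σ (χ (sdAct Λ g x)) = χ x := by
  simp only [sdBaseChar, left_conjNormal_sdBase]
  exact ⟨fun h x => h ((sdBaseEquiv Λ).symm x), fun h n => h _⟩

theorem mem_inertia_sdBase_iff {χ : X → ℂ} (g : AutSemidirect Λ) :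
    g ∈ inertia (sdBase Λ) (sdBaseChar Λ χ) ↔ ∀ x, χ (sdAct Λ g x) = χ x := by
  have h := sdBase_stab_iff (χ := χ) g 1
  simp only [galAct_one] at h
  exact h

variable (hΛ : Λ ≤ autStab U)

theorem conj_mem_autStab {u : X} (hu : u ∈ U) : MulAut.conj u ∈ autStab U := by
  rw [MulAction.mem_stabilizer_iff]
  exact Subgroup.conj_smul_eq_self_of_mem hu

theorem sdAct_mem_autStab {g : AutSemidirect Λ} (hg : g ∈ sdSub U Λ hΛ) : sdAct Λ g ∈ autStab U := by
  rw [sdAct_eq]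
  exact (autStab U).mul_mem (conj_mem_autStab hg) (hΛ g.right.2)

/-- The action of `U ⋊ Λ` on `X` as a homomorphism to `Aut(X)_U`. -/
def sdSubAct : sdSub U Λ hΛ →* autStab U :=
  ((sdAct Λ).comp (sdSub U Λ hΛ).subtype).codRestrict _ fun g => sdAct_mem_autStab hΛ g.2

theorem left_conjNormal_sdSubBase (g : sdSub U Λ hΛ) (n : sdSubBase U Λ hΛ) :
    (((MulAut.conjNormal g n : sdSubBase U Λ hΛ) : sdSub U Λ hΛ) : AutSemidirect Λ).left =
      sdAct Λ g ((n : sdSub U Λ hΛ) : AutSemidirect Λ).left :=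
  left_conjNormal_sdBase (g : AutSemidirect Λ) ⟨((n : sdSub U Λ hΛ) : AutSemidirect Λ), n.2⟩

/-- The identification of the base of `U ⋊ Λ` with `U`. -/
def sdSubBaseEquiv : sdSubBase U Λ hΛ ≃* U where
  toFun n := ⟨((n : sdSub U Λ hΛ) : AutSemidirect Λ).left, (n : sdSub U Λ hΛ).2⟩
  invFun x := ⟨⟨SemidirectProduct.inl x, x.2⟩, rfl⟩
  left_inv n := Subtype.ext (Subtype.ext
    (SemidirectProduct.ext rfl (right_eq_one_of_mem_sdBase (Λ := Λ) n.2).symm))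
  right_inv _ := rfl
  map_mul' n m := Subtype.ext
    ((sdBaseEquiv Λ).map_mul ⟨((n : sdSub U Λ hΛ) : AutSemidirect Λ), n.2⟩
      ⟨((m : sdSub U Λ hΛ) : AutSemidirect Λ), m.2⟩)

theorem sdSubBase_stab_iff {μ : U → ℂ} (g : sdSub U Λ hΛ) (σ : GalQab) :
    (∀ n, galAct σ (sdSubBaseChar U Λ hΛ μ (MulAut.conjNormal g n)) = sdSubBaseChar U Λ hΛ μ n) ↔
      ∀ u, galAct σ (μ (autRestrict U (sdSubAct hΛ g) u)) = μ u := by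
  have h1 : ∀ n, sdSubBaseChar U Λ hΛ μ (MulAut.conjNormal g n) =
      μ (autRestrict U (sdSubAct hΛ g) (sdSubBaseEquiv hΛ n)) := fun n =>
    congrArg μ (Subtype.ext (left_conjNormal_sdSubBase hΛ g n))
  simp only [h1]
  refine ⟨fun h u => ?_, fun h n => h _⟩
  have := h ((sdSubBaseEquiv hΛ).symm u)
  rwa [MulEquiv.apply_symm_apply] at this

theorem mem_inertia_sdSubBase_iff {μ : U → ℂ} (g : sdSub U Λ hΛ) :
    g ∈ inertia (sdSubBase U Λ hΛ) (sdSubBaseChar U Λ hΛ μ) ↔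
      ∀ u, μ (autRestrict U (sdSubAct hΛ g) u) = μ u := by
  have h := sdSubBase_stab_iff hΛ (μ := μ) g 1
  simp only [galAct_one] at h
  exact h

theorem sdAct_eq_one_of_mem_centralizer {c : AutSemidirect Λ}
    (hc : c ∈ Subgroup.centralizer (sdBase Λ : Set (AutSemidirect Λ))) : sdAct Λ c = 1 := by
  ext x
  have h := left_conjNormal_sdBase c ((sdBaseEquiv Λ).symm x)
  have h2 : ((MulAut.conjNormal c ((sdBaseEquiv Λ).symm x) : sdBase Λ) : AutSemidirect Λ) =
      ((sdBaseEquiv Λ).symm x : sdBase Λ) := by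
    rw [MulAut.conjNormal_apply, ← Subgroup.mem_centralizer_iff.mp hc _ ((sdBaseEquiv Λ).symm x).2,
      mul_inv_cancel_right]
  rw [h2] at h
  exact h.symm

/-- If c acts trivially on X, conjugation by its X-component is inverse to its Λ-component, which
stabilizes U. So the X-component lies in N_X(U) = U. -/
theorem centralizer_sdBase_le (hU : Subgroup.normalizer (U : Set X) = U) :
    Subgroup.centralizer (sdBase Λ : Set (AutSemidirect Λ)) ≤ sdSub U Λ hΛ := by
  intro c hc
  have h1 := sdAct_eq_one_of_mem_centralizer hc
  rw [sdAct_eq, mul_eq_one_iff_eq_inv] at h1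
  have h2 : MulAut.conj c.left ∈ autStab U := by
    rw [h1]; exact (autStab U).inv_mem (hΛ c.right.2)
  have h3 : c.left ∈ Subgroup.normalizer (U : Set X) := by
    rw [Subgroup.mem_normalizer_iff]
    intro x
    have e1 : MulAut.conj c.left • U = U := h2
    have e2 : c.left * x * c.left⁻¹ ∈ MulAut.conj c.left • U ↔ x ∈ U :=
      Subgroup.smul_mem_pointwise_smul_iff (a := MulAut.conj c.left) (x := x)
    rw [e1] at e2
    exact e2.symm
  rw [hU] at h3
  exact h3

theorem sdBase_sup_sdSub : sdBase Λ ⊔ sdSub U Λ hΛ = ⊤ := by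
  rw [eq_top_iff]
  intro g _
  have h : g = SemidirectProduct.inl g.left * SemidirectProduct.inr g.right :=
    (SemidirectProduct.inl_left_mul_inr_right g).symm
  rw [h]
  exact Subgroup.mul_mem_sup rfl U.one_mem

theorem sdBase_inf_sdSub :
    sdBase Λ ⊓ sdSub U Λ hΛ = (sdSubBase U Λ hΛ).map (sdSub U Λ hΛ).subtype := by
  ext g
  constructor
  · rintro ⟨h1, h2⟩
    exact ⟨⟨g, h2⟩, h1, rfl⟩
  · rintro ⟨h, h1, rfl⟩
    exact ⟨h1, h.2⟩

end Semidirect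

/-! ### The two J-triples in the semidirect product -/

section Triple

variable {X : Type*} [Group X] {U : Subgroup X} {J : Subgroup GalQab} {χ : X → ℂ} {μ : U → ℂ}

theorem exists_galAct_sdAct (hχ : IsIrrChar χ) (g : AutSemidirect (gammaOrbit U J χ)) :
    ∃ σ ∈ J, ∀ x, χ (sdAct _ g x) = galAct σ (χ x) := by
  obtain ⟨-, σ, hσ, h⟩ := g.right.2
  exact ⟨σ, hσ, fun x => by rw [sdAct_apply, hχ.conj]; exact h x⟩

theorem isGTriple_sdBase (hχ : IsIrrChar χ) :
    IsGTriple J (sdBase (gammaOrbit U J χ)) (sdBaseChar (gammaOrbit U J χ) χ) where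
  irr := hχ.comp_equiv (sdBaseEquiv _)
  orbit g := by
    obtain ⟨σ, hσ, h⟩ := exists_galAct_sdAct hχ g
    exact ⟨σ, hσ, fun n => by
      simp only [sdBaseChar, left_conjNormal_sdBase]; exact h _⟩

theorem stab_iff (hstab : pairStab (autStab U).subtype J χ = pairStab (autRestrict U) J μ)
    (g : sdSub U (gammaOrbit U J χ) (gammaOrbit_le U J χ)) {σ : GalQab} (hσ : σ ∈ J) :
    (∀ x, galAct σ (χ (sdAct _ (g : AutSemidirect (gammaOrbit U J χ)) x)) = χ x) ↔
      ∀ u, galAct σ (μ (autRestrict U (sdSubAct (gammaOrbit_le U J χ) g) u)) = μ u :=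
  pairStab_iff_of_comp hstab (sdSubAct (gammaOrbit_le U J χ)) g hσ

/-- The orbit condition is inherited from χ: if g moves χ to its conjugate under σ, then (g, σ⁻¹)
fixes χ and therefore μ. -/
theorem isGTriple_sdSubBase (hχ : IsIrrChar χ) (hμ : IsIrrChar μ)
    (hstab : pairStab (autStab U).subtype J χ = pairStab (autRestrict U) J μ) :
    IsGTriple J (sdSubBase U (gammaOrbit U J χ) (gammaOrbit_le U J χ))
      (sdSubBaseChar U (gammaOrbit U J χ) (gammaOrbit_le U J χ) μ) where
  irr := hμ.comp_equiv (sdSubBaseEquiv _)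
  orbit g := by
    obtain ⟨σ, hσ, h⟩ := exists_galAct_sdAct hχ (g : AutSemidirect (gammaOrbit U J χ))
    have h1 := (sdSubBase_stab_iff _ g _).mpr ((stab_iff hstab g (J.inv_mem hσ)).mp fun x => by
      rw [h, galAct_inv_self])
    refine ⟨σ, hσ, fun n => ?_⟩
    rw [← h1 n, ← galAct_mul, mul_inv_cancel, galAct_one]

theorem pairStab_sd_eq (hstab : pairStab (autStab U).subtype J χ = pairStab (autRestrict U) J μ) :
    pairStab ((MulAut.conjNormal : AutSemidirect (gammaOrbit U J χ) →* _).comp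
      (sdSub U (gammaOrbit U J χ) (gammaOrbit_le U J χ)).subtype) J
        (sdBaseChar (gammaOrbit U J χ) χ) =
    pairStab (MulAut.conjNormal : sdSub U (gammaOrbit U J χ) (gammaOrbit_le U J χ) →*
      MulAut (sdSubBase U (gammaOrbit U J χ) (gammaOrbit_le U J χ))) J
        (sdSubBaseChar U (gammaOrbit U J χ) (gammaOrbit_le U J χ) μ) := by
  ext ⟨g, σ⟩
  refine and_congr_right fun hσ => ?_
  refine (sdBase_stab_iff (g : AutSemidirect (gammaOrbit U J χ)) σ).trans ?_
  exact (stab_iff hstab g hσ).trans (sdSubBase_stab_iff _ g σ).symm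

end Triple

/-! ### From matrices over `ℚ^ab` to complex matrices -/

namespace Matrix.GeneralLinearGroup

theorem val_scalar_mul {k : Type*} [Field k] {d : ℕ} (z : kˣ) (A : GL (Fin d) k) :
    (scalar (Fin d) z * A).val = (z : k) • A.val := by
  rw [Units.val_mul, coe_scalar, Matrix.scalar_apply, ← Matrix.smul_one_eq_diagonal,
    Matrix.smul_mul, Matrix.one_mul]

section Proj

variable {T : Type*} {d : ℕ} {P : T → GL (Fin d) Qab}

theorem isProjRep_map [Group T] {α : T → T → (Qab)ˣ}
    (hα : ∀ g h, P (g * h) = scalar (Fin d) (α g h) * (P g * P h)) :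
    IsProjRep (fun g => map (algebraMap Qab ℂ) (P g))
      (fun g h => Units.map (algebraMap Qab ℂ : Qab →* ℂ) (α g h)) := by
  intro g h
  beta_reduce
  rw [hα, _root_.map_mul, _root_.map_mul, map_scalar, val_scalar_mul]
  rfl

theorem isCyclotomic_map {α : T → T → (Qab)ˣ} (hα : ∀ g h, IsOfFinOrder (α g h)) :
    IsCyclotomic (fun g => map (algebraMap Qab ℂ) (P g))
      (fun g h => Units.map (algebraMap Qab ℂ : Qab →* ℂ) (α g h)) where
  entries g i j := ((P g).val i j).2
  factors g h := by
    obtain ⟨n, hn, h1⟩ := isOfFinOrder_iff_pow_eq_one.mp (hα g h)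
    exact ⟨n, hn, by rw [← _root_.map_pow, h1, _root_.map_one]⟩

theorem exists_scalar_smul_one {x : T} {z : (Qab)ˣ} (h : P x = scalar (Fin d) z) :
    (map (algebraMap Qab ℂ) (P x)).val = ((z : Qab) : ℂ) • (1 : Matrix (Fin d) (Fin d) ℂ) := by
  have h1 := val_scalar_mul (Units.map (algebraMap Qab ℂ : Qab →* ℂ) z) (1 : GL (Fin d) ℂ)
  rw [mul_one] at h1
  rw [h, map_scalar, h1]
  rfl

end Proj

section Associated

variable {G : Type*} [Group G] {N : Subgroup G} [N.Normal] {θ : N → ℂ} {d : ℕ}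
  {P : inertia N θ → GL (Fin d) Qab}

theorem isAssociated_map (hP : IsProjExt (N.subgroupOf (inertia N θ)) P)
    (htr : ∀ (t : inertia N θ) (n : N), (t : G) = n → (((P t).val.trace : Qab) : ℂ) = θ n) :
    IsAssociated N θ (fun g => map (algebraMap Qab ℂ) (P g)) where
  affords g n h := by
    rw [← htr g n h]
    exact (AddMonoidHom.map_trace (algebraMap Qab ℂ) (P g).val).symm
  mul_left n g hn := by rw [hP.mul_left n hn, _root_.map_mul]
  mul_right g n hn := by rw [hP.mul_right g n hn, _root_.map_mul]

/-- Constancy on cosets of N comes from applying the similarity to a product nx and cancelling the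
part belonging to n. -/
theorem isTwistFun_map [NeZero d] (hP : IsProjExt (N.subgroupOf (inertia N θ)) P) {h : G}
    {σ : GalQab} (hh : ∀ n, galAct σ (θ (MulAut.conjNormal h n)) = θ n) {S : GL (Fin d) Qab}
    {ν : inertia N θ → (Qab)ˣ} (hν : ∀ x : inertia N θ, (x : G) ∈ N → ν x = 1)
    (hS : ∀ x y : inertia N θ, (y : G) = h * x * h⁻¹ →
      map ((σ : Qab ≃+* Qab) : Qab →+* Qab) (P y) = scalar (Fin d) (ν x) * (S * P x * S⁻¹)) :
    IsTwistFun N θ (fun g => map (algebraMap Qab ℂ) (P g)) h σ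
      (fun x => Units.map (algebraMap Qab ℂ : Qab →* ℂ) (ν x)) where
  one := by rw [hν 1 N.one_mem, _root_.map_one]
  const n x hn := by
    congr 1
    apply scalar_injective (d := d)
    let τ := (inertia N θ).conjEquiv h (conj_mem_charStab_iff hh)
    have hτ : τ n ∈ N.subgroupOf (inertia N θ) :=
      Subgroup.Normal.conj_mem (H := N) inferInstance _ hn h
    have h1 := hS (n * x) (τ (n * x)) rfl
    rw [_root_.map_mul, hP.mul_left _ hτ, _root_.map_mul, hS n (τ n) rfl, hS x (τ x) rfl, hν n hn,
      _root_.map_one, one_mul, hP.mul_left n hn, ← mul_assoc, ← scalar_commute] at h1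
    have e : S * (P n * P x) * S⁻¹ = S * P n * S⁻¹ * (S * P x * S⁻¹) := by group
    rw [e, mul_assoc] at h1
    exact (mul_right_cancel h1).symm
  similar := by
    refine ⟨map (algebraMap Qab ℂ) S, fun x y hy => ?_⟩
    have h1 := congrArg (fun B => (map (algebraMap Qab ℂ) B).val) (hS x y hy)
    have h2 : (map (algebraMap Qab ℂ) (map ((σ : Qab ≃+* Qab) : Qab →+* Qab) (P y))).val =
        (map (algebraMap Qab ℂ) (P y)).val.map (galAct σ) := by
      ext i j
      exact (galAct_coe σ ((P y).val i j)).symm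
    rw [← h2]
    refine h1.trans ?_
    rw [_root_.map_mul, map_scalar, val_scalar_mul, _root_.map_mul, _root_.map_mul, _root_.map_inv,
      Units.val_mul, Units.val_mul, Matrix.mul_smul, Matrix.smul_mul]

end Associated

/-- The projective representations required by the central order, from data over `ℚ^ab`. -/
theorem centralOrder_of_Qab {G : Type*} [Group G] {J : Subgroup GalQab} {N : Subgroup G} [N.Normal]
    {θ : N → ℂ} {H : Subgroup G} {M : Subgroup H} [M.Normal] {φ : M → ℂ}
    (triple : IsGTriple J N θ) (triple' : IsGTriple J M φ) (sup : N ⊔ H = ⊤)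
    (inf : N ⊓ H = M.map H.subtype) (cent : Subgroup.centralizer (N : Set G) ≤ H)
    (stab : pairStab ((MulAut.conjNormal : G →* MulAut N).comp H.subtype) J θ =
      pairStab (MulAut.conjNormal : H →* MulAut M) J φ)
    {d e : ℕ} [NeZero d] [NeZero e] {P : inertia N θ → GL (Fin d) Qab}
    {Q : inertia M φ → GL (Fin e) Qab} (hP : IsProjExt (N.subgroupOf (inertia N θ)) P)
    (hQ : IsProjExt (M.subgroupOf (inertia M φ)) Q)
    (hPtr : ∀ (t : inertia N θ) (n : N), (t : G) = n → (((P t).val.trace : Qab) : ℂ) = θ n)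
    (hQtr : ∀ (t : inertia M φ) (n : M), (t : H) = n → (((Q t).val.trace : Qab) : ℂ) = φ n)
    (factor : ∀ (x y : inertia N θ) (x' y' : inertia M φ), (x : G) = (x' : H) → (y : G) = (y' : H) →
      ∃ z : (Qab)ˣ, P (x * y) = scalar (Fin d) z * (P x * P y) ∧
        Q (x' * y') = scalar (Fin e) z * (Q x' * Q y'))
    (central : ∀ c ∈ Subgroup.centralizer (N : Set G), ∀ (x : inertia N θ) (x' : inertia M φ),
      (x : G) = c → ((x' : H) : G) = c →
        ∃ z : (Qab)ˣ, P x = scalar (Fin d) z ∧ Q x' = scalar (Fin e) z)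
    (twist : ∀ (h : H), ∀ σ ∈ J, (∀ n, galAct σ (θ (MulAut.conjNormal (h : G) n)) = θ n) →
      ∃ (S : GL (Fin d) Qab) (S' : GL (Fin e) Qab) (ν : inertia N θ → (Qab)ˣ)
        (ν' : inertia M φ → (Qab)ˣ),
        (∀ x : inertia N θ, (x : G) ∈ N → ν x = 1) ∧
        (∀ x : inertia M φ, (x : H) ∈ M → ν' x = 1) ∧
        (∀ x y : inertia N θ, (y : G) = h * x * (h : G)⁻¹ →
          map ((σ : Qab ≃+* Qab) : Qab →+* Qab) (P y) = scalar (Fin d) (ν x) * (S * P x * S⁻¹)) ∧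
        (∀ x y : inertia M φ, (y : H) = h * x * h⁻¹ →
          map ((σ : Qab ≃+* Qab) : Qab →+* Qab) (Q y) = scalar (Fin e) (ν' x) * (S' * Q x * S'⁻¹)) ∧
        ∀ (x : inertia N θ) (x' : inertia M φ), (x : G) = (x' : H) → ν x = ν' x') :
    CentralOrder J N θ H M φ := by
  refine ⟨triple, triple', sup, inf, cent, stab, ?_⟩
  choose α hα hPα using hP.factor
  choose α' hα' hQα' using hQ.factor
  refine ⟨d, e, _, _, _, _, isProjRep_map hPα, isAssociated_map hP hPtr, isCyclotomic_map hα,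
    isProjRep_map hQα', isAssociated_map hQ hQtr, isCyclotomic_map hα', ?_, ?_, ?_⟩
  · intro x y x' y' hx hy
    obtain ⟨z, h1, h2⟩ := factor x y x' y' hx hy
    -- The factor sets were chosen separately, but in nonzero degree each is determined by its
    -- projective representation.
    rw [hPα] at h1
    rw [hQα'] at h2
    rw [scalar_injective (mul_right_cancel h1), scalar_injective (mul_right_cancel h2)]
  · intro c hc x x' hx hx'
    obtain ⟨z, h1, h2⟩ := central c hc x x' hx hx'
    exact ⟨_, exists_scalar_smul_one h1, exists_scalar_smul_one h2⟩
  · intro h σ hhσ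
    obtain ⟨S, S', ν, ν', h1, h2, h3, h4, h5⟩ := twist h σ hhσ.1 hhσ.2
    have hhσ' := hhσ
    rw [stab] at hhσ'
    exact ⟨_, _, isTwistFun_map hP hhσ.2 h1 h3, isTwistFun_map hQ hhσ'.2 h2 h4,
      fun x x' hx => by rw [h5 x x' hx]⟩

end Matrix.GeneralLinearGroup

/-! ### Transfer to the semidirect product -/

namespace Matrix.GeneralLinearGroup

section Scalars

variable {k : Type*} [Field k] {d : ℕ} {T : Type*} [Group T] {N : Subgroup T} {P : T → GL (Fin d) k}

/-- Up to factor set values, which have finite order, P(cⁿ) is zⁿ, and some positive power of c is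
1. -/
theorem IsProjExt.isOfFinOrder_of_eq_scalar [Finite T] [NeZero d] (hP : IsProjExt N P) {c : T}
    {z : kˣ} (hc : P c = scalar (Fin d) z) : IsOfFinOrder z := by
  have hpow : ∀ n : ℕ, ∃ w : kˣ, IsOfFinOrder w ∧ P (c ^ n) = scalar (Fin d) (w * z ^ n) := by
    intro n
    induction n with
    | zero => exact ⟨1, IsOfFinOrder.one, by simp [hP.map_one]⟩
    | succ n ih =>
      obtain ⟨w, hw, h⟩ := ih
      obtain ⟨a, ha, h'⟩ := hP.factor (c ^ n) c
      refine ⟨a * w, ha.mul hw, ?_⟩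
      rw [pow_succ, h', h, hc, ← _root_.map_mul, ← _root_.map_mul, pow_succ]
      simp only [mul_assoc]
  obtain ⟨w, hw, h⟩ := hpow (Nat.card T)
  rw [pow_card_eq_one', hP.map_one, ← _root_.map_one (scalar (Fin d))] at h
  have h1 := eq_inv_of_mul_eq_one_right (scalar_injective h).symm
  exact (h1 ▸ hw.inv : IsOfFinOrder (z ^ Nat.card T)).of_pow Nat.card_pos.ne'

theorem mul_scalar_eq {a z : kˣ} {B C D : GL (Fin d) k} (hC : C = scalar (Fin d) z)
    (hD : D = scalar (Fin d) a * (B * C)) : D = scalar (Fin d) (a * z) * B := by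
  rw [hD, hC, ← scalar_commute, ← mul_assoc, _root_.map_mul]

end Scalars

theorem inv_mul_mem_centralizer {G : Type*} [Group G] {X : Subgroup G} [X.Normal] {a b : G}
    (h : (MulAut.conjNormal a : MulAut X) = MulAut.conjNormal b) :
    a⁻¹ * b ∈ Subgroup.centralizer (X : Set G) := by
  rw [Subgroup.mem_centralizer_iff]
  intro x hx
  have h1 := congrArg Subtype.val (DFunLike.congr_fun h ⟨x, hx⟩)
  rw [MulAut.conjNormal_apply, MulAut.conjNormal_apply] at h1
  have h2 : x = a⁻¹ * b * x * (a⁻¹ * b)⁻¹ := by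
    calc x = a⁻¹ * (a * x * a⁻¹) * a := by group
      _ = a⁻¹ * (b * x * b⁻¹) * a := by rw [h1]
      _ = _ := by group
  conv_lhs => rw [h2]
  rw [inv_mul_cancel_right]

namespace IsMatchedPair

variable {G : Type*} [Group G] [Finite G] {X : Subgroup G} [X.Normal] {J : Subgroup GalQab}
  {χ : X → ℂ} {U : Subgroup X} {μ : U → ℂ} {d e : ℕ} {P : inertia X χ → GL (Fin d) Qab}
  {Q : charStab (normInAct X U) μ → GL (Fin e) Qab}

omit [Finite G] in
theorem exists_lift_of_mem_centralizer (h : IsMatchedPair X J χ U μ P Q) {c : inertia X χ}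
    (hc : (c : G) ∈ Subgroup.centralizer (X : Set G)) :
    ∃ c' : charStab (normInAct X U) μ, (c : G) = (c' : normIn X U) := by
  have h1 : (MulAut.conjNormal (c : G) : MulAut X) = 1 := by
    ext x
    rw [MulAut.conjNormal_apply, ← Subgroup.mem_centralizer_iff.mp hc x x.2, mul_inv_cancel_right]
    rfl
  have h2 : (c : G) ∈ normIn X U := by
    change MulAut.conjNormal (c : G) ∈ autStab U
    rw [h1]; exact (autStab U).one_mem
  exact ⟨⟨⟨c, h2⟩, (h.mem_iff ⟨c, h2⟩).mp c.2⟩, rfl⟩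

/-- Elements with the same action on `X` are sent to scalar multiples. -/
theorem exists_scalar_mul (h : IsMatchedPair X J χ U μ P Q) {a b : inertia X χ}
    (hab : (MulAut.conjNormal (a : G) : MulAut X) = MulAut.conjNormal (b : G)) :
    ∃ z : (Qab)ˣ, IsOfFinOrder z ∧ P b = scalar (Fin d) z * P a := by
  have : NeZero d := ⟨h.left_ne_zero⟩
  have hc : ((a⁻¹ * b : inertia X χ) : G) ∈ Subgroup.centralizer (X : Set G) :=
    inv_mul_mem_centralizer hab
  obtain ⟨c', hc'⟩ := h.exists_lift_of_mem_centralizer hc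
  obtain ⟨z, hz, -⟩ := h.central c' _ hc' hc
  obtain ⟨w, hw, hw'⟩ := h.left.factor a (a⁻¹ * b)
  rw [mul_inv_cancel_left] at hw'
  exact ⟨w * z, hw.mul (h.left.isOfFinOrder_of_eq_scalar hz), mul_scalar_eq hz hw'⟩

/-- The quotient of the two elements centralizes X, where P and Q are the same scalar, and the
factor sets agree as well. Hence replacing one lift by another changes P and Q by a common scalar.
-/
theorem exists_scalar_mul_pair (h : IsMatchedPair X J χ U μ P Q) {a b : charStab (normInAct X U) μ}
    {a' b' : inertia X χ} (ha : (a' : G) = (a : normIn X U)) (hb : (b' : G) = (b : normIn X U))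
    (hab : (MulAut.conjNormal (a' : G) : MulAut X) = MulAut.conjNormal (b' : G)) :
    ∃ z : (Qab)ˣ, IsOfFinOrder z ∧ P b' = scalar (Fin d) z * P a' ∧
      Q b = scalar (Fin e) z * Q a := by
  have : NeZero d := ⟨h.left_ne_zero⟩
  have hc : ((a'⁻¹ * b' : inertia X χ) : G) ∈ Subgroup.centralizer (X : Set G) :=
    inv_mul_mem_centralizer hab
  have hc' : ((a'⁻¹ * b' : inertia X χ) : G) =
      ((a⁻¹ * b : charStab (normInAct X U) μ) : normIn X U) := by
    rw [Subgroup.coe_mul, Subgroup.coe_inv, ha, hb]; rfl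
  obtain ⟨z, hz, hz'⟩ := h.central _ _ hc' hc
  obtain ⟨w, hw, hw1, hw2⟩ := h.factor a (a⁻¹ * b) a' (a'⁻¹ * b') ha hc'
  rw [mul_inv_cancel_left] at hw1 hw2
  exact ⟨w * z, hw.mul (h.left.isOfFinOrder_of_eq_scalar hz), mul_scalar_eq hz hw1,
    mul_scalar_eq hz' hw2⟩

end IsMatchedPair

end Matrix.GeneralLinearGroup

/-! ### Lifting the semidirect product to the overgroup -/

section Lift

variable {G : Type*} [Group G] {X : Subgroup G} [X.Normal]

/-- A lift of `X ⋊ Λ` to a group that induces all automorphisms in `Λ` on `X`. -/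
structure IsLift (Λ : Subgroup (MulAut X)) (t : AutSemidirect Λ → G) : Prop where
  conj : ∀ g, MulAut.conjNormal (t g) = sdAct Λ g
  mul_left : ∀ n ∈ sdBase Λ, ∀ g, t (n * g) = n.left * t g
  base : ∀ n ∈ sdBase Λ, t n = n.left

theorem exists_isLift {Λ : Subgroup (MulAut X)}
    (hΛ : ∀ γ ∈ Λ, ∃ g : G, (MulAut.conjNormal g : MulAut X) = γ) :
    ∃ t : AutSemidirect Λ → G, IsLift Λ t := by
  -- Lifting the trivial automorphism to 1 makes the lift the identity on X.
  have h1 : ∀ γ : Λ, ∃ g : G, (MulAut.conjNormal g : MulAut X) = γ ∧ (γ = 1 → g = 1) := by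
    intro γ
    by_cases h : γ = 1
    · exact ⟨1, by rw [h, map_one]; rfl, fun _ => rfl⟩
    · obtain ⟨g, hg⟩ := hΛ γ γ.2
      exact ⟨g, hg, fun h' => absurd h' h⟩
  choose δ hδ hδ1 using h1
  refine ⟨fun g => (g.left : G) * δ g.right, fun g => ?_, fun n hn g => ?_, fun n hn => ?_⟩
  · rw [map_mul, hδ, sdAct_eq]
    congr 1
    ext x
    simp
  · have hr := right_eq_one_of_mem_sdBase hn
    rw [SemidirectProduct.mul_left, SemidirectProduct.mul_right, hr, one_mul, map_one,
      MulAut.one_apply, Subgroup.coe_mul, mul_assoc]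
  · rw [right_eq_one_of_mem_sdBase hn, hδ1 1 rfl, mul_one]

namespace IsLift

variable {Λ : Subgroup (MulAut X)} {t : AutSemidirect Λ → G} (ht : IsLift Λ t) {U : Subgroup X}
  {χ : X → ℂ} {μ : U → ℂ} (hΛ : Λ ≤ autStab U)

include ht

theorem conj_mul (g h : AutSemidirect Λ) :
    (MulAut.conjNormal (t g * t h) : MulAut X) = MulAut.conjNormal (t (g * h)) := by
  rw [map_mul, ht.conj, ht.conj, ht.conj, map_mul]

theorem conj_conj (g h : AutSemidirect Λ) :
    (MulAut.conjNormal (t g * t h * (t g)⁻¹) : MulAut X) = MulAut.conjNormal (t (g * h * g⁻¹)) := by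
  rw [map_mul, map_mul, map_inv, ht.conj, ht.conj, ht.conj, map_mul, map_mul, map_inv]

theorem mem_inertia {g : AutSemidirect Λ} (hg : g ∈ inertia (sdBase Λ) (sdBaseChar Λ χ)) :
    t g ∈ inertia X χ := by
  intro x
  rw [ht.conj]
  exact (mem_inertia_sdBase_iff g).mp hg x

theorem mem_normIn {g : AutSemidirect Λ} (hg : g ∈ sdSub U Λ hΛ) : t g ∈ normIn X U := by
  change MulAut.conjNormal (t g) ∈ autStab U
  rw [ht.conj]
  exact sdAct_mem_autStab hΛ hg

theorem mem_charStab {g : sdSub U Λ hΛ}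
    (hg : g ∈ inertia (sdSubBase U Λ hΛ) (sdSubBaseChar U Λ hΛ μ)) :
    (⟨t g, ht.mem_normIn hΛ g.2⟩ : normIn X U) ∈ charStab (normInAct X U) μ := by
  intro u
  rw [← (mem_inertia_sdSubBase_iff hΛ g).mp hg u]
  congr 1
  apply Subtype.ext
  exact DFunLike.congr_fun (ht.conj g) (u : X)

/-- The lift is not a homomorphism, but it respects the action on X, so compatibility with X passes
from left to right by conjugation. -/
theorem mul_right {n g : AutSemidirect Λ} (hn : n ∈ sdBase Λ) : t (g * n) = t g * t n := by
  have h1 : g * n * g⁻¹ ∈ sdBase Λ := Subgroup.Normal.conj_mem inferInstance n hn g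
  have h2 := ht.mul_left _ h1 g
  rw [inv_mul_cancel_right] at h2
  rw [h2, ht.base n hn]
  have h3 : (g * n * g⁻¹).left = sdAct Λ g n.left := left_conjNormal_sdBase g ⟨n, hn⟩
  rw [h3, ← ht.conj, MulAut.conjNormal_apply, inv_mul_cancel_right]

theorem conj_base {n g : AutSemidirect Λ} (hn : n ∈ sdBase Λ) :
    t (g * n * g⁻¹) = t g * t n * (t g)⁻¹ := by
  have h1 : g * n * g⁻¹ ∈ sdBase Λ := Subgroup.Normal.conj_mem inferInstance n hn g
  have h3 : (g * n * g⁻¹).left = sdAct Λ g n.left := left_conjNormal_sdBase g ⟨n, hn⟩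
  rw [ht.base _ h1, h3, ← ht.conj, MulAut.conjNormal_apply, ht.base n hn]

end IsLift

end Lift

/-! ### Pulling back matched extensions along a lift -/

namespace Matrix.GeneralLinearGroup

variable {G : Type*} [Group G] [Finite G] {X : Subgroup G} [X.Normal] {J : Subgroup GalQab}
  {χ : X → ℂ} {U : Subgroup X} {μ : U → ℂ} {d e : ℕ} {P : inertia X χ → GL (Fin d) Qab}
  {Q : charStab (normInAct X U) μ → GL (Fin e) Qab} {Λ : Subgroup (MulAut X)}
  {t : AutSemidirect Λ → G}

/-- The projective extension of `χ` to its stabilizer in `X ⋊ Λ` obtained from a lift. -/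
def liftLeft (ht : IsLift Λ t) (P : inertia X χ → GL (Fin d) Qab) :
    inertia (sdBase Λ) (sdBaseChar Λ χ) → GL (Fin d) Qab :=
  fun g => P ⟨t g, ht.mem_inertia g.2⟩

/-- The projective extension of `μ` to its stabilizer in `U ⋊ Λ` obtained from a lift. -/
def liftRight (ht : IsLift Λ t) (hΛ : Λ ≤ autStab U)
    (Q : charStab (normInAct X U) μ → GL (Fin e) Qab) :
    inertia (sdSubBase U Λ hΛ) (sdSubBaseChar U Λ hΛ μ) → GL (Fin e) Qab :=
  fun g => Q ⟨⟨t (g : sdSub U Λ hΛ), ht.mem_normIn hΛ (g : sdSub U Λ hΛ).2⟩, ht.mem_charStab hΛ g.2⟩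

theorem scalar_mul_of_mul {k : Type*} [Field k] {n : ℕ} {a z : kˣ} {A B C D : GL (Fin n) k}
    (h1 : A = scalar (Fin n) a * B) (h2 : B = scalar (Fin n) z * (C * D)) :
    A = scalar (Fin n) (a * z) * (C * D) := by
  rw [h1, h2, _root_.map_mul, mul_assoc]

theorem map_scalar_mul_of_map {k : Type*} [Field k] {n : ℕ} {f : k →+* k} {w ν : kˣ}
    {A B C : GL (Fin n) k} (h1 : B = scalar (Fin n) w * A)
    (h2 : map f A = scalar (Fin n) ν * C) :
    map f B = scalar (Fin n) (Units.map (f : k →* k) w * ν) * C := by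
  rw [h1, _root_.map_mul, h2, map_scalar, _root_.map_mul, mul_assoc]

theorem isProjExt_liftLeft (h : IsMatchedPair X J χ U μ P Q) (ht : IsLift Λ t) :
    IsProjExt ((sdBase Λ).subgroupOf (inertia (sdBase Λ) (sdBaseChar Λ χ))) (liftLeft ht P) where
  mul_left n hn g := by
    have hn' : (n : AutSemidirect Λ) ∈ sdBase Λ := hn
    have hX : t n ∈ X := by rw [ht.base _ hn']; exact SetLike.coe_mem _
    rw [liftLeft, liftLeft, liftLeft, ← h.left.mul_left _ hX]
    congr 1
    apply Subtype.ext
    change t (n * g) = t n * t g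
    rw [ht.mul_left _ hn', ht.base _ hn']
  mul_right g n hn := by
    have hn' : (n : AutSemidirect Λ) ∈ sdBase Λ := hn
    have hX : t n ∈ X := by rw [ht.base _ hn']; exact SetLike.coe_mem _
    rw [liftLeft, liftLeft, liftLeft, ← h.left.mul_right _ _ hX]
    congr 1
    exact Subtype.ext (ht.mul_right hn')
  factor g g' := by
    obtain ⟨w, hw, hw'⟩ := h.left.factor ⟨t g, ht.mem_inertia g.2⟩ ⟨t g', ht.mem_inertia g'.2⟩
    obtain ⟨z, hz, hz'⟩ := h.exists_scalar_mul
      (a := ⟨t g, ht.mem_inertia g.2⟩ * ⟨t g', ht.mem_inertia g'.2⟩)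
      (b := ⟨t (g * g' : inertia (sdBase Λ) (sdBaseChar Λ χ)), ht.mem_inertia (g * g').2⟩)
      (ht.conj_mul g g')
    exact ⟨z * w, hz.mul hw, scalar_mul_of_mul hz' hw'⟩

section

variable (hΛ : Λ ≤ autStab U)

/-- t(x)t(y) and t(xy) act alike on X, so replacing one by the other costs the same scalar on both
sides. -/
theorem exists_factor_lift (h : IsMatchedPair X J χ U μ P Q) (ht : IsLift Λ t)
    (x y : inertia (sdBase Λ) (sdBaseChar Λ χ))
    (x' y' : inertia (sdSubBase U Λ hΛ) (sdSubBaseChar U Λ hΛ μ))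
    (hx : (x : AutSemidirect Λ) = (x' : sdSub U Λ hΛ))
    (hy : (y : AutSemidirect Λ) = (y' : sdSub U Λ hΛ)) :
    ∃ z : (Qab)ˣ, IsOfFinOrder z ∧
      liftLeft ht P (x * y) = scalar (Fin d) z * (liftLeft ht P x * liftLeft ht P y) ∧
      liftRight ht hΛ Q (x' * y') =
        scalar (Fin e) z * (liftRight ht hΛ Q x' * liftRight ht hΛ Q y') := by
  let f : inertia (sdSubBase U Λ hΛ) (sdSubBaseChar U Λ hΛ μ) → charStab (normInAct X U) μ :=
    fun g => ⟨⟨t (g : sdSub U Λ hΛ), ht.mem_normIn hΛ (g : sdSub U Λ hΛ).2⟩, ht.mem_charStab hΛ g.2⟩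
  obtain ⟨w, hw, hw1, hw2⟩ := h.factor (f x') (f y') ⟨t x, ht.mem_inertia x.2⟩
    ⟨t y, ht.mem_inertia y.2⟩ (congrArg t hx) (congrArg t hy)
  obtain ⟨z, hz, hz1, hz2⟩ := h.exists_scalar_mul_pair (a := f x' * f y') (b := f (x' * y'))
    (a' := ⟨t x, ht.mem_inertia x.2⟩ * ⟨t y, ht.mem_inertia y.2⟩)
    (b' := ⟨t (x * y : inertia (sdBase Λ) (sdBaseChar Λ χ)), ht.mem_inertia (x * y).2⟩)
    (congrArg₂ (fun a b => t a * t b) hx hy) (congrArg₂ (fun a b => t (a * b)) hx hy)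
    (ht.conj_mul x y)
  exact ⟨z * w, hz.mul hw, scalar_mul_of_mul hz1 hw1, scalar_mul_of_mul hz2 hw2⟩

omit [Finite G] in
theorem mem_baseIn_of_mem_sdSubBase (ht : IsLift Λ t)
    (g : inertia (sdSubBase U Λ hΛ) (sdSubBaseChar U Λ hΛ μ))
    (hg : (g : sdSub U Λ hΛ) ∈ sdSubBase U Λ hΛ) :
    (⟨⟨t (g : sdSub U Λ hΛ), ht.mem_normIn hΛ (g : sdSub U Λ hΛ).2⟩, ht.mem_charStab hΛ g.2⟩ :
      charStab (normInAct X U) μ) ∈ baseIn X U μ :=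
  ⟨((g : sdSub U Λ hΛ) : AutSemidirect Λ).left, (g : sdSub U Λ hΛ).2, (ht.base _ hg).symm⟩

theorem isProjExt_liftRight (h : IsMatchedPair X J χ U μ P Q) (ht : IsLift Λ t)
    (hin : ∀ g : sdSub U Λ hΛ, g ∈ inertia (sdSubBase U Λ hΛ) (sdSubBaseChar U Λ hΛ μ) →
      (g : AutSemidirect Λ) ∈ inertia (sdBase Λ) (sdBaseChar Λ χ)) :
    IsProjExt ((sdSubBase U Λ hΛ).subgroupOf (inertia (sdSubBase U Λ hΛ) (sdSubBaseChar U Λ hΛ μ)))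
      (liftRight ht hΛ Q) where
  mul_left n hn g := by
    have hn' : ((n : sdSub U Λ hΛ) : AutSemidirect Λ) ∈ sdBase Λ := hn
    rw [liftRight, liftRight, liftRight,
      ← h.right.mul_left _ (mem_baseIn_of_mem_sdSubBase hΛ ht n hn)]
    congr 1
    apply Subtype.ext
    apply Subtype.ext
    change t ((n : sdSub U Λ hΛ) * (g : sdSub U Λ hΛ)) = t (n : sdSub U Λ hΛ) * t (g : sdSub U Λ hΛ)
    rw [ht.mul_left _ hn', ht.base _ hn']
  mul_right g n hn := by
    have hn' : ((n : sdSub U Λ hΛ) : AutSemidirect Λ) ∈ sdBase Λ := hn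
    rw [liftRight, liftRight, liftRight,
      ← h.right.mul_right _ _ (mem_baseIn_of_mem_sdSubBase hΛ ht n hn)]
    congr 1
    apply Subtype.ext
    apply Subtype.ext
    exact ht.mul_right hn'
  factor g g' := by
    obtain ⟨z, hz, -, h2⟩ := exists_factor_lift hΛ h ht ⟨_, hin g g.2⟩ ⟨_, hin g' g'.2⟩ g g' rfl rfl
    exact ⟨z, hz, h2⟩

/-- The twist functions are those in the overgroup, corrected by the failure of the lift to commute
with conjugation by g. The correction is common to both sides. -/
theorem exists_twist_lift (h : IsMatchedPair X J χ U μ P Q) (ht : IsLift Λ t)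
    (hin : ∀ g : sdSub U Λ hΛ, g ∈ inertia (sdSubBase U Λ hΛ) (sdSubBaseChar U Λ hΛ μ) ↔
      (g : AutSemidirect Λ) ∈ inertia (sdBase Λ) (sdBaseChar Λ χ))
    (g : sdSub U Λ hΛ) (σ : GalQab) (hσ : σ ∈ J)
    (hχ : ∀ n, galAct σ (sdBaseChar Λ χ (MulAut.conjNormal (g : AutSemidirect Λ) n)) =
      sdBaseChar Λ χ n)
    (hμ : ∀ n, galAct σ (sdSubBaseChar U Λ hΛ μ (MulAut.conjNormal g n)) =
      sdSubBaseChar U Λ hΛ μ n) :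
    ∃ (S : GL (Fin d) Qab) (S' : GL (Fin e) Qab)
      (ν : inertia (sdBase Λ) (sdBaseChar Λ χ) → (Qab)ˣ)
      (ν' : inertia (sdSubBase U Λ hΛ) (sdSubBaseChar U Λ hΛ μ) → (Qab)ˣ),
      (∀ x : inertia (sdBase Λ) (sdBaseChar Λ χ), (x : AutSemidirect Λ) ∈ sdBase Λ → ν x = 1) ∧
      (∀ x : inertia (sdSubBase U Λ hΛ) (sdSubBaseChar U Λ hΛ μ),
        (x : sdSub U Λ hΛ) ∈ sdSubBase U Λ hΛ → ν' x = 1) ∧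
      (∀ x y : inertia (sdBase Λ) (sdBaseChar Λ χ),
        (y : AutSemidirect Λ) = g * x * (g : AutSemidirect Λ)⁻¹ →
        map ((σ : Qab ≃+* Qab) : Qab →+* Qab) (liftLeft ht P y) =
          scalar (Fin d) (ν x) * (S * liftLeft ht P x * S⁻¹)) ∧
      (∀ x y : inertia (sdSubBase U Λ hΛ) (sdSubBaseChar U Λ hΛ μ),
        (y : sdSub U Λ hΛ) = g * x * g⁻¹ →
        map ((σ : Qab ≃+* Qab) : Qab →+* Qab) (liftRight ht hΛ Q y) =
          scalar (Fin e) (ν' x) * (S' * liftRight ht hΛ Q x * S'⁻¹)) ∧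
      ∀ (x : inertia (sdBase Λ) (sdBaseChar Λ χ))
        (x' : inertia (sdSubBase U Λ hΛ) (sdSubBaseChar U Λ hΛ μ)),
        (x : AutSemidirect Λ) = (x' : sdSub U Λ hΛ) → ν x = ν' x' := by
  have : NeZero d := ⟨h.left_ne_zero⟩
  let h₀ : normIn X U := ⟨t g, ht.mem_normIn hΛ g.2⟩
  have hχ₀ : ∀ x, galAct σ (χ (MulAut.conjNormal (h₀ : G) x)) = χ x := by
    intro x
    rw [ht.conj]
    exact (sdBase_stab_iff _ σ).mp hχ x
  have hμ₀ : ∀ u, galAct σ (μ (normInAct X U h₀ u)) = μ u := by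
    intro u
    rw [← (sdSubBase_stab_iff hΛ g σ).mp hμ u]
    congr 2
    apply Subtype.ext
    exact DFunLike.congr_fun (ht.conj g) (u : X)
  obtain ⟨S, S', ν₀, ν₀', hν₀, hν₀', hS, hS', hν⟩ := h.twist h₀ σ hσ hχ₀
  have hT := conj_mem_charStab_iff hχ₀
  have hT' := conj_mem_charStab_iff hμ₀
  have hB := conj_mem_charStab_iff hχ
  have hB' := conj_mem_charStab_iff hμ
  let f : inertia (sdBase Λ) (sdBaseChar Λ χ) → inertia X χ := fun x => ⟨t x, ht.mem_inertia x.2⟩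
  let f' : inertia (sdSubBase U Λ hΛ) (sdSubBaseChar U Λ hΛ μ) → charStab (normInAct X U) μ :=
    fun x => ⟨⟨t (x : sdSub U Λ hΛ), ht.mem_normIn hΛ (x : sdSub U Λ hΛ).2⟩, ht.mem_charStab hΛ x.2⟩
  -- Compares t(gxg⁻¹) with t(g)t(x)t(g)⁻¹, which induce the same automorphism of X.
  have hw : ∀ x, ∃ z : (Qab)ˣ, P (f ((inertia (sdBase Λ) (sdBaseChar Λ χ)).conjEquiv g.val hB x)) =
      scalar (Fin d) z * P ((inertia X χ).conjEquiv (h₀ : G) hT (f x)) := fun x => by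
    obtain ⟨z, -, hz⟩ := h.exists_scalar_mul
      (a := (inertia X χ).conjEquiv (h₀ : G) hT (f x))
      (b := f ((inertia (sdBase Λ) (sdBaseChar Λ χ)).conjEquiv g.val hB x)) (ht.conj_conj g x)
    exact ⟨z, hz⟩
  choose w hw using hw
  refine ⟨S, S', fun x => Units.map ((σ : Qab ≃+* Qab) : Qab →+* Qab) (w x) * ν₀ (f x),
    fun x => Units.map ((σ : Qab ≃+* Qab) : Qab →+* Qab) (w ⟨_, (hin x).mp x.2⟩) * ν₀' (f' x),
    ?_, ?_, ?_, ?_, ?_⟩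
  · intro x hx
    have h1 : t x ∈ X := by rw [ht.base _ hx]; exact SetLike.coe_mem _
    have h2 : f ((inertia (sdBase Λ) (sdBaseChar Λ χ)).conjEquiv g.val hB x) =
        (inertia X χ).conjEquiv (h₀ : G) hT (f x) := Subtype.ext (ht.conj_base hx)
    have h3 := hw x
    rw [h2, right_eq_mul, ← _root_.map_one (scalar (Fin d))] at h3
    beta_reduce
    rw [scalar_injective h3, hν₀ _ h1, _root_.map_one, mul_one]
  · intro x hx
    have h2 : f ((inertia (sdBase Λ) (sdBaseChar Λ χ)).conjEquiv g.val hB ⟨_, (hin x).mp x.2⟩) =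
        (inertia X χ).conjEquiv (h₀ : G) hT (f ⟨_, (hin x).mp x.2⟩) := Subtype.ext (ht.conj_base hx)
    have h3 := hw ⟨_, (hin x).mp x.2⟩
    rw [h2, right_eq_mul, ← _root_.map_one (scalar (Fin d))] at h3
    beta_reduce
    rw [scalar_injective h3, hν₀' _ (mem_baseIn_of_mem_sdSubBase hΛ ht x hx), _root_.map_one, mul_one]
  · intro x y hy
    have h1 : y = (inertia (sdBase Λ) (sdBaseChar Λ χ)).conjEquiv g.val hB x := Subtype.ext hy
    have h2 := hS (f x) ((inertia X χ).conjEquiv (h₀ : G) hT (f x)) rfl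
    subst h1
    exact map_scalar_mul_of_map (hw x) h2
  · intro x y hy
    have h1 : y = (inertia (sdSubBase U Λ hΛ) (sdSubBaseChar U Λ hΛ μ)).conjEquiv g hB' x :=
      Subtype.ext hy
    have h2 := hS' (f' x) ((charStab (normInAct X U) μ).conjEquiv h₀ hT' (f' x)) rfl
    subst h1
    obtain ⟨z, -, hz, hz'⟩ := h.exists_scalar_mul_pair
      (a := (charStab (normInAct X U) μ).conjEquiv h₀ hT' (f' x))
      (b := f' ((inertia (sdSubBase U Λ hΛ) (sdSubBaseChar U Λ hΛ μ)).conjEquiv g hB' x))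
      (a' := (inertia X χ).conjEquiv (h₀ : G) hT (f ⟨_, (hin x).mp x.2⟩))
      (b' := f ((inertia (sdBase Λ) (sdBaseChar Λ χ)).conjEquiv g.val hB ⟨_, (hin x).mp x.2⟩))
      rfl rfl (ht.conj_conj g (x : sdSub U Λ hΛ))
    -- The scalar obtained for the pair is identified with the one already chosen for P, so the same
    -- correction serves Q.
    rw [hw, mul_left_inj] at hz
    rw [← scalar_injective hz] at hz'
    exact map_scalar_mul_of_map hz' h2
  · intro x x' hx
    have h1 : x = ⟨_, (hin x').mp x'.2⟩ := Subtype.ext hx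
    subst h1
    beta_reduce
    rw [hν (f' x') (f ⟨_, (hin x').mp x'.2⟩) rfl]

end

end Matrix.GeneralLinearGroup

namespace Matrix.GeneralLinearGroup

variable {G : Type*} [Group G] {X : Subgroup G} [X.Normal] {J : Subgroup GalQab}
  {χ : X → ℂ} {U : Subgroup X} {μ : U → ℂ} {d e : ℕ} {P : inertia X χ → GL (Fin d) Qab}
  {Q : charStab (normInAct X U) μ → GL (Fin e) Qab} {Λ : Subgroup (MulAut X)}
  {t : AutSemidirect Λ → G}

theorem trace_liftLeft (h : IsMatchedPair X J χ U μ P Q) (ht : IsLift Λ t)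
    (g : inertia (sdBase Λ) (sdBaseChar Λ χ)) (n : sdBase Λ) (hg : (g : AutSemidirect Λ) = n) :
    (((liftLeft ht P g).val.trace : Qab) : ℂ) = sdBaseChar Λ χ n :=
  h.trace_left _ (n : AutSemidirect Λ).left ((congrArg t hg).trans (ht.base _ n.2))

theorem trace_liftRight (hΛ : Λ ≤ autStab U) (h : IsMatchedPair X J χ U μ P Q) (ht : IsLift Λ t)
    (g : inertia (sdSubBase U Λ hΛ) (sdSubBaseChar U Λ hΛ μ)) (n : sdSubBase U Λ hΛ)
    (hg : (g : sdSub U Λ hΛ) = n) :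
    (((liftRight ht hΛ Q g).val.trace : Qab) : ℂ) = sdSubBaseChar U Λ hΛ μ n :=
  h.trace_right _ ⟨((n : sdSub U Λ hΛ) : AutSemidirect Λ).left, (n : sdSub U Λ hΛ).2⟩
    ((congrArg (fun x : sdSub U Λ hΛ => t x) hg).trans (ht.base _ n.2))

theorem exists_lift_eq_scalar (hΛ : Λ ≤ autStab U) (h : IsMatchedPair X J χ U μ P Q)
    (ht : IsLift Λ t) {c : AutSemidirect Λ}
    (hc : c ∈ Subgroup.centralizer (sdBase Λ : Set (AutSemidirect Λ)))
    (x : inertia (sdBase Λ) (sdBaseChar Λ χ))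
    (x' : inertia (sdSubBase U Λ hΛ) (sdSubBaseChar U Λ hΛ μ)) (hx : (x : AutSemidirect Λ) = c)
    (hx' : ((x' : sdSub U Λ hΛ) : AutSemidirect Λ) = c) :
    ∃ z : (Qab)ˣ, liftLeft ht P x = scalar (Fin d) z ∧ liftRight ht hΛ Q x' = scalar (Fin e) z := by
  refine h.central _ ⟨t x, ht.mem_inertia x.2⟩ (congrArg t (hx.trans hx'.symm)) ?_
  have h1 : (MulAut.conjNormal (1 : G) : MulAut X) = MulAut.conjNormal (t x) := by
    rw [ht.conj, hx, sdAct_eq_one_of_mem_centralizer hc, _root_.map_one]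
  have h2 := inv_mul_mem_centralizer h1
  rwa [inv_one, one_mul] at h2

end Matrix.GeneralLinearGroup

end

theorem mainTheorem4
    {S G : Type u} [Group S] [Finite S] [IsSimpleGroup S] (hS : ∃ a b : S, a * b ≠ b * a)
    -- the ambient finite group `G` is `Σ`
    [Group G] [Finite G]
    (X : Subgroup G) [X.Normal] (hX : IsUniversalCoveringGroup X S)
    (J : Subgroup GalQab)
    (χ : X → ℂ) (hχ : IsIrrChar χ)
    (U : Subgroup X) (hU : U < ⊤) (hUnorm : Subgroup.normalizer (U : Set X) = U)
    (hUintra : IsIntravariant U)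
    (μ : U → ℂ) (hμ : IsIrrChar μ)
    -- `(Γ × J)_χ = (Γ × J)_μ` for `Γ = Aut(X)_U`
    (hstab : pairStab (autStab U).subtype J χ = pairStab (autRestrict U) J μ)
    -- `Δ = N_Σ(U)` induces `Γ_{χ^J}` on `X`
    (hinduce : (normIn X U).map (MulAut.conjNormal : G →* MulAut X) = gammaOrbit U J χ)
    -- `K/X` is a normal `p`-complement of `Σ/X`
    (p : ℕ) (hp : p.Prime)
    (K : Subgroup G) [K.Normal] (hXK : X ≤ K)
    (hKX : (X.relIndex K).Coprime p) (hK : ∃ n : ℕ, K.index = p ^ n)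
    (hcent : Subgroup.centralizer (X : Set G) ≤ Subgroup.centralizer (stabIn X K χ : Set G))
    -- the extension `χ*` of `χ` to `K_χ`; the normality is part of `(Σ, K_χ, χ*)` being a triple
    [(stabIn X K χ).Normal] (χs : stabIn X K χ → ℂ) (hχs : IsGTriple J (stabIn X K χ) χs)
    (hχs_ext : ∀ (y : stabIn X K χ) (x : X), (y : G) = x → χs y = χ x)
    (hχs_stab :
      pairStab ((MulAut.conjNormal : G →* MulAut X).comp (normIn X U).subtype) J χ =
      pairStab ((MulAut.conjNormal : G →* MulAut (stabIn X K χ)).comp (normIn X U).subtype) J χs)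
    -- the extension `μ*` of `μ` to `K ∩ Δ_μ`; again `K ∩ Δ_μ ⊴ Δ` is part of the triple
    [(stabInNorm X U K μ).Normal] (μs : stabInNorm X U K μ → ℂ)
    (hμs : IsGTriple J (stabInNorm X U K μ) μs)
    (hμs_ext : ∀ (y : stabInNorm X U K μ) (u : U),
      ((y : normIn X U) : G) = ((u : X) : G) → μs y = μ u)
    (hμs_stab : pairStab (normInAct X U) J μ =
      pairStab (MulAut.conjNormal : normIn X U →* MulAut (stabInNorm X U K μ)) J μs)
    -- `[χ*_{Δ_μ ∩ K}, μ*]` is an integer prime to `p`; note `Δ_μ ∩ K ≤ K_χ`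
    (hmult : ∃ m : ℕ, m.Coprime p ∧
      charInner (fun y : stabInNorm X U K μ =>
        Function.extend Subtype.val χs 0 ((y : normIn X U) : G)) μs = m) :
    CentralOrder J
      (sdBase (gammaOrbit U J χ)) (sdBaseChar (gammaOrbit U J χ) χ)
      (sdSub U (gammaOrbit U J χ) (gammaOrbit_le U J χ))
      (sdSubBase U (gammaOrbit U J χ) (gammaOrbit_le U J χ))
      (sdSubBaseChar U (gammaOrbit U J χ) (gammaOrbit_le U J χ) μ) := by
  have hΛ := gammaOrbit_le U J χ
  -- Lifts exist because every automorphism in Γ_{χ^J} is induced by an element of N_Σ(U).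
  obtain ⟨t, ht⟩ : ∃ t : AutSemidirect (gammaOrbit U J χ) → G, IsLift _ t := by
    refine exists_isLift fun γ hγ => ?_
    rw [← hinduce] at hγ
    obtain ⟨g, -, hg⟩ := hγ
    exact ⟨g, hg⟩
  obtain ⟨d, e, P, Q, h⟩ := Matrix.GeneralLinearGroup.exists_isMatchedPair X J χ hχ U hUintra μ hμ
    hstab p hp K hXK hK χs hχs.irr hχs_ext hχs_stab μs hμs.irr hμs_ext hμs_stab hmult
  have : NeZero d := ⟨h.left_ne_zero⟩
  have : NeZero e := ⟨h.right_ne_zero⟩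
  have hin : ∀ g : sdSub U (gammaOrbit U J χ) (gammaOrbit_le U J χ),
      g ∈ inertia (sdSubBase U _ (gammaOrbit_le U J χ)) (sdSubBaseChar U _ (gammaOrbit_le U J χ) μ) ↔
        (g : AutSemidirect (gammaOrbit U J χ)) ∈ inertia (sdBase _) (sdBaseChar _ χ) := by
    intro g
    have h1 := stab_iff hstab g J.one_mem
    simp only [galAct_one] at h1
    rw [mem_inertia_sdSubBase_iff, mem_inertia_sdBase_iff]
    exact h1.symm
  refine Matrix.GeneralLinearGroup.centralOrder_of_Qab (isGTriple_sdBase hχ)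
    (isGTriple_sdSubBase hχ hμ hstab) (sdBase_sup_sdSub _) (sdBase_inf_sdSub _)
    (centralizer_sdBase_le _ hUnorm) (pairStab_sd_eq hstab)
    (Matrix.GeneralLinearGroup.isProjExt_liftLeft h ht)
    (Matrix.GeneralLinearGroup.isProjExt_liftRight hΛ h ht fun g => (hin g).mp)
    (Matrix.GeneralLinearGroup.trace_liftLeft h ht)
    (Matrix.GeneralLinearGroup.trace_liftRight hΛ h ht) ?_
    (fun c hc => Matrix.GeneralLinearGroup.exists_lift_eq_scalar hΛ h ht hc) ?_
  · intro x y x' y' hx hy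
    obtain ⟨z, -, hz⟩ := Matrix.GeneralLinearGroup.exists_factor_lift hΛ h ht x y x' y' hx hy
    exact ⟨z, hz⟩
  · intro g σ hσ hχ'
    refine Matrix.GeneralLinearGroup.exists_twist_lift hΛ h ht hin g σ hσ hχ' ?_
    have h1 : (g, σ) ∈ pairStab ((MulAut.conjNormal : AutSemidirect (gammaOrbit U J χ) →* _).comp
      (sdSub U (gammaOrbit U J χ) (gammaOrbit_le U J χ)).subtype) J
        (sdBaseChar (gammaOrbit U J χ) χ) := ⟨hσ, hχ'⟩
    rw [pairStab_sd_eq hstab] at h1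
    exact h1.2
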